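/- Let $R$ be a commutative ring and $n\geqslant 2$ an integer. Categories are strict and globular, $s_k,t_k$ denote $k$-sources and $k$-targets, and $\star_k$ denotes composition along $k$-cells, in diagrammatic order. **Linear categories.** For $p\geqslant 1$, a linear $(p,p)$-category over $R$ is a $p$-category in which, for all parallel $(p-1)$-cells $u,v$, the set of $p$-cells from $u$ to $v$ is an $R$-module and all compositions are bilinear. A linear $(p+1,p)$-category is a $(p+1)$-category in which, for all parallel $(p-1)$-cells $u,v$, the sets of $p$-cells and of $(p+1)$-cells with $(p-1)$-source $u$ and $(p-1)$-target $v$ are $R$-modules, such that the $p$-source, $p$-target, identities and $\star_p$ are linear and the $\star_k$ with $k<p$ are bilinear. **Polygraphs.** A globular extension of a $p$-category is a set of generating $(p+1)$-cells, each with parallel $p$-cells as source and target. A $0$-polygraph is a set, and a $(p+1)$-polygraph is a $p$-polygraph $\Sigma$ with a globular extension of the free $p$-category $\Sigma^*$. A linear $(p+1,p)$-polygraph $\Sigma$ is a $p$-polygraph $\Sigma_{\leqslant p}$ with a globular extension $\Sigma_{p+1}$ of the free linear $(p,p)$-category $\Sigma_p^\ell$ on the $p$-category $\Sigma_{\leqslant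 p}^*$; the free linear $(p+1,p)$-category on $\Sigma_p^\ell$ with this extension is denoted $\Sigma^\ell$. The polygraph $\Sigma$ presents a linear $(p,p)$-category $\mathcal C$ if $\mathcal C$ is isomorphic to the quotient of $\Sigma_p^\ell$ by the congruence on $p$-cells (compatible with all compositions and with the linear structure) generated by identifying the source and the target of every element of $\Sigma_{p+1}$. **Decategorification of a category.** Let $\mathcal C$ be a linear $(n,n)$-category over $R$. Two $(n-1)$-cells $u,v$ are isomorphic if there is an $n$-cell $u\to v$ invertible for $\star_{n-1}$. For $(n-1)$-cells $a,b,c$ write $a\simeq b\oplus c$ if there are $n$-cells $p_b:a\to b$, $p_c:a\to c$, $i_b:b\to a$, $i_c:c\to a$ with $p_b\star_{n-1}i_b+p_c\star_{n-1}i_c=1_a$, $i_b\star_{n-1}p_b=1_b$ and $i_c\star_{n-1}p_c=1_c$. The Grothendieck decategorification $K(\mathcal C)$ is the $\mathbb Z$-linear $(n-1,n-1)$-category with the same $k$-cells as $\mathcal C$ for $k<n-1$, in which the group of $(n-1)$-cells from $x$ to $y$ is the free abelian group on the isomorphism classes of $(n-1)$-cells of $\mathcal C$ from $x$ to $y$ modulo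 the relations $[a]=[b]+[c]$ for $a\simeq b\oplus c$, and with the biadditive compositions determined by $[u]\star_k[v]=[u\star_k v]$. **Decategorification of a polygraph.** Let $\Sigma$ be a linear $(n+1,n)$-polygraph over $R$. An isomorphism proof between two distinct $(n-1)$-cells $u,v$ of $\Sigma^\ell$ is a pair $(\alpha_u,\alpha_v)$ of $(n+1)$-cells of $\Sigma^\ell$ such that, for some $n$-cells $a_u:u\to v$ and $a_v:v\to u$, $\alpha_u$ goes from $a_u\star_{n-1}a_v$ to $1_u$ and $\alpha_v$ goes from $a_v\star_{n-1}a_u$ to $1_v$. A direct sum proof of $a\simeq b\oplus c$, for $(n-1)$-cells $a,b,c$ of $\Sigma^\ell$, is a triple $(\alpha_a,\alpha_b,\alpha_c)$ of $(n+1)$-cells of $\Sigma^\ell$ such that, for some $n$-cells $p_b:a\to b$, $p_c:a\to c$, $i_b:b\to a$, $i_c:c\to a$, they go respectively from $p_b\star_{n-1}i_b+p_c\star_{n-1}i_c$ to $1_a$, from $i_b\star_{n-1}p_b$ to $1_b$, and from $i_c\star_{n-1}p_c$ to $1_c$. A proof (of either kind) is minimal if there are no $(n-1)$-cell $w$, no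 integer $k<n-1$ and no proof of the same kind, different from it, from which it is obtained by applying $w\star_k-$ to all components or $-\star_k w$ to all components. The Grothendieck decategorification $K(\Sigma)$ is the $\mathbb Z$-linear $(n,n-1)$-polygraph with the same generating $k$-cells as $\Sigma$ for $k\leqslant n-1$ and whose generating $n$-cells are: one $n$-cell $u\to v$ for each pair of distinct $(n-1)$-cells $u,v$ of $\Sigma^\ell$ such that there is a minimal isomorphism proof between $u$ and $v$; and one $n$-cell $a\to b+c$ for each triple of $(n-1)$-cells $a,b,c$ of $\Sigma^\ell$ such that there is a minimal direct sum proof of $a\simeq b\oplus c$. **Theorem.** Let $\mathcal C$ be a linear $(n,n)$-category over $R$ presented by a linear $(n+1,n)$-polygraph $\Sigma$. Then the $\mathbb Z$-linear $(n,n-1)$-polygraph $K(\Sigma)$ presents the $\mathbb Z$-linear $(n-1,n-1)$-category $K(\mathcal C)$. -/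

import Mathlib

universe u v w v'

noncomputable section

open scoped Classical

set_option linter.unusedSimpArgs false
set_option linter.style.longLine false

/-- A strict (globular) `n`-category, in one-sorted form. All cells are `n`-cells; a `k`-cell with
`k < n` is identified with the identity `n`-cell on it, so that the `k`-cells are the `f` with
`src k f = f`. `src k` and `tgt k` are the `k`-source and the `k`-target (followed by this
identification), and `comp k f g` is `f ⋆_k g` in diagrammatic order, meaningful only if
`tgt k f = src k g`. For `k ≥ n` the axioms make `src k`, `tgt k` the identity and `comp k` trivial.
 -/
structure NCat (n : ℕ) where
  cell : Type u
  src : ℕ → cell → cell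
  tgt : ℕ → cell → cell
  comp : ℕ → cell → cell → cell
  src_top : ∀ f, src n f = f
  src_src_of_lt : ∀ {j k} f, j < k → src j (src k f) = src j f
  src_tgt_of_lt : ∀ {j k} f, j < k → src j (tgt k f) = src j f
  tgt_src_of_lt : ∀ {j k} f, j < k → tgt j (src k f) = tgt j f
  tgt_tgt_of_lt : ∀ {j k} f, j < k → tgt j (tgt k f) = tgt j f
  src_src_of_le : ∀ {j k} f, j ≤ k → src k (src j f) = src j f
  src_tgt_of_le : ∀ {j k} f, j ≤ k → src k (tgt j f) = tgt j f
  tgt_src_of_le : ∀ {j k} f, j ≤ k → tgt k (src j f) = src j f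
  tgt_tgt_of_le : ∀ {j k} f, j ≤ k → tgt k (tgt j f) = tgt j f
  src_comp : ∀ {k} f g, tgt k f = src k g → src k (comp k f g) = src k f
  tgt_comp : ∀ {k} f g, tgt k f = src k g → tgt k (comp k f g) = tgt k g
  src_comp_of_lt : ∀ {j k} f g, j < k → tgt j f = src j g →
    src k (comp j f g) = comp j (src k f) (src k g)
  tgt_comp_of_lt : ∀ {j k} f g, j < k → tgt j f = src j g →
    tgt k (comp j f g) = comp j (tgt k f) (tgt k g)
  id_comp : ∀ k f, comp k (src k f) f = f
  comp_id : ∀ k f, comp k f (tgt k f) = f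
  assoc : ∀ {k} f g h, tgt k f = src k g → tgt k g = src k h →
    comp k (comp k f g) h = comp k f (comp k g h)
  interchange : ∀ {j k} f g f' g', j < k → tgt k f = src k g → tgt k f' = src k g' →
    tgt j f = src j f' → tgt j g = src j g' →
    comp j (comp k f g) (comp k f' g') = comp k (comp j f f') (comp j g g')

namespace NCat

variable {n : ℕ} (C : NCat.{u} n)

/-- Two cells of dimension `m` are parallel: they have the same sources and targets in all
dimensions below `m`. -/
def Parallel (m : ℕ) (f g : C.cell) : Prop :=
  ∀ k < m, C.src k f = C.src k g ∧ C.tgt k f = C.tgt k g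

/-- `f` and `g` have the same `q`-source and the same `q`-target. -/
def SameHom (q : ℕ) (f g : C.cell) : Prop := C.src q f = C.src q g ∧ C.tgt q f = C.tgt q g

variable {C}

theorem src_of_le {k : ℕ} (f : C.cell) (h : n ≤ k) : C.src k f = f := by
  have := C.src_src_of_le f h
  rwa [C.src_top] at this

theorem tgt_of_le {k : ℕ} (f : C.cell) (h : n ≤ k) : C.tgt k f = f := by
  have := C.tgt_src_of_le f h
  rwa [C.src_top] at this

theorem src_comp_low {j k : ℕ} (f g : C.cell) (h : j < k) (hc : C.tgt k f = C.src k g) :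
    C.src j (C.comp k f g) = C.src j f := by
  rw [← C.src_src_of_lt _ h, C.src_comp _ _ hc, C.src_src_of_lt _ h]

theorem tgt_comp_low {j k : ℕ} (f g : C.cell) (h : j < k) (hc : C.tgt k f = C.src k g) :
    C.tgt j (C.comp k f g) = C.tgt j f := by
  rw [← C.tgt_src_of_lt _ h, C.src_comp _ _ hc, C.tgt_src_of_lt _ h]

theorem tgt_comp_low' {j k : ℕ} (f g : C.cell) (h : j < k) (hc : C.tgt k f = C.src k g) :
    C.tgt j (C.comp k f g) = C.tgt j g := by
  rw [← C.tgt_tgt_of_lt _ h, C.tgt_comp _ _ hc, C.tgt_tgt_of_lt _ h]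

theorem src_comp_low' {j k : ℕ} (f g : C.cell) (h : j < k) (hc : C.tgt k f = C.src k g) :
    C.src j (C.comp k f g) = C.src j g := by
  rw [← C.src_tgt_of_lt _ h, C.tgt_comp _ _ hc, C.src_tgt_of_lt _ h]

theorem Parallel.refl (m : ℕ) (f : C.cell) : C.Parallel m f f := fun _ _ => ⟨rfl, rfl⟩

theorem parallel_src_tgt (m : ℕ) (f : C.cell) : C.Parallel m (C.src m f) (C.tgt m f) := by
  intro k hk
  simp [C.src_src_of_lt _ hk, C.src_tgt_of_lt _ hk, C.tgt_src_of_lt _ hk, C.tgt_tgt_of_lt _ hk]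

theorem src_src_le {k m : ℕ} (h : k ≤ m) (f : C.cell) : C.src k (C.src m f) = C.src k f := by
  rcases h.lt_or_eq with h | rfl
  · exact C.src_src_of_lt _ h
  · exact C.src_src_of_le _ le_rfl

theorem tgt_tgt_le {k m : ℕ} (h : k ≤ m) (f : C.cell) : C.tgt k (C.tgt m f) = C.tgt k f := by
  rcases h.lt_or_eq with h | rfl
  · exact C.tgt_tgt_of_lt _ h
  · exact C.tgt_tgt_of_le _ le_rfl

theorem SameHom.refl (q : ℕ) (f : C.cell) : C.SameHom q f f := ⟨rfl, rfl⟩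

theorem SameHom.src {q k : ℕ} (hk : k ≤ q) {f g : C.cell} (h : C.SameHom q f g) :
    C.src k f = C.src k g := by rw [← src_src_le hk, h.1, src_src_le hk]

theorem SameHom.tgt {q k : ℕ} (hk : k ≤ q) {f g : C.cell} (h : C.SameHom q f g) :
    C.tgt k f = C.tgt k g := by rw [← tgt_tgt_le hk, h.2, tgt_tgt_le hk]

theorem SameHom.comp {q k : ℕ} (hk : k ≤ q) {f f' g g' : C.cell} (h : C.SameHom q f f')
    (h' : C.SameHom q g g') (hc : C.tgt k f = C.src k g) :
    C.SameHom q (C.comp k f g) (C.comp k f' g') := by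
  have hc' : C.tgt k f' = C.src k g' := by rw [← h.tgt hk, ← h'.src hk, hc]
  rcases hk.lt_or_eq with hk | rfl
  · exact ⟨by rw [C.src_comp_of_lt _ _ hk hc, C.src_comp_of_lt _ _ hk hc', h.1, h'.1],
      by rw [C.tgt_comp_of_lt _ _ hk hc, C.tgt_comp_of_lt _ _ hk hc', h.2, h'.2]⟩
  · exact ⟨by rw [C.src_comp _ _ hc, C.src_comp _ _ hc', h.1],
      by rw [C.tgt_comp _ _ hc, C.tgt_comp _ _ hc', h'.2]⟩

/-- Compositions of parallel cells -/
theorem Parallel.comp {m k : ℕ} {f f' g g' : C.cell} (hk : k < m) (hf : C.Parallel m f f')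
    (hg : C.Parallel m g g') (hc : C.tgt k f = C.src k g) :
    C.Parallel m (C.comp k f g) (C.comp k f' g') := by
  have hc' : C.tgt k f' = C.src k g' := by rw [← (hf k hk).2, hc, (hg k hk).1]
  intro j hj
  rcases lt_trichotomy j k with h | rfl | h
  · rw [src_comp_low _ _ h hc, src_comp_low _ _ h hc', tgt_comp_low _ _ h hc,
      tgt_comp_low _ _ h hc']
    exact hf j hj
  · rw [C.src_comp _ _ hc, C.src_comp _ _ hc', C.tgt_comp _ _ hc, C.tgt_comp _ _ hc']
    exact ⟨(hf j hj).1, (hg j hj).2⟩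
  · rw [C.src_comp_of_lt _ _ h hc, C.src_comp_of_lt _ _ h hc', C.tgt_comp_of_lt _ _ h hc,
      C.tgt_comp_of_lt _ _ h hc', (hf j hj).1, (hf j hj).2, (hg j hj).1, (hg j hj).2]
    exact ⟨rfl, rfl⟩

theorem comp_top {k : ℕ} (hk : n ≤ k) (f g : C.cell) (h : C.tgt k f = C.src k g) :
    C.comp k f g = f := by
  rw [src_of_le _ hk] at h
  rw [← h]; exact C.comp_id k f

end NCat

/-- A set of `(n+1)`-cells over the `n`-category `C`, with sources `s`, targets `t`, identities `one`
and compositions, which together with `C` forms an `(n+1)`-category. Only used as a device to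
build one-sorted `(n+1)`-categories. -/
structure CellExt {n : ℕ} (C : NCat.{u} n) where
  cell : Type v
  one : C.cell → cell
  s : cell → C.cell
  t : cell → C.cell
  comp : ℕ → cell → cell → cell
  s_one : ∀ x, s (one x) = x
  t_one : ∀ x, t (one x) = x
  parallel : ∀ f, C.Parallel n (s f) (t f)
  comp_of_lt : ∀ {k} f g, n < k → comp k f g = f
  comp_one : ∀ {k} x y, k < n → C.tgt k x = C.src k y →
    comp k (one x) (one y) = one (C.comp k x y)
  s_comp_top : ∀ f g, t f = s g → s (comp n f g) = s f
  t_comp_top : ∀ f g, t f = s g → t (comp n f g) = t g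
  s_comp : ∀ {k} f g, k < n → C.tgt k (t f) = C.src k (s g) →
    s (comp k f g) = C.comp k (s f) (s g)
  t_comp : ∀ {k} f g, k < n → C.tgt k (t f) = C.src k (s g) →
    t (comp k f g) = C.comp k (t f) (t g)
  id_comp : ∀ {k} f, k ≤ n → comp k (one (C.src k (s f))) f = f
  comp_id : ∀ {k} f, k ≤ n → comp k f (one (C.tgt k (t f))) = f
  assoc : ∀ {k} f g h, k ≤ n → C.tgt k (t f) = C.src k (s g) → C.tgt k (t g) = C.src k (s h) →
    comp k (comp k f g) h = comp k f (comp k g h)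
  interchange : ∀ {j k} f g f' g', j < k → k ≤ n → C.tgt k (t f) = C.src k (s g) →
    C.tgt k (t f') = C.src k (s g') → C.tgt j (t f) = C.src j (s f') →
    C.tgt j (t g) = C.src j (s g') →
    comp j (comp k f g) (comp k f' g') = comp k (comp j f f') (comp j g g')

namespace CellExt

variable {n : ℕ} {C : NCat.{u} n} (X : CellExt.{u, v} C)

def src (k : ℕ) (f : X.cell) : X.cell := if k ≤ n then X.one (C.src k (X.s f)) else f
def tgt (k : ℕ) (f : X.cell) : X.cell := if k ≤ n then X.one (C.tgt k (X.t f)) else f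

variable {X}

theorem one_inj {x y : C.cell} : X.one x = X.one y ↔ x = y :=
  ⟨fun h => by rw [← X.s_one x, h, X.s_one], fun h => h ▸ rfl⟩

theorem composable_iff {k : ℕ} (hk : k ≤ n) (f g : X.cell) :
    X.tgt k f = X.src k g ↔ C.tgt k (X.t f) = C.src k (X.s g) := by
  simp [tgt, src, hk, one_inj]

theorem top_iff (x y : C.cell) : C.tgt n x = C.src n y ↔ x = y := by
  rw [NCat.tgt_of_le _ le_rfl, NCat.src_of_le _ le_rfl]

theorem src_s_comp {k : ℕ} (hk : k ≤ n) (f g : X.cell) (h : C.tgt k (X.t f) = C.src k (X.s g)) :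
    C.src k (X.s (X.comp k f g)) = C.src k (X.s f) := by
  rcases hk.lt_or_eq with hk' | rfl
  · rw [X.s_comp _ _ hk' h, C.src_comp]
    rw [(X.parallel f k hk').2, h]
  · rw [X.s_comp_top _ _ ((top_iff _ _).1 h)]

theorem tgt_t_comp {k : ℕ} (hk : k ≤ n) (f g : X.cell) (h : C.tgt k (X.t f) = C.src k (X.s g)) :
    C.tgt k (X.t (X.comp k f g)) = C.tgt k (X.t g) := by
  rcases hk.lt_or_eq with hk' | rfl
  · rw [X.t_comp _ _ hk' h, C.tgt_comp]
    rw [h, (X.parallel g k hk').1]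
  · rw [X.t_comp_top _ _ ((top_iff _ _).1 h)]

variable (X)

/-- The `(n+1)`-category formed by `C` and the `(n+1)`-cells of `X`. -/
@[reducible] def total : NCat.{v} (n + 1) where
  cell := X.cell
  src := X.src
  tgt := X.tgt
  comp := X.comp
  src_top f := by simp [X.s_one, X.t_one, src]
  src_src_of_lt {j k} f h := by
    by_cases hk : k ≤ n
    · simp [X.s_one, X.t_one, src, hk, h.le.trans hk, C.src_src_of_lt _ h]
    · simp [X.s_one, X.t_one, src, hk]
  src_tgt_of_lt {j k} f h := by
    by_cases hk : k ≤ n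
    · have := (X.parallel f j (h.trans_le hk)).1
      simp [X.s_one, X.t_one, src, tgt, hk, h.le.trans hk, C.src_tgt_of_lt _ h, this]
    · simp [X.s_one, X.t_one, tgt, hk]
  tgt_src_of_lt {j k} f h := by
    by_cases hk : k ≤ n
    · have := (X.parallel f j (h.trans_le hk)).2
      simp [X.s_one, X.t_one, src, tgt, hk, h.le.trans hk, C.tgt_src_of_lt _ h, this]
    · simp [X.s_one, X.t_one, src, hk]
  tgt_tgt_of_lt {j k} f h := by
    by_cases hk : k ≤ n
    · simp [X.s_one, X.t_one, tgt, hk, h.le.trans hk, C.tgt_tgt_of_lt _ h]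
    · simp [X.s_one, X.t_one, tgt, hk]
  src_src_of_le {j k} f h := by
    by_cases hk : k ≤ n
    · simp [X.s_one, X.t_one, src, hk, h.trans hk, C.src_src_of_le _ h]
    · simp [X.s_one, X.t_one, src, hk]
  src_tgt_of_le {j k} f h := by
    by_cases hk : k ≤ n
    · simp [X.s_one, X.t_one, src, tgt, hk, h.trans hk, C.src_tgt_of_le _ h]
    · simp [X.s_one, X.t_one, src, hk]
  tgt_src_of_le {j k} f h := by
    by_cases hk : k ≤ n
    · simp [X.s_one, X.t_one, src, tgt, hk, h.trans hk, C.tgt_src_of_le _ h]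
    · simp [X.s_one, X.t_one, tgt, hk]
  tgt_tgt_of_le {j k} f h := by
    by_cases hk : k ≤ n
    · simp [X.s_one, X.t_one, tgt, hk, h.trans hk, C.tgt_tgt_of_le _ h]
    · simp [X.s_one, X.t_one, tgt, hk]
  src_comp {k} f g h := by
    by_cases hk : k ≤ n
    · rw [composable_iff hk] at h
      simp only [src, hk, if_true]
      rw [src_s_comp hk _ _ h]
    · rw [X.comp_of_lt _ _ (not_le.1 hk)]
  tgt_comp {k} f g h := by
    by_cases hk : k ≤ n
    · rw [composable_iff hk] at h
      simp only [tgt, hk, if_true]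
      rw [tgt_t_comp hk _ _ h]
    · rw [X.comp_of_lt _ _ (not_le.1 hk)]
      simp only [src, tgt, hk, if_false] at h ⊢
      exact h
  src_comp_of_lt {j k} f g hjk h := by
    by_cases hk : k ≤ n
    · have hj : j < n := by omega
      rw [composable_iff hj.le] at h
      simp only [src, hk, if_true]
      rw [X.s_comp _ _ hj h, X.comp_one _ _ hj, C.src_comp_of_lt _ _ hjk]
      · rw [(X.parallel f j hj).2, h]
      · rw [C.tgt_src_of_lt _ hjk, C.src_src_of_lt _ hjk, (X.parallel f j hj).2, h]
    · simp [src, hk]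
  tgt_comp_of_lt {j k} f g hjk h := by
    by_cases hk : k ≤ n
    · have hj : j < n := by omega
      rw [composable_iff hj.le] at h
      simp only [tgt, hk, if_true]
      rw [X.t_comp _ _ hj h, X.comp_one _ _ hj, C.tgt_comp_of_lt _ _ hjk]
      · rw [h, (X.parallel g j hj).1]
      · rw [C.tgt_tgt_of_lt _ hjk, C.src_tgt_of_lt _ hjk, h, (X.parallel g j hj).1]
    · simp [tgt, hk]
  id_comp k f := by
    by_cases hk : k ≤ n
    · simp only [src, hk, if_true, X.id_comp f hk]
    · simp [src, hk, X.comp_of_lt _ _ (not_le.1 hk)]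
  comp_id k f := by
    by_cases hk : k ≤ n
    · simp only [tgt, hk, if_true, X.comp_id f hk]
    · simp [X.comp_of_lt _ _ (not_le.1 hk)]
  assoc {k} f g h h1 h2 := by
    by_cases hk : k ≤ n
    · rw [composable_iff hk] at h1 h2
      exact X.assoc _ _ _ hk h1 h2
    · simp [X.comp_of_lt _ _ (not_le.1 hk)]
  interchange {j k} f g f' g' hjk h1 h2 h3 h4 := by
    by_cases hk : k ≤ n
    · have hj : j ≤ n := by omega
      rw [composable_iff hk] at h1 h2
      rw [composable_iff hj] at h3 h4
      exact X.interchange _ _ _ _ hjk hk h1 h2 h3 h4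
    · simp [X.comp_of_lt _ _ (not_le.1 hk)]

end CellExt

/-- A globular extension of the `n`-category `C`: a set of generating `(n+1)`-cells, each with
parallel `n`-cells as source and target. -/
structure GlobExt {n : ℕ} (C : NCat.{u} n) where
  gen : Type v
  s : gen → C.cell
  t : gen → C.cell
  parallel : ∀ γ, C.Parallel n (s γ) (t γ)

/-- Formal expressions for the `(n+1)`-cells of the free `(n+1)`-category on a globular extension:
identities, generators, and composites. -/
inductive FreeTerm {n : ℕ} (C : NCat.{u} n) (G : GlobExt.{u, v} C) : Type (max u v)
  | one (x : C.cell) : FreeTerm C G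
  | gen (γ : G.gen) : FreeTerm C G
  | comp (k : ℕ) (f g : FreeTerm C G) : FreeTerm C G

namespace FreeTerm

variable {n : ℕ} {C : NCat.{u} n} {G : GlobExt.{u, v} C}

/-- The source of an expression. -/
def src : FreeTerm C G → C.cell
  | one x => x
  | gen γ => G.s γ
  | comp k f g => if k = n then src f else C.comp k (src f) (src g)

/-- The target of an expression. -/
def tgt : FreeTerm C G → C.cell
  | one x => x
  | gen γ => G.t γ
  | comp k f g => if k = n then tgt g else C.comp k (tgt f) (tgt g)

/-- Well-formed expressions: all the composites are defined. -/
def Wf : FreeTerm C G → Prop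
  | one _ => True
  | gen _ => True
  | comp k f g => Wf f ∧ Wf g ∧ k ≤ n ∧ C.tgt k (tgt f) = C.src k (src g)

theorem wf_one (x : C.cell) : (one x : FreeTerm C G).Wf := trivial

theorem wf_comp {k : ℕ} {f g : FreeTerm C G} :
    (comp k f g).Wf ↔ f.Wf ∧ g.Wf ∧ k ≤ n ∧ C.tgt k f.tgt = C.src k g.src := Iff.rfl

theorem parallel : ∀ f : FreeTerm C G, f.Wf → C.Parallel n f.src f.tgt
  | one x, _ => NCat.Parallel.refl n x
  | gen γ, _ => G.parallel γ
  | comp k f g, ⟨hf, hg, hk, hc⟩ => by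
    have pf := parallel f hf
    have pg := parallel g hg
    rcases hk.lt_or_eq with h | rfl
    · simp only [src, tgt, h.ne, if_false]
      exact pf.comp h pg (by rw [(pf k h).2, hc])
    · simp only [src, tgt, if_true]
      rw [NCat.tgt_of_le _ le_rfl, NCat.src_of_le _ le_rfl] at hc
      intro j hj
      rw [(pf j hj).1, (pf j hj).2, hc]
      exact pg j hj

/-- The `k`-source of a `k`-composite. -/
theorem src_comp {k : ℕ} {f g : FreeTerm C G} (h : (comp k f g).Wf) :
    C.src k (comp k f g).src = C.src k f.src := by
  obtain ⟨hf, hg, hk, hc⟩ := h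
  rcases hk.lt_or_eq with h | rfl
  · simp only [src, h.ne, if_false]
    exact C.src_comp _ _ (by rw [((parallel f hf) k h).2, hc])
  · simp [src]

theorem tgt_comp {k : ℕ} {f g : FreeTerm C G} (h : (comp k f g).Wf) :
    C.tgt k (comp k f g).tgt = C.tgt k g.tgt := by
  obtain ⟨hf, hg, hk, hc⟩ := h
  rcases hk.lt_or_eq with h | rfl
  · simp only [tgt, h.ne, if_false]
    exact C.tgt_comp _ _ (by rw [← ((parallel g hg) k h).1, hc])
  · simp [tgt]

/-- The congruence on well-formed expressions generated by the axioms of `(n+1)`-categories and by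
the relations of `C`. -/
inductive Rel : FreeTerm C G → FreeTerm C G → Prop
  | refl {f} : f.Wf → Rel f f
  | symm {f g} : Rel f g → Rel g f
  | trans {f g h} : Rel f g → Rel g h → Rel f h
  | congr {k f f' g g'} : Rel f f' → Rel g g' → (comp k f g).Wf → (comp k f' g').Wf →
      Rel (comp k f g) (comp k f' g')
  | one_comp {k x y} : k < n → C.tgt k x = C.src k y →
      Rel (one (C.comp k x y)) (comp k (one x) (one y))
  | id_comp {k f} : k ≤ n → f.Wf → Rel (comp k (one (C.src k f.src)) f) f
  | comp_id {k f} : k ≤ n → f.Wf → Rel (comp k f (one (C.tgt k f.tgt))) f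
  | assoc {k f g h} : (comp k (comp k f g) h).Wf → (comp k f (comp k g h)).Wf →
      Rel (comp k (comp k f g) h) (comp k f (comp k g h))
  | interchange {j k f g f' g'} : j < k → (comp j (comp k f g) (comp k f' g')).Wf →
      (comp k (comp j f f') (comp j g g')).Wf →
      Rel (comp j (comp k f g) (comp k f' g')) (comp k (comp j f f') (comp j g g'))

theorem Rel.spec {f g : FreeTerm C G} (h : Rel f g) :
    f.Wf ∧ g.Wf ∧ f.src = g.src ∧ f.tgt = g.tgt := by
  induction h with
  | refl h => exact ⟨h, h, rfl, rfl⟩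
  | symm _ ih => exact ⟨ih.2.1, ih.1, ih.2.2.1.symm, ih.2.2.2.symm⟩
  | trans _ _ ih ih' =>
    exact ⟨ih.1, ih'.2.1, ih.2.2.1.trans ih'.2.2.1, ih.2.2.2.trans ih'.2.2.2⟩
  | congr _ _ hw hw' ih ih' =>
    refine ⟨hw, hw', ?_, ?_⟩
    · simp only [src, ih.2.2.1, ih'.2.2.1]
    · simp only [tgt, ih.2.2.2, ih'.2.2.2]
  | one_comp hk hc => exact ⟨trivial, ⟨trivial, trivial, hk.le, hc⟩, by simp [src, hk.ne],
      by simp [tgt, hk.ne]⟩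
  | @id_comp k f hk hf =>
    refine ⟨⟨trivial, hf, hk, by simp [tgt, C.tgt_src_of_le]⟩, hf, ?_, ?_⟩
    · rcases hk.lt_or_eq with h | rfl
      · simp [src, h.ne, C.id_comp]
      · simp [src, C.src_top]
    · rcases hk.lt_or_eq with h | rfl
      · simp [tgt, h.ne, (parallel f hf k h).1, C.id_comp]
      · simp [tgt]
  | @comp_id k f hk hf =>
    refine ⟨⟨hf, trivial, hk, by simp [src, C.src_tgt_of_le]⟩, hf, ?_, ?_⟩
    · rcases hk.lt_or_eq with h | rfl
      · simp [src, h.ne, ← (parallel f hf k h).2, C.comp_id]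
      · simp [src]
    · rcases hk.lt_or_eq with h | rfl
      · simp [tgt, h.ne, C.comp_id]
      · simp [tgt, NCat.tgt_of_le]
  | @assoc k f g h hw hw' =>
    refine ⟨hw, hw', ?_⟩
    obtain ⟨⟨hf, hg, hk, hc⟩, hh, -, hc'⟩ := hw
    rcases hk.lt_or_eq with h | rfl
    · have h1 := hc
      have h2 := hw'.2.1.2.2.2
      simp only [src, tgt, h.ne, if_false]
      constructor
      · exact C.assoc _ _ _ (by rw [(parallel f hf k h).2, h1]) (by rw [(parallel g hg k h).2, h2])
      · exact C.assoc _ _ _ (by rw [h1, (parallel g hg k h).1])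
          (by rw [h2, (parallel _ hh k h).1])
    · simp [src, tgt]
  | @interchange j k f g f' g' hjk hw hw' =>
    refine ⟨hw, hw', ?_⟩
    have hj : j ≠ n := (lt_of_lt_of_le hjk hw'.2.2.1).ne
    have hjn := (lt_of_lt_of_le hjk hw'.2.2.1)
    obtain ⟨⟨hf, hg, hk, hc⟩, ⟨hf', hg', -, hc'⟩, -, -⟩ := hw
    obtain ⟨⟨-, -, -, hd⟩, ⟨-, -, -, hd'⟩, -, -⟩ := hw'
    rcases hk.lt_or_eq with h | rfl
    · simp only [src, tgt, h.ne, hj, if_false]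
      constructor
      · exact C.interchange _ _ _ _ hjk (by rw [(parallel f hf k h).2, hc])
          (by rw [(parallel f' hf' k h).2, hc']) (by rw [(parallel f hf j hjn).2, hd])
          (by rw [(parallel g hg j hjn).2, hd'])
      · exact C.interchange _ _ _ _ hjk (by rw [hc, (parallel g hg k h).1])
          (by rw [hc', (parallel g' hg' k h).1]) (by rw [hd, (parallel f' hf' j hjn).1])
          (by rw [hd', (parallel g' hg' j hjn).1])
    · simp [src, tgt, hj]

variable (C G) in
def setoid : Setoid {f : FreeTerm C G // f.Wf} where
  r f g := Rel f.1 g.1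
  iseqv := ⟨fun f => Rel.refl f.2, Rel.symm, Rel.trans⟩

end FreeTerm

section

variable {n : ℕ} (C : NCat.{u} n) (G : GlobExt.{u, v} C)

/-- The `(n+1)`-cells of the free `(n+1)`-category on the globular extension `G` of `C`. -/
def FreeCell : Type (max u v) := Quotient (FreeTerm.setoid C G)

namespace FreeCell

variable {C G}

def mk (f : FreeTerm C G) (hf : f.Wf) : FreeCell C G := Quotient.mk (FreeTerm.setoid C G) ⟨f, hf⟩

theorem sound {f g : FreeTerm C G} (h : FreeTerm.Rel f g) :
    mk f h.spec.1 = mk g h.spec.2.1 := Quotient.sound h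

def one (x : C.cell) : FreeCell C G := mk (.one x) (FreeTerm.wf_one x)

def s : FreeCell C G → C.cell := Quotient.lift (fun f => f.1.src) fun _ _ h => h.spec.2.2.1
def t : FreeCell C G → C.cell := Quotient.lift (fun f => f.1.tgt) fun _ _ h => h.spec.2.2.2

@[simp] theorem s_mk (f : FreeTerm C G) (hf) : s (mk f hf) = f.src := rfl
@[simp] theorem t_mk (f : FreeTerm C G) (hf) : t (mk f hf) = f.tgt := rfl
@[simp] theorem s_one (x : C.cell) : s (one x : FreeCell C G) = x := rfl
@[simp] theorem t_one (x : C.cell) : t (one x : FreeCell C G) = x := rfl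

def comp (k : ℕ) : FreeCell C G → FreeCell C G → FreeCell C G :=
  Quotient.map₂ (fun f g => if h : k ≤ n ∧ C.tgt k f.1.tgt = C.src k g.1.src then
    ⟨.comp k f.1 g.1, FreeTerm.wf_comp.2 ⟨f.2, g.2, h.1, h.2⟩⟩ else f) (by
      intro f f' hf g g' hg
      have h1 := FreeTerm.Rel.spec hf
      have h2 := FreeTerm.Rel.spec hg
      by_cases h : k ≤ n ∧ C.tgt k f.1.tgt = C.src k g.1.src
      · have h' : k ≤ n ∧ C.tgt k f'.1.tgt = C.src k g'.1.src := by
          rwa [← h1.2.2.2, ← h2.2.2.1]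
        simp only [h, h', and_self, dite_true]
        exact .congr hf hg ⟨f.2, g.2, h.1, h.2⟩ ⟨f'.2, g'.2, h'.1, h'.2⟩
      · have h' : ¬ (k ≤ n ∧ C.tgt k f'.1.tgt = C.src k g'.1.src) := by
          rwa [← h1.2.2.2, ← h2.2.2.1]
        simp only [h, h', dite_false]
        exact hf)

theorem comp_mk {k : ℕ} {f g : FreeTerm C G} (h : (FreeTerm.comp k f g).Wf) :
    comp k (mk f (FreeTerm.wf_comp.1 h).1) (mk g (FreeTerm.wf_comp.1 h).2.1) =
      mk (.comp k f g) h := by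
  have h' := (FreeTerm.wf_comp.1 h).2.2
  exact congrArg (Quotient.mk (FreeTerm.setoid C G)) (dif_pos h')

theorem comp_of_lt {k : ℕ} (h : n < k) (f g : FreeCell C G) : comp k f g = f := by
  induction f, g using Quotient.inductionOn₂ with
  | _ f g => exact congrArg (Quotient.mk (FreeTerm.setoid C G)) (dif_neg fun h' => by
      have := h'.1; omega)

theorem ind {p : FreeCell C G → Prop} (h : ∀ f hf, p (mk f hf)) (f) : p f :=
  Quotient.inductionOn f fun f => h f.1 f.2

theorem parallel (f : FreeCell C G) : C.Parallel n f.s f.t := by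
  induction f using ind with | _ f hf => exact f.parallel hf

theorem comp_one {k : ℕ} (hk : k < n) {x y : C.cell} (h : C.tgt k x = C.src k y) :
    comp k (one x) (one y) = (one (C.comp k x y) : FreeCell C G) :=
  (comp_mk (FreeTerm.wf_comp.2 ⟨FreeTerm.wf_one x, FreeTerm.wf_one y, hk.le, h⟩)).trans (sound (.one_comp hk h)).symm

theorem exists_comp {k : ℕ} (hk : k ≤ n) (f g : FreeCell C G)
    (h : C.tgt k f.t = C.src k g.s) : ∃ a b, ∃ (ha : a.Wf) (hb : b.Wf)
      (hc : (FreeTerm.comp k a b).Wf), f = mk a ha ∧ g = mk b hb ∧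
      comp k f g = mk (.comp k a b) hc := by
  induction f using ind with | _ f hf =>
  induction g using ind with | _ g hg =>
  exact ⟨f, g, hf, hg, FreeTerm.wf_comp.2 ⟨hf, hg, hk, h⟩, rfl, rfl,
    comp_mk (FreeTerm.wf_comp.2 ⟨hf, hg, hk, h⟩)⟩

theorem s_comp_n (f g : FreeCell C G) (h : f.t = g.s) : (comp n f g).s = f.s := by
  obtain ⟨a, b, ha, hb, hc, rfl, rfl, e⟩ := exists_comp le_rfl f g (by
    rw [h, NCat.tgt_of_le _ le_rfl, NCat.src_of_le _ le_rfl])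
  simp [e, FreeTerm.src]

theorem t_comp_n (f g : FreeCell C G) (h : f.t = g.s) : (comp n f g).t = g.t := by
  obtain ⟨a, b, ha, hb, hc, rfl, rfl, e⟩ := exists_comp le_rfl f g (by
    rw [h, NCat.tgt_of_le _ le_rfl, NCat.src_of_le _ le_rfl])
  simp [e, FreeTerm.tgt]

theorem s_comp {k : ℕ} (hk : k < n) (f g : FreeCell C G) (h : C.tgt k f.t = C.src k g.s) :
    (comp k f g).s = C.comp k f.s g.s := by
  obtain ⟨a, b, ha, hb, hc, rfl, rfl, e⟩ := exists_comp hk.le f g h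
  simp [e, FreeTerm.src, hk.ne]

theorem t_comp {k : ℕ} (hk : k < n) (f g : FreeCell C G) (h : C.tgt k f.t = C.src k g.s) :
    (comp k f g).t = C.comp k f.t g.t := by
  obtain ⟨a, b, ha, hb, hc, rfl, rfl, e⟩ := exists_comp hk.le f g h
  simp [e, FreeTerm.tgt, hk.ne]

theorem src_comp' {k : ℕ} (hk : k ≤ n) (f g : FreeCell C G) (h : C.tgt k f.t = C.src k g.s) :
    C.src k (comp k f g).s = C.src k f.s := by
  obtain ⟨a, b, ha, hb, hc, rfl, rfl, e⟩ := exists_comp hk f g h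
  rw [e]; exact FreeTerm.src_comp hc

theorem tgt_comp' {k : ℕ} (hk : k ≤ n) (f g : FreeCell C G) (h : C.tgt k f.t = C.src k g.s) :
    C.tgt k (comp k f g).t = C.tgt k g.t := by
  obtain ⟨a, b, ha, hb, hc, rfl, rfl, e⟩ := exists_comp hk f g h
  rw [e]; exact FreeTerm.tgt_comp hc

end FreeCell

open FreeCell in
/-- The `(n+1)`-cells of the free `(n+1)`-category, with their compositions. -/
def freeCellExt : CellExt.{u, max u v} C where
  cell := FreeCell C G
  one := FreeCell.one
  s := FreeCell.s
  t := FreeCell.t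
  comp := FreeCell.comp
  s_one _ := rfl
  t_one _ := rfl
  parallel := FreeCell.parallel
  comp_of_lt f g h := FreeCell.comp_of_lt h f g
  comp_one _ _ hk h := FreeCell.comp_one hk h
  s_comp_top := s_comp_n
  t_comp_top := t_comp_n
  s_comp f g hk h := FreeCell.s_comp hk f g h
  t_comp f g hk h := FreeCell.t_comp hk f g h
  id_comp {k} f hk := by
    induction f using ind with | _ f hf =>
    have r := FreeTerm.Rel.id_comp hk hf
    exact (comp_mk r.spec.1).trans (sound r)
  comp_id {k} f hk := by
    induction f using ind with | _ f hf =>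
    have r := FreeTerm.Rel.comp_id hk hf
    exact (comp_mk r.spec.1).trans (sound r)
  assoc {k} f g h hk h1 h2 := by
    have h3 := tgt_comp' hk f g h1
    have h4 := src_comp' hk g h h2
    induction f using ind with | _ f hf =>
    induction g using ind with | _ g hg =>
    induction h using ind with | _ h hh =>
    have w1 : (FreeTerm.comp k f g).Wf := FreeTerm.wf_comp.2 ⟨hf, hg, hk, h1⟩
    have w2 : (FreeTerm.comp k g h).Wf := FreeTerm.wf_comp.2 ⟨hg, hh, hk, h2⟩
    rw [comp_mk w1] at h3 ⊢
    rw [comp_mk w2] at h4 ⊢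
    have w3 : (FreeTerm.comp k (FreeTerm.comp k f g) h).Wf :=
      FreeTerm.wf_comp.2 ⟨w1, hh, hk, h3.trans h2⟩
    have w4 : (FreeTerm.comp k f (FreeTerm.comp k g h)).Wf :=
      FreeTerm.wf_comp.2 ⟨hf, w2, hk, h1.trans h4.symm⟩
    rw [comp_mk w3, comp_mk w4]
    exact sound (.assoc w3 w4)
  interchange {j k} f g f' g' hjk hk h1 h2 h3 h4 := by
    have hj : j < n := by omega
    induction f using ind with | _ f hf =>
    induction g using ind with | _ g hg =>
    induction f' using ind with | _ f' hf' =>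
    induction g' using ind with | _ g' hg' =>
    have w1 : (FreeTerm.comp k f g).Wf := FreeTerm.wf_comp.2 ⟨hf, hg, hk, h1⟩
    have w2 : (FreeTerm.comp k f' g').Wf := FreeTerm.wf_comp.2 ⟨hf', hg', hk, h2⟩
    have w3 : (FreeTerm.comp j f f').Wf := FreeTerm.wf_comp.2 ⟨hf, hf', hj.le, h3⟩
    have w4 : (FreeTerm.comp j g g').Wf := FreeTerm.wf_comp.2 ⟨hg, hg', hj.le, h4⟩
    simp only [s_mk, t_mk] at h1 h2 h3 h4
    rw [comp_mk w1, comp_mk w2, comp_mk w3, comp_mk w4]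
    have w5 : (FreeTerm.comp j (FreeTerm.comp k f g) (FreeTerm.comp k f' g')).Wf := by
      refine FreeTerm.wf_comp.2 ⟨w1, w2, hj.le, ?_⟩
      have e1 := FreeTerm.parallel _ w1 j hj
      have e2 := FreeTerm.parallel _ hf j hj
      rw [← C.src_src_of_lt _ hjk, FreeTerm.src_comp w2, C.src_src_of_lt _ hjk,
        ← e1.2, ← C.tgt_src_of_lt _ hjk, FreeTerm.src_comp w1, C.tgt_src_of_lt _ hjk, e2.2, h3]
    have w6 : (FreeTerm.comp k (FreeTerm.comp j f f') (FreeTerm.comp j g g')).Wf := by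
      refine FreeTerm.wf_comp.2 ⟨w3, w4, hk, ?_⟩
      simp only [FreeTerm.src, FreeTerm.tgt, hj.ne, if_false]
      rw [C.tgt_comp_of_lt _ _ hjk, C.src_comp_of_lt _ _ hjk, h1, h2]
      · rw [(FreeTerm.parallel _ hg j hj).2, h4]
      · rw [h3, (FreeTerm.parallel _ hf' j hj).1]
    rw [comp_mk w5, comp_mk w6]
    exact sound (.interchange hjk w5 w6)

/-- The free `(n+1)`-category over the `n`-category `C` with the globular extension `G`. -/
def freeExt : NCat.{max u v} (n + 1) := (freeCellExt C G).total

end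

/-- A set, seen as a `0`-category. -/
def setCat (X : Type u) : NCat.{u} 0 where
  cell := X
  src _ f := f
  tgt _ f := f
  comp _ f _ := f
  src_top _ := rfl
  src_src_of_lt _ _ := rfl
  src_tgt_of_lt _ _ := rfl
  tgt_src_of_lt _ _ := rfl
  tgt_tgt_of_lt _ _ := rfl
  src_src_of_le _ _ := rfl
  src_tgt_of_le _ _ := rfl
  tgt_src_of_le _ _ := rfl
  tgt_tgt_of_le _ _ := rfl
  src_comp _ _ _ := rfl
  tgt_comp _ _ h := h
  src_comp_of_lt _ _ _ _ := rfl
  tgt_comp_of_lt _ _ _ _ := rfl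
  id_comp _ _ := rfl
  comp_id _ _ := rfl
  assoc _ _ _ _ _ := rfl
  interchange _ _ _ _ _ _ _ _ _ := rfl

/-- `n`-polygraphs together with the free `n`-category on each of them, by simultaneous recursion: a
`0`-polygraph is a set, and an `(n+1)`-polygraph is an `n`-polygraph with a globular extension of
the free `n`-category on it. -/
def polData : (n : ℕ) → (P : Type (u + 1)) × (P → NCat.{u} n)
  | 0 => ⟨Type u, setCat⟩
  | n + 1 => ⟨(P : (polData n).1) × GlobExt.{u, u} ((polData n).2 P),
      fun P => freeExt ((polData n).2 P.1) P.2⟩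

/-- `n`-polygraphs. -/
def Pol (n : ℕ) : Type (u + 1) := (polData.{u} n).1

namespace Pol

variable {n : ℕ}

/-- The free `n`-category on an `n`-polygraph. -/
def free (P : Pol.{u} n) : NCat.{u} n := (polData.{u} n).2 P

/-- The underlying `n`-polygraph of an `(n+1)`-polygraph. -/
def lower (P : Pol.{u} (n + 1)) : Pol.{u} n := P.1

/-- The generating `(n+1)`-cells of an `(n+1)`-polygraph. -/
def top (P : Pol.{u} (n + 1)) : GlobExt.{u, u} P.lower.free := P.2

theorem free_succ (P : Pol.{u} (n + 1)) : P.free = freeExt P.lower.free P.top := rfl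

/-- The `n`-cells of the free `n`-category on the underlying `n`-polygraph as (identity) cells of the
free `(n+1)`-category. -/
def incl (P : Pol.{u} (n + 1)) (x : P.lower.free.cell) : P.free.cell :=
  (FreeCell.one x : FreeCell P.lower.free P.top)

end Pol

/-- A linear `(n,q+1)`-category over `R`: an `n`-category in which, for all parallel `q`-cells `u`
and `v`, the set of cells `f` with `src q f = u` and `tgt q f = v` is an `R`-module with addition
`add`, scalar multiplication `smul` and zero `zero u v`. The maps `src k`, `tgt k` and `⋆_k` are
linear for `k > q`, and `⋆_k` is bilinear for `k ≤ q`. The values of `add f g` for `f` and `g` not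
satisfying `SameHom q f g`, and of `zero u v` for `u`, `v` not parallel `q`-cells, are irrelevant.
For `n = q + 1` these are the linear `(n,n)`-categories, and for `n = q + 2` the linear
`(n,n-1)`-categories. -/
structure LinCat (R : Type w) [CommRing R] (n q : ℕ) extends NCat.{u} n where
  zero : cell → cell → cell
  add : cell → cell → cell
  smul : R → cell → cell
  src_zero : ∀ u v, src q u = u → src q v = v → toNCat.Parallel q u v → src q (zero u v) = u
  tgt_zero : ∀ u v, src q u = u → src q v = v → toNCat.Parallel q u v → tgt q (zero u v) = v
  src_add : ∀ f g, toNCat.SameHom q f g → src q (add f g) = src q f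
  tgt_add : ∀ f g, toNCat.SameHom q f g → tgt q (add f g) = tgt q f
  src_smul : ∀ r f, src q (smul r f) = src q f
  tgt_smul : ∀ r f, tgt q (smul r f) = tgt q f
  add_comm : ∀ f g, toNCat.SameHom q f g → add f g = add g f
  add_assoc : ∀ f g h, toNCat.SameHom q f g → toNCat.SameHom q g h →
    add (add f g) h = add f (add g h)
  add_zero : ∀ f, add f (zero (src q f) (tgt q f)) = f
  smul_add : ∀ r f g, toNCat.SameHom q f g → smul r (add f g) = add (smul r f) (smul r g)
  add_smul : ∀ r r' f, smul (r + r') f = add (smul r f) (smul r' f)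
  mul_smul : ∀ r r' f, smul (r * r') f = smul r (smul r' f)
  one_smul : ∀ f, smul 1 f = f
  zero_smul : ∀ f, smul 0 f = zero (src q f) (tgt q f)
  src_add_of_lt : ∀ {k} f g, q < k → toNCat.SameHom q f g →
    src k (add f g) = add (src k f) (src k g)
  tgt_add_of_lt : ∀ {k} f g, q < k → toNCat.SameHom q f g →
    tgt k (add f g) = add (tgt k f) (tgt k g)
  src_smul_of_lt : ∀ {k} r f, q < k → src k (smul r f) = smul r (src k f)
  tgt_smul_of_lt : ∀ {k} r f, q < k → tgt k (smul r f) = smul r (tgt k f)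
  comp_add_of_lt : ∀ {k} f g f' g', q < k → tgt k f = src k g → tgt k f' = src k g' →
    toNCat.SameHom q f f' → comp k (add f f') (add g g') = add (comp k f g) (comp k f' g')
  comp_smul_of_lt : ∀ {k} r f g, q < k → tgt k f = src k g →
    comp k (smul r f) (smul r g) = smul r (comp k f g)
  add_comp : ∀ {k} f f' g, k ≤ q → tgt k f = src k g → toNCat.SameHom q f f' →
    comp k (add f f') g = add (comp k f g) (comp k f' g)
  comp_add : ∀ {k} f g g', k ≤ q → tgt k f = src k g → toNCat.SameHom q g g' →
    comp k f (add g g') = add (comp k f g) (comp k f g')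
  smul_comp : ∀ {k} r f g, k ≤ q → tgt k f = src k g →
    comp k (smul r f) g = smul r (comp k f g)
  comp_smul : ∀ {k} r f g, k ≤ q → tgt k f = src k g →
    comp k f (smul r g) = smul r (comp k f g)

namespace LinCat

variable {R : Type w} [CommRing R] {n q : ℕ} (C : LinCat.{u} R n q)

theorem src_add' {k : ℕ} (hk : k ≤ q) (f g : C.cell) (h : C.SameHom q f g) : C.src k (C.add f g) = C.src k f := by
  rw [← NCat.src_src_le hk, C.src_add _ _ h, NCat.src_src_le hk]

theorem tgt_add' {k : ℕ} (hk : k ≤ q) (f g : C.cell) (h : C.SameHom q f g) : C.tgt k (C.add f g) = C.tgt k f := by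
  rw [← NCat.tgt_tgt_le hk, C.tgt_add _ _ h, NCat.tgt_tgt_le hk]

theorem src_smul' {k : ℕ} (hk : k ≤ q) (a : R) (f : C.cell) : C.src k (C.smul a f) = C.src k f := by
  rw [← NCat.src_src_le hk, C.src_smul, NCat.src_src_le hk]

theorem tgt_smul' {k : ℕ} (hk : k ≤ q) (a : R) (f : C.cell) : C.tgt k (C.smul a f) = C.tgt k f := by
  rw [← NCat.tgt_tgt_le hk, C.tgt_smul, NCat.tgt_tgt_le hk]

end LinCat

/-- An isomorphism of linear `(n,q+1)`-categories. -/
structure LinIso {R : Type w} [CommRing R] {n q : ℕ} (C : LinCat.{u} R n q)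
    (D : LinCat.{v} R n q) extends C.cell ≃ D.cell where
  map_src : ∀ k f, toFun (C.src k f) = D.src k (toFun f)
  map_tgt : ∀ k f, toFun (C.tgt k f) = D.tgt k (toFun f)
  map_comp : ∀ k f g, C.tgt k f = C.src k g → toFun (C.comp k f g) = D.comp k (toFun f) (toFun g)
  map_add : ∀ f g, C.SameHom q f g → toFun (C.add f g) = D.add (toFun f) (toFun g)
  map_smul : ∀ r f, toFun (C.smul r f) = D.smul r (toFun f)

/-! ### The free linear `(n+1,n+1)`-category on an `(n+1)`-category -/

/-- A cell of the free linear `(n+1,n+1)`-category on the `(n+1)`-category `D`: parallel `n`-cells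
`s` and `t` of `D`, and a formal linear combination `m` of `(n+1)`-cells of `D` from `s` to `t`. -/
@[ext]
structure LinCell {n : ℕ} (R : Type w) [CommRing R] (D : NCat.{u} (n + 1)) where
  s : D.cell
  t : D.cell
  m : D.cell →₀ R
  src_s : D.src n s = s
  src_t : D.src n t = t
  par : D.Parallel n s t
  supp : ∀ f ∈ m.support, D.src n f = s ∧ D.tgt n f = t

namespace LinCell

variable {n : ℕ} {R : Type w} [CommRing R] {D : NCat.{u} (n + 1)}

/-- The cell of the free linear `(n+1,n+1)`-category given by a cell of `D`. -/
def ofCell (f : D.cell) : LinCell R D where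
  s := D.src n f
  t := D.tgt n f
  m := Finsupp.single f 1
  src_s := D.src_src_of_le _ le_rfl
  src_t := D.src_tgt_of_le _ le_rfl
  par := D.parallel_src_tgt n f
  supp g hg := by
    have := Finsupp.support_single_subset hg
    simp only [Finset.mem_singleton] at this
    subst this; exact ⟨rfl, rfl⟩

/-- The bilinear extension of the `k`-composition to linear combinations. -/
def bil (k : ℕ) (m m' : D.cell →₀ R) : D.cell →₀ R :=
  m.sum fun f a => m'.sum fun g b => Finsupp.single (D.comp k f g) (a * b)

theorem bil_sum {M : Type*} [AddCommMonoid M] (k : ℕ) (m m' : D.cell →₀ R) (h : D.cell → R → M)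
    (h0 : ∀ f, h f 0 = 0) (ha : ∀ f a b, h f (a + b) = h f a + h f b) :
    (bil k m m').sum h = m.sum fun f a => m'.sum fun g b => h (D.comp k f g) (a * b) := by
  unfold bil
  rw [Finsupp.sum_sum_index h0 ha]
  refine Finsupp.sum_congr fun f _ => ?_
  rw [Finsupp.sum_sum_index h0 ha]
  refine Finsupp.sum_congr fun g _ => ?_
  rw [Finsupp.sum_single_index (h0 _)]

theorem add_bil (k : ℕ) (m₁ m₂ m' : D.cell →₀ R) :
    bil k (m₁ + m₂) m' = bil k m₁ m' + bil k m₂ m' := by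
  unfold bil
  rw [Finsupp.sum_add_index' (by simp)]
  intro f a b
  rw [← Finsupp.sum_add]
  refine Finsupp.sum_congr fun g _ => ?_
  rw [add_mul, Finsupp.single_add]

theorem bil_add (k : ℕ) (m m₁ m₂ : D.cell →₀ R) :
    bil k m (m₁ + m₂) = bil k m m₁ + bil k m m₂ := by
  unfold bil
  rw [← Finsupp.sum_add]
  refine Finsupp.sum_congr fun f _ => ?_
  rw [Finsupp.sum_add_index' (by simp)]
  intro g a b
  rw [mul_add, Finsupp.single_add]

theorem smul_bil (k : ℕ) (r : R) (m m' : D.cell →₀ R) : bil k (r • m) m' = r • bil k m m' := by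
  unfold bil
  rw [Finsupp.sum_smul_index (by simp), Finsupp.smul_sum]
  refine Finsupp.sum_congr fun f _ => ?_
  rw [Finsupp.smul_sum]
  refine Finsupp.sum_congr fun g _ => ?_
  rw [Finsupp.smul_single, smul_eq_mul, mul_assoc]

theorem bil_smul (k : ℕ) (r : R) (m m' : D.cell →₀ R) : bil k m (r • m') = r • bil k m m' := by
  unfold bil
  rw [Finsupp.smul_sum]
  refine Finsupp.sum_congr fun f _ => ?_
  rw [Finsupp.sum_smul_index (by simp), Finsupp.smul_sum]
  refine Finsupp.sum_congr fun g _ => ?_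
  rw [Finsupp.smul_single, smul_eq_mul, mul_left_comm]

theorem bil_single (k : ℕ) (f g : D.cell) (a b : R) :
    bil k (Finsupp.single f a) (Finsupp.single g b) = Finsupp.single (D.comp k f g) (a * b) := by
  unfold bil
  rw [Finsupp.sum_single_index (by simp), Finsupp.sum_single_index (by simp)]

theorem mem_bil {k : ℕ} {m m' : D.cell →₀ R} {x : D.cell} (hx : x ∈ (bil k m m').support) :
    ∃ f ∈ m.support, ∃ g ∈ m'.support, x = D.comp k f g := by
  unfold bil at hx
  obtain ⟨f, hf, hx⟩ := Finset.mem_biUnion.1 (Finsupp.support_sum hx)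
  obtain ⟨g, hg, hx⟩ := Finset.mem_biUnion.1 (Finsupp.support_sum hx)
  exact ⟨f, hf, g, hg, by simpa using Finsupp.support_single_subset hx⟩

def src (k : ℕ) (c : LinCell R D) : LinCell R D := if k ≤ n then ofCell (D.src k c.s) else c
def tgt (k : ℕ) (c : LinCell R D) : LinCell R D := if k ≤ n then ofCell (D.tgt k c.t) else c

theorem composable {k : ℕ} {c d : LinCell R D} (hk : k ≤ n) (h : D.tgt k c.t = D.src k d.s)
    {f g : D.cell} (hf : f ∈ c.m.support) (hg : g ∈ d.m.support) : D.tgt k f = D.src k g := by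
  obtain ⟨-, h1⟩ := c.supp f hf
  obtain ⟨h2, -⟩ := d.supp g hg
  rw [← h1, ← h2] at h
  rcases hk.lt_or_eq with hk | rfl
  · rwa [D.tgt_tgt_of_lt _ hk, D.src_src_of_lt _ hk] at h
  · rwa [D.tgt_tgt_of_le _ le_rfl, D.src_src_of_le _ le_rfl] at h

theorem src_eq {k : ℕ} (hk : k ≤ n) (f : D.cell) : D.src k (D.src n f) = D.src k f := by
  rcases hk.lt_or_eq with hk | rfl
  · exact D.src_src_of_lt _ hk
  · exact D.src_src_of_le _ le_rfl

theorem tgt_eq {k : ℕ} (hk : k ≤ n) (f : D.cell) : D.tgt k (D.tgt n f) = D.tgt k f := by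
  rcases hk.lt_or_eq with hk | rfl
  · exact D.tgt_tgt_of_lt _ hk
  · exact D.tgt_tgt_of_le _ le_rfl

theorem tgt_s {k : ℕ} (hk : k < n) (c : LinCell R D) : D.tgt k c.s = D.tgt k c.t :=
  (c.par k hk).2

theorem src_s' {k : ℕ} (hk : k < n) (c : LinCell R D) : D.src k c.s = D.src k c.t :=
  (c.par k hk).1

theorem tgt_of_src {f : D.cell} (h : D.src n f = f) : D.tgt n f = f := by
  rw [← h, D.tgt_src_of_le _ le_rfl]

/-- The composite of two `k`-composable cells. -/
def compAux (k : ℕ) (c d : LinCell R D) (hk : k ≤ n) (h : D.tgt k c.t = D.src k d.s) :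
    LinCell R D where
  s := if k = n then c.s else D.comp k c.s d.s
  t := if k = n then d.t else D.comp k c.t d.t
  m := bil k c.m d.m
  src_s := by
    rcases hk.lt_or_eq with hk | rfl
    · simp only [hk.ne, if_false]
      rw [D.src_comp_of_lt _ _ hk (by rw [c.tgt_s hk, h]), c.src_s, d.src_s]
    · simpa using c.src_s
  src_t := by
    rcases hk.lt_or_eq with hk | rfl
    · simp only [hk.ne, if_false]
      rw [D.src_comp_of_lt _ _ hk (by rw [h, d.src_s' hk]), c.src_t, d.src_t]
    · simpa using d.src_t
  par := by
    rcases hk.lt_or_eq with hk | rfl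
    · simp only [hk.ne, if_false]
      exact c.par.comp hk d.par (by rw [c.tgt_s hk, h])
    · simp only [if_true]
      rw [tgt_of_src c.src_t, d.src_s] at h
      intro j hj
      rw [(c.par j hj).1, (c.par j hj).2, h]
      exact d.par j hj
  supp := by
    intro x hx
    obtain ⟨f, hf, g, hg, rfl⟩ := mem_bil hx
    have hc := composable hk h hf hg
    obtain ⟨h1, h2⟩ := c.supp f hf
    obtain ⟨h3, h4⟩ := d.supp g hg
    rcases hk.lt_or_eq with hk | rfl
    · simp only [hk.ne, if_false]
      rw [D.src_comp_of_lt _ _ hk hc, D.tgt_comp_of_lt _ _ hk hc, h1, h2, h3, h4]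
      exact ⟨rfl, rfl⟩
    · simp only [if_true]
      rw [D.src_comp _ _ hc, D.tgt_comp _ _ hc]
      exact ⟨h1, h4⟩

def comp (k : ℕ) (c d : LinCell R D) : LinCell R D :=
  if h : k ≤ n ∧ D.tgt k c.t = D.src k d.s then compAux k c d h.1 h.2 else c

theorem comp_eq {k : ℕ} {c d : LinCell R D} (hk : k ≤ n) (h : D.tgt k c.t = D.src k d.s) :
    comp k c d = compAux k c d hk h := dif_pos ⟨hk, h⟩

theorem comp_of_lt {k : ℕ} (hk : n < k) (c d : LinCell R D) : comp k c d = c :=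
  dif_neg fun h => by have := h.1; omega

theorem ofCell_inj {f g : D.cell} (hf : D.src n f = f) (hg : D.src n g = g) :
    (ofCell f : LinCell R D) = ofCell g ↔ f = g := by
  refine ⟨fun h => ?_, fun h => h ▸ rfl⟩
  have : D.src n f = D.src n g := congrArg LinCell.s h
  rwa [hf, hg] at this

theorem composable_iff {k : ℕ} (hk : k ≤ n) (c d : LinCell R D) :
    tgt k c = src k d ↔ D.tgt k c.t = D.src k d.s := by
  simp only [tgt, src, hk, if_true]
  exact ofCell_inj (D.src_tgt_of_le _ hk) (D.src_src_of_le _ hk)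

theorem s_ofCell_src {k : ℕ} (hk : k ≤ n) (f : D.cell) :
    (ofCell (D.src k f) : LinCell R D).s = D.src k f := D.src_src_of_le _ hk
theorem t_ofCell_src {k : ℕ} (hk : k ≤ n) (f : D.cell) :
    (ofCell (D.src k f) : LinCell R D).t = D.src k f := D.tgt_src_of_le _ hk
theorem s_ofCell_tgt {k : ℕ} (hk : k ≤ n) (f : D.cell) :
    (ofCell (D.tgt k f) : LinCell R D).s = D.tgt k f := D.src_tgt_of_le _ hk
theorem t_ofCell_tgt {k : ℕ} (hk : k ≤ n) (f : D.cell) :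
    (ofCell (D.tgt k f) : LinCell R D).t = D.tgt k f := D.tgt_tgt_of_le _ hk

theorem s_src {k : ℕ} (hk : k ≤ n) (c : LinCell R D) : (src k c).s = D.src k c.s := by
  simp only [src, hk, if_true, s_ofCell_src]
theorem t_src {k : ℕ} (hk : k ≤ n) (c : LinCell R D) : (src k c).t = D.src k c.s := by
  simp only [src, hk, if_true, t_ofCell_src]
theorem s_tgt {k : ℕ} (hk : k ≤ n) (c : LinCell R D) : (tgt k c).s = D.tgt k c.t := by
  simp only [tgt, hk, if_true, s_ofCell_tgt]
theorem t_tgt {k : ℕ} (hk : k ≤ n) (c : LinCell R D) : (tgt k c).t = D.tgt k c.t := by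
  simp only [tgt, hk, if_true, t_ofCell_tgt]

/-- The composite of two cells of `D`. -/
theorem comp_ofCell {k : ℕ} (hk : k < n) {f g : D.cell} (hf : D.src n f = f) (hg : D.src n g = g)
    (h : D.tgt k f = D.src k g) :
    comp k (ofCell f) (ofCell g) = (ofCell (D.comp k f g) : LinCell R D) := by
  have h' : D.tgt k (ofCell f : LinCell R D).t = D.src k (ofCell g : LinCell R D).s := by
    rw [show (ofCell f : LinCell R D).t = D.tgt n f from rfl, tgt_of_src hf]
    rw [show (ofCell g : LinCell R D).s = D.src n g from rfl, hg, h]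
  rw [comp_eq hk.le h']
  ext1
  · simp only [compAux, hk.ne, if_false, ofCell]
    rw [D.src_comp_of_lt _ _ hk h]
  · simp only [compAux, hk.ne, if_false, ofCell]
    rw [D.tgt_comp_of_lt _ _ hk h]
  · simp only [compAux, ofCell, bil_single, mul_one]

theorem bil_assoc {k : ℕ} (m m' m'' : D.cell →₀ R)
    (h : ∀ f ∈ m.support, ∀ g ∈ m'.support, D.tgt k f = D.src k g)
    (h' : ∀ f ∈ m'.support, ∀ g ∈ m''.support, D.tgt k f = D.src k g) :
    bil k (bil k m m') m'' = bil k m (bil k m' m'') := by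
  rw [bil, bil_sum _ _ _ _ (by simp) (by
    intro f a b
    simp only [add_mul, Finsupp.single_add, Finsupp.sum_add])]
  rw [bil]
  refine Finsupp.sum_congr fun f hf => ?_
  rw [bil_sum _ _ _ _ (by simp) (by intro f a b; simp only [mul_add, Finsupp.single_add])]
  refine Finsupp.sum_congr fun g hg => ?_
  refine Finsupp.sum_congr fun x hx => ?_
  rw [D.assoc _ _ _ (h f hf g hg) (h' g hg x hx), mul_assoc]

theorem bil_interchange {j k : ℕ} (hjk : j < k) (m₁ m₂ m₃ m₄ : D.cell →₀ R)
    (h : ∀ f ∈ m₁.support, ∀ g ∈ m₂.support, D.tgt k f = D.src k g)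
    (h' : ∀ f ∈ m₃.support, ∀ g ∈ m₄.support, D.tgt k f = D.src k g)
    (h1 : ∀ f ∈ m₁.support, ∀ g ∈ m₃.support, D.tgt j f = D.src j g)
    (h2 : ∀ f ∈ m₂.support, ∀ g ∈ m₄.support, D.tgt j f = D.src j g) :
    bil j (bil k m₁ m₂) (bil k m₃ m₄) = bil k (bil j m₁ m₃) (bil j m₂ m₄) := by
  have key : ∀ (i l : ℕ) (a b c d : D.cell →₀ R), bil i (bil l a b) (bil l c d) =
      a.sum fun f r => b.sum fun g r' => c.sum fun f' s => d.sum fun g' s' =>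
        Finsupp.single (D.comp i (D.comp l f g) (D.comp l f' g')) ((r * r') * (s * s')) := by
    intro i l a b c d
    rw [bil, bil_sum _ _ _ _ (by simp) (by
      intro f a b
      simp only [add_mul, Finsupp.single_add, Finsupp.sum_add])]
    refine Finsupp.sum_congr fun f _ => Finsupp.sum_congr fun g _ => ?_
    rw [bil_sum _ _ _ _ (by simp) (by intro f a b; simp only [mul_add, Finsupp.single_add])]
  rw [key, key]
  refine Finsupp.sum_congr fun f hf => ?_
  rw [Finsupp.sum_comm]
  refine Finsupp.sum_congr fun f' hf' => Finsupp.sum_congr fun g hg =>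
    Finsupp.sum_congr fun g' hg' => ?_
  rw [D.interchange _ _ _ _ hjk (h f hf g hg) (h' f' hf' g' hg') (h1 f hf f' hf') (h2 g hg g' hg'),
    mul_mul_mul_comm]

def zero (u v : LinCell R D) : LinCell R D :=
  if h : D.Parallel n u.s v.s then ⟨u.s, v.s, 0, u.src_s, v.src_s, h, by simp⟩ else u

def add (c d : LinCell R D) : LinCell R D :=
  ⟨c.s, c.t, if c.s = d.s ∧ c.t = d.t then c.m + d.m else c.m, c.src_s, c.src_t, c.par, by
    intro f hf
    split_ifs at hf with h
    · rcases Finset.mem_union.1 (Finsupp.support_add hf) with h' | h'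
      · exact c.supp f h'
      · rw [h.1, h.2]; exact d.supp f h'
    · exact c.supp f hf⟩

def smul (r : R) (c : LinCell R D) : LinCell R D :=
  ⟨c.s, c.t, r • c.m, c.src_s, c.src_t, c.par, fun f hf => c.supp f (Finsupp.support_smul hf)⟩


theorem add_eq {c d : LinCell R D} (h1 : c.s = d.s) (h2 : c.t = d.t) :
    (add c d).m = c.m + d.m := if_pos ⟨h1, h2⟩

theorem src_comp_s {k : ℕ} (hk : k ≤ n) {c d : LinCell R D} (h : D.tgt k c.t = D.src k d.s) :
    D.src k (comp k c d).s = D.src k c.s := by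
  rw [comp_eq hk h]
  rcases hk.lt_or_eq with hk | rfl
  · simp only [compAux, hk.ne, if_false]
    exact D.src_comp _ _ (by rw [c.tgt_s hk, h])
  · simp only [compAux, if_true]

theorem tgt_comp_t {k : ℕ} (hk : k ≤ n) {c d : LinCell R D} (h : D.tgt k c.t = D.src k d.s) :
    D.tgt k (comp k c d).t = D.tgt k d.t := by
  rw [comp_eq hk h]
  rcases hk.lt_or_eq with hk | rfl
  · simp only [compAux, hk.ne, if_false]
    exact D.tgt_comp _ _ (by rw [h, d.src_s' hk])
  · simp only [compAux, if_true]

theorem sameHom_iff {c d : LinCell R D} :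
    (src n c = src n d ∧ tgt n c = tgt n d) ↔ c.s = d.s ∧ c.t = d.t := by
  simp only [src, tgt, le_rfl, if_true]
  rw [ofCell_inj (D.src_src_of_le _ le_rfl) (D.src_src_of_le _ le_rfl),
    ofCell_inj (D.src_tgt_of_le _ le_rfl) (D.src_tgt_of_le _ le_rfl), c.src_s, d.src_s,
    tgt_of_src c.src_t, tgt_of_src d.src_t]

theorem ext_of {c d : LinCell R D} (h : c.s = d.s ∧ c.t = d.t) (h' : c.m = d.m) : c = d :=
  LinCell.ext h.1 h.2 h'

end LinCell

open LinCell in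
/-- The underlying `(n+1)`-category of the free linear `(n+1,n+1)`-category on `D`. -/
@[reducible] def linNCat {n : ℕ} (R : Type w) [CommRing R] (D : NCat.{u} (n + 1)) :
    NCat.{max u w} (n + 1) where
  cell := LinCell R D
  src := LinCell.src
  tgt := LinCell.tgt
  comp := LinCell.comp
  src_top f := by simp [LinCell.src]
  src_src_of_lt {j k} f h := by
    by_cases hk : k ≤ n
    · have e := s_src hk f
      rw [LinCell.src, e, D.src_src_of_lt _ h]
      simp only [LinCell.src, h.le.trans hk, if_true]
    · simp [LinCell.src, hk]
  src_tgt_of_lt {j k} f h := by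
    by_cases hk : k ≤ n
    · rw [LinCell.src, LinCell.src]
      simp only [h.le.trans hk, if_true, s_tgt hk, D.src_tgt_of_lt _ h,
        f.src_s' (h.trans_le hk)]
    · simp [LinCell.tgt, hk]
  tgt_src_of_lt {j k} f h := by
    by_cases hk : k ≤ n
    · rw [LinCell.tgt, LinCell.tgt]
      simp only [h.le.trans hk, if_true, t_src hk, D.tgt_src_of_lt _ h,
        f.tgt_s (h.trans_le hk)]
    · simp [LinCell.src, hk]
  tgt_tgt_of_lt {j k} f h := by
    by_cases hk : k ≤ n
    · have e := t_tgt hk f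
      rw [LinCell.tgt, e, D.tgt_tgt_of_lt _ h]
      simp only [LinCell.tgt, h.le.trans hk, if_true]
    · simp [LinCell.tgt, hk]
  src_src_of_le {j k} f h := by
    by_cases hk : k ≤ n
    · rw [LinCell.src]
      simp only [hk, if_true, s_src (h.trans hk), D.src_src_of_le _ h]
      simp [LinCell.src, h.trans hk]
    · simp [LinCell.src, hk]
  src_tgt_of_le {j k} f h := by
    by_cases hk : k ≤ n
    · rw [LinCell.src]
      simp only [hk, if_true, s_tgt (h.trans hk), D.src_tgt_of_le _ h]
      simp [LinCell.tgt, h.trans hk]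
    · simp [LinCell.src, hk]
  tgt_src_of_le {j k} f h := by
    by_cases hk : k ≤ n
    · rw [LinCell.tgt]
      simp only [hk, if_true, t_src (h.trans hk), D.tgt_src_of_le _ h]
      simp [LinCell.src, h.trans hk]
    · simp [LinCell.tgt, hk]
  tgt_tgt_of_le {j k} f h := by
    by_cases hk : k ≤ n
    · rw [LinCell.tgt]
      simp only [hk, if_true, t_tgt (h.trans hk), D.tgt_tgt_of_le _ h]
      simp [LinCell.tgt, h.trans hk]
    · simp [LinCell.tgt, hk]
  src_comp {k} f g h := by
    by_cases hk : k ≤ n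
    · rw [composable_iff hk] at h
      simp only [LinCell.src, hk, if_true, src_comp_s hk h]
    · rw [LinCell.comp_of_lt (not_le.1 hk)]
  tgt_comp {k} f g h := by
    by_cases hk : k ≤ n
    · rw [composable_iff hk] at h
      simp only [LinCell.tgt, hk, if_true, tgt_comp_t hk h]
    · rw [LinCell.comp_of_lt (not_le.1 hk)]
      simp only [LinCell.src, LinCell.tgt, hk, if_false] at h ⊢
      exact h
  src_comp_of_lt {j k} f g hjk h := by
    by_cases hk : k ≤ n
    · have hj : j < n := by omega
      rw [composable_iff hj.le] at h
      have h' : D.tgt j f.s = D.src j g.s := by rw [f.tgt_s hj, h]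
      simp only [LinCell.src, hk, if_true]
      rw [comp_ofCell hj (D.src_src_of_le _ hk) (D.src_src_of_le _ hk) (by
        rw [D.tgt_src_of_lt _ hjk, D.src_src_of_lt _ hjk, h']), comp_eq hj.le h,
        ← D.src_comp_of_lt _ _ hjk h']
      simp only [compAux, hj.ne, if_false]
    · simp [LinCell.src, hk]
  tgt_comp_of_lt {j k} f g hjk h := by
    by_cases hk : k ≤ n
    · have hj : j < n := by omega
      rw [composable_iff hj.le] at h
      have h' : D.tgt j f.t = D.src j g.t := by rw [h, g.src_s' hj]
      simp only [LinCell.tgt, hk, if_true]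
      rw [comp_ofCell hj (D.src_tgt_of_le _ hk) (D.src_tgt_of_le _ hk) (by
        rw [D.tgt_tgt_of_lt _ hjk, D.src_tgt_of_lt _ hjk, h']), comp_eq hj.le h,
        ← D.tgt_comp_of_lt _ _ hjk h']
      simp only [compAux, hj.ne, if_false]
    · simp [LinCell.tgt, hk]
  id_comp k f := by
    by_cases hk : k ≤ n
    · have hc : D.tgt k (LinCell.src k f).t = D.src k f.s := by
        rw [t_src hk, D.tgt_src_of_le _ le_rfl]
      rw [comp_eq hk hc]
      have hm : bil k (LinCell.src k f).m f.m = f.m := by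
        simp only [LinCell.src, hk, if_true, ofCell, bil]
        rw [Finsupp.sum_single_index (by simp)]
        conv_rhs => rw [← Finsupp.sum_single f.m]
        refine Finsupp.sum_congr fun g hg => ?_
        rw [one_mul, ← (f.supp g hg).1, src_eq hk, D.id_comp]
      rcases hk.lt_or_eq with h | rfl
      · refine ext_of ⟨?_, ?_⟩ hm
        · simp only [compAux, h.ne, if_false, s_src hk, D.id_comp]
        · simp only [compAux, h.ne, if_false, t_src hk, f.src_s' h, D.id_comp]
      · refine ext_of ⟨?_, ?_⟩ hm
        · simp only [compAux, if_true, s_src le_rfl, f.src_s]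
        · simp only [compAux, if_true]
    · rw [LinCell.comp_of_lt (not_le.1 hk)]; simp [LinCell.src, hk]
  comp_id k f := by
    by_cases hk : k ≤ n
    · have hc : D.tgt k f.t = D.src k (LinCell.tgt k f).s := by
        rw [s_tgt hk, D.src_tgt_of_le _ le_rfl]
      rw [comp_eq hk hc]
      have hm : bil k f.m (LinCell.tgt k f).m = f.m := by
        simp only [LinCell.tgt, hk, if_true, ofCell, bil]
        conv_rhs => rw [← Finsupp.sum_single f.m]
        refine Finsupp.sum_congr fun g hg => ?_
        rw [Finsupp.sum_single_index (by simp), mul_one, ← (f.supp g hg).2, tgt_eq hk, D.comp_id]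
      rcases hk.lt_or_eq with h | rfl
      · refine ext_of ⟨?_, ?_⟩ hm
        · simp only [compAux, h.ne, if_false, s_tgt hk, ← f.tgt_s h, D.comp_id]
        · simp only [compAux, h.ne, if_false, t_tgt hk, D.comp_id]
      · refine ext_of ⟨?_, ?_⟩ hm
        · simp only [compAux, if_true]
        · simp only [compAux, if_true, t_tgt le_rfl, tgt_of_src f.src_t]
    · rw [LinCell.comp_of_lt (not_le.1 hk)]
  assoc {k} f g h h1 h2 := by
    by_cases hk : k ≤ n
    · rw [composable_iff hk] at h1 h2
      have h3 := (tgt_comp_t hk h1).trans h2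
      have h4 := h1.trans (src_comp_s hk h2).symm
      have hm := bil_assoc f.m g.m h.m (fun a ha b hb => composable hk h1 ha hb)
        (fun a ha b hb => composable hk h2 ha hb)
      rw [comp_eq hk h1] at h3 ⊢
      rw [comp_eq hk h2] at h4 ⊢
      rw [comp_eq hk h3, comp_eq hk h4]
      rcases hk.lt_or_eq with hk' | rfl
      · refine ext_of ⟨?_, ?_⟩ hm
        · simp only [compAux, hk'.ne, if_false]
          exact D.assoc _ _ _ (by rw [f.tgt_s hk', h1]) (by rw [g.tgt_s hk', h2])
        · simp only [compAux, hk'.ne, if_false]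
          exact D.assoc _ _ _ (by rw [h1, g.src_s' hk']) (by rw [h2, h.src_s' hk'])
      · refine ext_of ⟨?_, ?_⟩ hm
        · simp only [compAux, if_true]
        · simp only [compAux, if_true]
    · simp [LinCell.comp_of_lt (not_le.1 hk)]
  interchange {j k} f g f' g' hjk h1 h2 h3 h4 := by
    by_cases hk : k ≤ n
    · have hj : j < n := by omega
      rw [composable_iff hk] at h1 h2
      rw [composable_iff hj.le] at h3 h4
      have e3 : D.tgt j f.s = D.src j f'.s := by rw [f.tgt_s hj, h3]
      have e3' : D.tgt j f.t = D.src j f'.t := by rw [h3, f'.src_s' hj]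
      have e4 : D.tgt j g.s = D.src j g'.s := by rw [g.tgt_s hj, h4]
      have e4' : D.tgt j g.t = D.src j g'.t := by rw [h4, g'.src_s' hj]
      have hm := bil_interchange hjk f.m g.m f'.m g'.m
        (fun a ha b hb => composable hk h1 ha hb) (fun a ha b hb => composable hk h2 ha hb)
        (fun a ha b hb => composable hj.le h3 ha hb) (fun a ha b hb => composable hj.le h4 ha hb)
      rw [comp_eq hk h1, comp_eq hk h2, comp_eq hj.le h3, comp_eq hj.le h4]
      have w1 : D.tgt j (compAux k f g hk h1).t = D.src j (compAux k f' g' hk h2).s := by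
        have a1 := tgt_s hj (compAux k f g hk h1)
        have a2 := src_comp_s hk h1
        have a3 := src_comp_s hk h2
        rw [comp_eq hk h1] at a2
        rw [comp_eq hk h2] at a3
        rw [← a1, ← D.tgt_src_of_lt _ hjk, a2, D.tgt_src_of_lt _ hjk, ← D.src_src_of_lt _ hjk,
          a3, D.src_src_of_lt _ hjk, e3]
      have w2 : D.tgt k (compAux j f f' hj.le h3).t = D.src k (compAux j g g' hj.le h4).s := by
        simp only [compAux, hj.ne, if_false]
        rw [D.tgt_comp_of_lt _ _ hjk e3', D.src_comp_of_lt _ _ hjk e4, h1, h2]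
      rw [comp_eq hj.le w1, comp_eq hk w2]
      refine ext_of ?_ hm
      rcases hk.lt_or_eq with hk' | rfl
      · simp only [compAux, hk'.ne, hj.ne, if_false]
        exact ⟨D.interchange _ _ _ _ hjk (by rw [f.tgt_s hk', h1]) (by rw [f'.tgt_s hk', h2]) e3 e4,
          D.interchange _ _ _ _ hjk (by rw [h1, g.src_s' hk']) (by rw [h2, g'.src_s' hk']) e3' e4'⟩
      · simp only [compAux, hj.ne, if_false, if_true, and_self]
    · simp [LinCell.comp_of_lt (not_le.1 hk)]

theorem LinCell.par_of {n : ℕ} {R : Type w} [CommRing R] {D : NCat.{u} (n + 1)}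
    {u v : LinCell R D} (h : (linNCat R D).Parallel n u v) : D.Parallel n u.s v.s := by
  intro k hk
  have a : LinCell.src k u = LinCell.src k v ∧ LinCell.tgt k u = LinCell.tgt k v := h k hk
  simp only [LinCell.src, LinCell.tgt, hk.le, if_true] at a
  rw [ofCell_inj (D.src_src_of_le _ hk.le) (D.src_src_of_le _ hk.le),
    ofCell_inj (D.src_tgt_of_le _ hk.le) (D.src_tgt_of_le _ hk.le)] at a
  rw [u.tgt_s hk, v.tgt_s hk]
  exact a

open LinCell in
/-- The free linear `(n+1,n+1)`-category over `R` on the `(n+1)`-category `D`. -/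
def lin {n : ℕ} (R : Type w) [CommRing R] (D : NCat.{u} (n + 1)) :
    LinCat.{max u w} R (n + 1) n where
  toNCat := linNCat R D
  zero := LinCell.zero
  add := LinCell.add
  smul := LinCell.smul
  src_zero (u : LinCell R D) (v : LinCell R D) hu hv h := by
    have hp := par_of h
    have hz : LinCell.zero u v = ⟨u.s, v.s, 0, u.src_s, v.src_s, hp, by simp⟩ := dif_pos hp
    rw [hz]
    refine Eq.trans ?_ (show LinCell.src n u = u from hu)
    simp only [LinCell.src, le_rfl, if_true]
  tgt_zero (u : LinCell R D) (v : LinCell R D) hu hv h := by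
    have hp := par_of h
    have hz : LinCell.zero u v = ⟨u.s, v.s, 0, u.src_s, v.src_s, hp, by simp⟩ := dif_pos hp
    rw [hz]
    refine Eq.trans ?_ (show LinCell.src n v = v from hv)
    simp only [LinCell.src, LinCell.tgt, le_rfl, if_true, v.src_s, tgt_of_src v.src_s]
  src_add (f : LinCell R D) (g : LinCell R D) h := by simp [linNCat, LinCell.src, LinCell.add]
  tgt_add (f : LinCell R D) (g : LinCell R D) h := by simp [linNCat, LinCell.tgt, LinCell.add]
  src_smul r (f : LinCell R D) := by simp [linNCat, LinCell.src, LinCell.smul]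
  tgt_smul r (f : LinCell R D) := by simp [linNCat, LinCell.tgt, LinCell.smul]
  add_comm (f : LinCell R D) (g : LinCell R D) h := by
    have h := sameHom_iff.1 h
    refine ext_of h ?_
    rw [add_eq h.1 h.2, add_eq h.1.symm h.2.symm]
    exact _root_.add_comm _ _
  add_assoc (f : LinCell R D) (g : LinCell R D) (e : LinCell R D) h h' := by
    have h := sameHom_iff.1 h
    have h' := sameHom_iff.1 h'
    refine ext_of ⟨rfl, rfl⟩ ?_
    have e1 := add_eq (c := LinCell.add f g) (d := e) (h.1.trans h'.1) (h.2.trans h'.2)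
    have e2 := add_eq (c := f) (d := LinCell.add g e) h.1 h.2
    rw [e1, e2, add_eq h.1 h.2, add_eq h'.1 h'.2, _root_.add_assoc]
  add_zero (f : LinCell R D) := by
    have hz : LinCell.zero (LinCell.src n f) (LinCell.tgt n f) =
        ⟨f.s, f.t, 0, f.src_s, f.src_t, f.par, by simp⟩ := by
      have e1 := (s_src le_rfl f).trans f.src_s
      have e2 := (s_tgt le_rfl f).trans (tgt_of_src f.src_t)
      have hp : D.Parallel n (LinCell.src n f).s (LinCell.tgt n f).s := by
        rw [e1, e2]; exact f.par
      exact (dif_pos hp).trans (ext_of ⟨e1, e2⟩ rfl)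
    change LinCell.add f (LinCell.zero (LinCell.src n f) (LinCell.tgt n f)) = f
    rw [hz]
    refine ext_of ⟨rfl, rfl⟩ ?_
    have e := add_eq (c := f) (d := ⟨f.s, f.t, 0, f.src_s, f.src_t, f.par, by simp⟩) rfl rfl
    rw [e]
    exact _root_.add_zero _
  smul_add r (f : LinCell R D) (g : LinCell R D) h := by
    have h := sameHom_iff.1 h
    refine ext_of ⟨rfl, rfl⟩ ?_
    rw [add_eq (by exact h.1) (by exact h.2)]
    simp only [LinCell.smul]
    rw [add_eq h.1 h.2, _root_.smul_add]
  add_smul r r' (f : LinCell R D) := by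
    refine ext_of ⟨rfl, rfl⟩ ?_
    exact (_root_.add_smul _ _ _).trans
      (add_eq (c := LinCell.smul r f) (d := LinCell.smul r' f) rfl rfl).symm
  mul_smul r r' (f : LinCell R D) := ext_of ⟨rfl, rfl⟩ (smul_smul _ _ _).symm
  one_smul (f : LinCell R D) := ext_of ⟨rfl, rfl⟩ (_root_.one_smul _ _)
  zero_smul (f : LinCell R D) := by
    have hz : LinCell.zero (LinCell.src n f) (LinCell.tgt n f) =
        ⟨f.s, f.t, 0, f.src_s, f.src_t, f.par, by simp⟩ := by
      have e1 := (s_src le_rfl f).trans f.src_s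
      have e2 := (s_tgt le_rfl f).trans (tgt_of_src f.src_t)
      have hp : D.Parallel n (LinCell.src n f).s (LinCell.tgt n f).s := by
        rw [e1, e2]; exact f.par
      exact (dif_pos hp).trans (ext_of ⟨e1, e2⟩ rfl)
    change _ = LinCell.zero (LinCell.src n f) (LinCell.tgt n f)
    rw [hz]
    exact ext_of ⟨rfl, rfl⟩ (_root_.zero_smul _ _)
  src_add_of_lt {k} (f : LinCell R D) (g : LinCell R D) h _ := by simp [linNCat, LinCell.src, not_le.2 h]
  tgt_add_of_lt {k} (f : LinCell R D) (g : LinCell R D) h _ := by simp [linNCat, LinCell.tgt, not_le.2 h]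
  src_smul_of_lt {k} r f h := by simp [linNCat, LinCell.src, not_le.2 h]
  tgt_smul_of_lt {k} r f h := by simp [linNCat, LinCell.tgt, not_le.2 h]
  comp_add_of_lt {k} (f : LinCell R D) (g : LinCell R D) (f' : LinCell R D) (g' : LinCell R D) h _ _ _ := by simp only [LinCell.comp_of_lt h]
  comp_smul_of_lt {k} r (f : LinCell R D) (g : LinCell R D) h _ := by simp only [LinCell.comp_of_lt h]
  add_comp {k} (f : LinCell R D) (f' : LinCell R D) (g : LinCell R D) hk hc h := by
    have h := sameHom_iff.1 h
    have hc := (composable_iff hk _ _).1 hc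
    have hc' : D.tgt k f'.t = D.src k g.s := by rw [← h.2, hc]
    change LinCell.comp k (LinCell.add f f') g =
      LinCell.add (LinCell.comp k f g) (LinCell.comp k f' g)
    rw [comp_eq hk hc, comp_eq hk hc', comp_eq hk (by exact hc)]
    refine ext_of ⟨rfl, rfl⟩ ?_
    rw [add_eq (by simp only [compAux, h.1]) (by simp only [compAux, h.2])]
    simp only [compAux]
    rw [add_eq h.1 h.2, add_bil]
  comp_add {k} (f : LinCell R D) (g : LinCell R D) (g' : LinCell R D) hk hc h := by
    have h := sameHom_iff.1 h
    have hc := (composable_iff hk _ _).1 hc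
    have hc' : D.tgt k f.t = D.src k g'.s := by rw [← h.1, hc]
    change LinCell.comp k f (LinCell.add g g') =
      LinCell.add (LinCell.comp k f g) (LinCell.comp k f g')
    rw [comp_eq hk hc, comp_eq hk hc', comp_eq hk (by exact hc)]
    refine ext_of ⟨rfl, rfl⟩ ?_
    rw [add_eq (by simp only [compAux, h.1]) (by simp only [compAux, h.2])]
    simp only [compAux]
    rw [add_eq h.1 h.2, bil_add]
  smul_comp {k} r (f : LinCell R D) (g : LinCell R D) hk hc := by
    have hc := (composable_iff hk _ _).1 hc
    change LinCell.comp k (LinCell.smul r f) g = LinCell.smul r (LinCell.comp k f g)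
    rw [comp_eq hk hc, comp_eq hk (by exact hc)]
    exact ext_of ⟨rfl, rfl⟩ (smul_bil _ _ _ _)
  comp_smul {k} r (f : LinCell R D) (g : LinCell R D) hk hc := by
    have hc := (composable_iff hk _ _).1 hc
    change LinCell.comp k f (LinCell.smul r g) = LinCell.smul r (LinCell.comp k f g)
    rw [comp_eq hk hc, comp_eq hk (by exact hc)]
    exact ext_of ⟨rfl, rfl⟩ (bil_smul _ _ _ _)


/-- Congruences on the `(n+1)`-cells of a linear `(n+1,n+1)`-category. -/
structure LinCong {R : Type w} [CommRing R] {n : ℕ} (C : LinCat.{u} R (n + 1) n) where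
  r : C.cell → C.cell → Prop
  iseqv : Equivalence r
  src_eq : ∀ {f g}, r f g → C.src n f = C.src n g
  tgt_eq : ∀ {f g}, r f g → C.tgt n f = C.tgt n g
  rel_comp : ∀ {k f f' g g'}, k ≤ n → r f f' → r g g' → C.tgt k f = C.src k g →
    r (C.comp k f g) (C.comp k f' g')
  rel_add : ∀ {f f' g g'}, r f f' → r g g' → C.SameHom n f g → r (C.add f g) (C.add f' g')
  rel_smul : ∀ {f f'} (a : R), r f f' → r (C.smul a f) (C.smul a f')

namespace LinCong

variable {R : Type w} [CommRing R] {n : ℕ} {C : LinCat.{u} R (n + 1) n} (E : LinCong C)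

def setoid : Setoid C.cell := ⟨E.r, E.iseqv⟩

def Cell : Type u := Quotient E.setoid

def cls (f : C.cell) : E.Cell := Quotient.mk E.setoid f

variable {E}

theorem src_eq' {k : ℕ} (hk : k ≤ n) {f g : C.cell} (h : E.r f g) : C.src k f = C.src k g := by
  rcases hk.lt_or_eq with hk | rfl
  · rw [← C.src_src_of_lt f hk, E.src_eq h, C.src_src_of_lt _ hk]
  · exact E.src_eq h

theorem tgt_eq' {k : ℕ} (hk : k ≤ n) {f g : C.cell} (h : E.r f g) : C.tgt k f = C.tgt k g := by
  rcases hk.lt_or_eq with hk | rfl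
  · rw [← C.tgt_tgt_of_lt f hk, E.tgt_eq h, C.tgt_tgt_of_lt _ hk]
  · exact E.tgt_eq h

theorem src_rel (k : ℕ) {f g : C.cell} (h : E.r f g) : E.r (C.src k f) (C.src k g) := by
  by_cases hk : k ≤ n
  · rw [src_eq' hk h]; exact E.iseqv.refl _
  · rwa [NCat.src_of_le _ (by omega), NCat.src_of_le _ (by omega)]

theorem tgt_rel (k : ℕ) {f g : C.cell} (h : E.r f g) : E.r (C.tgt k f) (C.tgt k g) := by
  by_cases hk : k ≤ n
  · rw [tgt_eq' hk h]; exact E.iseqv.refl _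
  · rwa [NCat.tgt_of_le _ (by omega), NCat.tgt_of_le _ (by omega)]

variable (E)

def src (k : ℕ) : E.Cell → E.Cell := Quotient.map (C.src k) fun _ _ h => src_rel k h
def tgt (k : ℕ) : E.Cell → E.Cell := Quotient.map (C.tgt k) fun _ _ h => tgt_rel k h

def comp (k : ℕ) : E.Cell → E.Cell → E.Cell :=
  Quotient.map₂ (fun f g => if k ≤ n ∧ C.tgt k f = C.src k g then C.comp k f g else f) (by
    intro f f' hf g g' hg
    by_cases hk : k ≤ n
    · simp only [tgt_eq' hk hf, src_eq' hk hg]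
      split_ifs with h
      · exact E.rel_comp hk hf hg (by rw [tgt_eq' hk hf, src_eq' hk hg, h.2])
      · exact hf
    · simp only [hk, false_and, if_false]
      exact hf)

def add : E.Cell → E.Cell → E.Cell :=
  Quotient.map₂ (fun f g => if C.SameHom n f g then C.add f g else f) (by
    intro f f' hf g g' hg
    have e : C.SameHom n f g ↔ C.SameHom n f' g' := by
      simp only [NCat.SameHom, E.src_eq hf, E.src_eq hg, E.tgt_eq hf, E.tgt_eq hg]
    by_cases h : C.SameHom n f g
    · simp only [h, e.1 h, if_true]
      exact E.rel_add hf hg h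
    · simp only [h, mt e.2 h, if_false]
      exact hf)

def smul (a : R) : E.Cell → E.Cell := Quotient.map (C.smul a) fun _ _ h => E.rel_smul a h

def zero : E.Cell → E.Cell → E.Cell :=
  Quotient.map₂ (fun u v => C.zero (C.src n u) (C.src n v)) (by
    intro f f' hf g g' hg
    simp only [E.src_eq hf, E.src_eq hg]
    exact E.iseqv.refl _)

variable {E}

theorem ind {p : E.Cell → Prop} (h : ∀ f, p (E.cls f)) (f) : p f := Quotient.inductionOn f h

theorem src_mk (k : ℕ) (f : C.cell) : E.src k (E.cls f) = E.cls (C.src k f) := rfl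
theorem tgt_mk (k : ℕ) (f : C.cell) : E.tgt k (E.cls f) = E.cls (C.tgt k f) := rfl
theorem smul_mk (a : R) (f : C.cell) : E.smul a (E.cls f) = E.cls (C.smul a f) := rfl
theorem zero_mk (f g : C.cell) : E.zero (E.cls f) (E.cls g) =
  E.cls (C.zero (C.src n f) (C.src n g)) := rfl

theorem comp_mk {k : ℕ} (hk : k ≤ n) {f g : C.cell} (h : C.tgt k f = C.src k g) :
    E.comp k (E.cls f) (E.cls g) = E.cls (C.comp k f g) :=
  congrArg E.cls (if_pos ⟨hk, h⟩)

theorem comp_of_lt {k : ℕ} (hk : n < k) (f g : E.Cell) : E.comp k f g = f := by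
  induction f using ind with | _ f =>
  induction g using ind with | _ g =>
  exact congrArg E.cls (if_neg fun h => by have := h.1; omega)

theorem add_mk {f g : C.cell} (h : C.SameHom n f g) :
    E.add (E.cls f) (E.cls g) = E.cls (C.add f g) := congrArg E.cls (if_pos h)

theorem rel_of_eq {f g : C.cell} (h : E.cls f = E.cls g) : E.r f g := Quotient.exact h

theorem low {k : ℕ} (hk : k ≤ n) {f g : C.cell} (hf : C.src k f = f) (hg : C.src k g = g)
    (h : E.cls f = E.cls g) : f = g := by
  rw [← hf, ← hg, src_eq' hk (rel_of_eq h)]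

theorem composable {k : ℕ} (hk : k ≤ n) {f g : C.cell}
    (h : E.tgt k (E.cls f) = E.src k (E.cls g)) : C.tgt k f = C.src k g :=
  low hk (C.src_tgt_of_le _ le_rfl) (C.src_src_of_le _ le_rfl) h

theorem sameHom {f g : C.cell} (h : E.src n (E.cls f) = E.src n (E.cls g) ∧
    E.tgt n (E.cls f) = E.tgt n (E.cls g)) : C.SameHom n f g :=
  ⟨low le_rfl (C.src_src_of_le _ le_rfl) (C.src_src_of_le _ le_rfl) h.1,
    low le_rfl (C.src_tgt_of_le _ le_rfl) (C.src_tgt_of_le _ le_rfl) h.2⟩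

variable (E)

@[reducible] def quotNCat : NCat.{u} (n + 1) where
  cell := E.Cell
  src := E.src
  tgt := E.tgt
  comp := E.comp
  src_top f := by induction f using ind with | _ f => rw [src_mk, C.src_top]
  src_src_of_lt {j k} f h := by
    induction f using ind with | _ f => simp only [src_mk, C.src_src_of_lt _ h]
  src_tgt_of_lt {j k} f h := by
    induction f using ind with | _ f => simp only [src_mk, tgt_mk, C.src_tgt_of_lt _ h]
  tgt_src_of_lt {j k} f h := by
    induction f using ind with | _ f => simp only [src_mk, tgt_mk, C.tgt_src_of_lt _ h]
  tgt_tgt_of_lt {j k} f h := by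
    induction f using ind with | _ f => simp only [tgt_mk, C.tgt_tgt_of_lt _ h]
  src_src_of_le {j k} f h := by
    induction f using ind with | _ f => simp only [src_mk, C.src_src_of_le _ h]
  src_tgt_of_le {j k} f h := by
    induction f using ind with | _ f => simp only [src_mk, tgt_mk, C.src_tgt_of_le _ h]
  tgt_src_of_le {j k} f h := by
    induction f using ind with | _ f => simp only [src_mk, tgt_mk, C.tgt_src_of_le _ h]
  tgt_tgt_of_le {j k} f h := by
    induction f using ind with | _ f => simp only [tgt_mk, C.tgt_tgt_of_le _ h]
  src_comp {k} f g h := by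
    by_cases hk : k ≤ n
    · induction f using ind with | _ f =>
      induction g using ind with | _ g =>
      have h := composable hk h
      rw [comp_mk hk h, src_mk, src_mk, C.src_comp _ _ h]
    · rw [comp_of_lt (not_le.1 hk)]
  tgt_comp {k} f g h := by
    by_cases hk : k ≤ n
    · induction f using ind with | _ f =>
      induction g using ind with | _ g =>
      have h := composable hk h
      rw [comp_mk hk h, tgt_mk, tgt_mk, C.tgt_comp _ _ h]
    · rw [comp_of_lt (not_le.1 hk), h]
      induction g using ind with | _ g =>
      rw [src_mk, tgt_mk, NCat.src_of_le _ (by omega), NCat.tgt_of_le _ (by omega)]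
  src_comp_of_lt {j k} f g hjk h := by
    induction f using ind with | _ f =>
    induction g using ind with | _ g =>
    by_cases hj : j ≤ n
    · have h := composable hj h
      rw [comp_mk hj h, src_mk, src_mk, src_mk, C.src_comp_of_lt _ _ hjk h, comp_mk hj]
      rw [C.tgt_src_of_lt _ hjk, C.src_src_of_lt _ hjk, h]
    · simp only [comp_of_lt (not_le.1 hj)]
  tgt_comp_of_lt {j k} f g hjk h := by
    induction f using ind with | _ f =>
    induction g using ind with | _ g =>
    by_cases hj : j ≤ n
    · have h := composable hj h
      rw [comp_mk hj h, tgt_mk, tgt_mk, tgt_mk, C.tgt_comp_of_lt _ _ hjk h, comp_mk hj]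
      rw [C.tgt_tgt_of_lt _ hjk, C.src_tgt_of_lt _ hjk, h]
    · simp only [comp_of_lt (not_le.1 hj)]
  id_comp k f := by
    induction f using ind with | _ f =>
    by_cases hk : k ≤ n
    · rw [src_mk, comp_mk hk (C.tgt_src_of_le _ le_rfl), C.id_comp]
    · rw [comp_of_lt (not_le.1 hk), src_mk, NCat.src_of_le _ (by omega)]
  comp_id k f := by
    induction f using ind with | _ f =>
    by_cases hk : k ≤ n
    · rw [tgt_mk, comp_mk hk (C.src_tgt_of_le _ le_rfl).symm, C.comp_id]
    · rw [comp_of_lt (not_le.1 hk)]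
  assoc {k} f g h h1 h2 := by
    induction f using ind with | _ f =>
    induction g using ind with | _ g =>
    induction h using ind with | _ h =>
    by_cases hk : k ≤ n
    · have h1 := composable hk h1
      have h2 := composable hk h2
      rw [comp_mk hk h1, comp_mk hk h2, comp_mk hk (by rw [C.tgt_comp _ _ h1, h2]),
        comp_mk hk (by rw [C.src_comp _ _ h2, h1]), C.assoc _ _ _ h1 h2]
    · simp only [comp_of_lt (not_le.1 hk)]
  interchange {j k} f g f' g' hjk h1 h2 h3 h4 := by
    induction f using ind with | _ f =>
    induction g using ind with | _ g =>
    induction f' using ind with | _ f' =>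
    induction g' using ind with | _ g' =>
    by_cases hk : k ≤ n
    · have hj : j ≤ n := by omega
      have h1 := composable hk h1
      have h2 := composable hk h2
      have h3 := composable hj h3
      have h4 := composable hj h4
      rw [comp_mk hk h1, comp_mk hk h2, comp_mk hj h3, comp_mk hj h4,
        comp_mk hj (by rw [NCat.tgt_comp_low _ _ hjk h1, NCat.src_comp_low _ _ hjk h2, h3]),
        comp_mk hk (by rw [C.tgt_comp_of_lt _ _ hjk h3, C.src_comp_of_lt _ _ hjk h4, h1, h2]),
        C.interchange _ _ _ _ hjk h1 h2 h3 h4]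
    · simp only [comp_of_lt (not_le.1 hk)]

theorem parallel_mk {f g : C.cell} (h : E.quotNCat.Parallel n (E.cls f) (E.cls g)) :
    C.Parallel n f g := fun _ hk =>
  ⟨low hk.le (C.src_src_of_le _ le_rfl) (C.src_src_of_le _ le_rfl) (h _ hk).1,
    low hk.le (C.src_tgt_of_le _ le_rfl) (C.src_tgt_of_le _ le_rfl) (h _ hk).2⟩

/-- The quotient of a linear `(n+1,n+1)`-category by a congruence on its `(n+1)`-cells. -/
def quot : LinCat.{u} R (n + 1) n where
  toNCat := E.quotNCat
  zero := E.zero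
  add := E.add
  smul := E.smul
  src_zero u v hu hv h := by
    induction u using ind with | _ u =>
    induction v using ind with | _ v =>
    have hp : C.Parallel n (C.src n u) (C.src n v) := fun k hk => by
      simpa only [C.src_src_of_lt _ hk, C.tgt_src_of_lt _ hk] using parallel_mk E h k hk
    dsimp only [quotNCat]
    rw [zero_mk, src_mk, C.src_zero _ _ (C.src_src_of_le _ le_rfl) (C.src_src_of_le _ le_rfl) hp]
    exact hu
  tgt_zero u v hu hv h := by
    induction u using ind with | _ u =>
    induction v using ind with | _ v =>
    have hp : C.Parallel n (C.src n u) (C.src n v) := fun k hk => by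
      simpa only [C.src_src_of_lt _ hk, C.tgt_src_of_lt _ hk] using parallel_mk E h k hk
    dsimp only [quotNCat]
    rw [zero_mk, tgt_mk, C.tgt_zero _ _ (C.src_src_of_le _ le_rfl) (C.src_src_of_le _ le_rfl) hp]
    exact hv
  src_add f g h := by
    induction f using ind with | _ f =>
    induction g using ind with | _ g =>
    have h := sameHom h
    dsimp only [quotNCat]
    rw [add_mk h, src_mk, src_mk, C.src_add _ _ h]
  tgt_add f g h := by
    induction f using ind with | _ f =>
    induction g using ind with | _ g =>
    have h := sameHom h
    dsimp only [quotNCat]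
    rw [add_mk h, tgt_mk, tgt_mk, C.tgt_add _ _ h]
  src_smul a f := by
    induction f using ind with | _ f => dsimp only [quotNCat]; rw [smul_mk, src_mk, src_mk, C.src_smul]
  tgt_smul a f := by
    induction f using ind with | _ f => dsimp only [quotNCat]; rw [smul_mk, tgt_mk, tgt_mk, C.tgt_smul]
  add_comm f g h := by
    induction f using ind with | _ f =>
    induction g using ind with | _ g =>
    have h := sameHom h
    rw [add_mk h, add_mk ⟨h.1.symm, h.2.symm⟩, C.add_comm _ _ h]
  add_assoc f g e h h' := by
    induction f using ind with | _ f =>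
    induction g using ind with | _ g =>
    induction e using ind with | _ e =>
    have h := sameHom h
    have h' := sameHom h'
    have a1 : C.SameHom n (C.add f g) e :=
      ⟨by rw [C.src_add _ _ h, h.1, h'.1], by rw [C.tgt_add _ _ h, h.2, h'.2]⟩
    have a2 : C.SameHom n f (C.add g e) :=
      ⟨by rw [C.src_add _ _ h', h.1], by rw [C.tgt_add _ _ h', h.2]⟩
    rw [add_mk h, add_mk h', add_mk a1, add_mk a2, C.add_assoc _ _ _ h h']
  add_zero f := by
    induction f using ind with | _ f =>
    have e1 := C.src_src_of_le f (le_refl n)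
    have e2 := C.src_tgt_of_le f (le_refl n)
    have hp := C.parallel_src_tgt n f
    dsimp only [quotNCat]
    rw [src_mk, tgt_mk, zero_mk, e1, e2, add_mk, C.add_zero]
    exact ⟨(C.src_zero _ _ e1 e2 hp).symm, (C.tgt_zero _ _ e1 e2 hp).symm⟩
  smul_add a f g h := by
    induction f using ind with | _ f =>
    induction g using ind with | _ g =>
    have h := sameHom h
    rw [add_mk h, smul_mk, smul_mk, smul_mk, add_mk, C.smul_add _ _ _ h]
    exact ⟨by rw [C.src_smul, C.src_smul, h.1], by rw [C.tgt_smul, C.tgt_smul, h.2]⟩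
  add_smul a b f := by
    induction f using ind with | _ f =>
    rw [smul_mk, smul_mk, smul_mk, add_mk, C.add_smul]
    exact ⟨by rw [C.src_smul, C.src_smul], by rw [C.tgt_smul, C.tgt_smul]⟩
  mul_smul a b f := by
    induction f using ind with | _ f => rw [smul_mk, smul_mk, smul_mk, C.mul_smul]
  one_smul f := by induction f using ind with | _ f => rw [smul_mk, C.one_smul]
  zero_smul f := by
    induction f using ind with | _ f =>
    have e1 := C.src_src_of_le f (le_refl n)
    have e2 := C.src_tgt_of_le f (le_refl n)
    dsimp only [quotNCat]
    rw [smul_mk, src_mk, tgt_mk, zero_mk, e1, e2, C.zero_smul]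
  src_add_of_lt {k} f g hk h := by
    rw [NCat.src_of_le (C := E.quotNCat) _ hk, NCat.src_of_le (C := E.quotNCat) _ hk,
      NCat.src_of_le (C := E.quotNCat) _ hk]
  tgt_add_of_lt {k} f g hk h := by
    rw [NCat.tgt_of_le (C := E.quotNCat) _ hk, NCat.tgt_of_le (C := E.quotNCat) _ hk,
      NCat.tgt_of_le (C := E.quotNCat) _ hk]
  src_smul_of_lt {k} a f hk := by
    rw [NCat.src_of_le (C := E.quotNCat) _ hk, NCat.src_of_le (C := E.quotNCat) _ hk]
  tgt_smul_of_lt {k} a f hk := by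
    rw [NCat.tgt_of_le (C := E.quotNCat) _ hk, NCat.tgt_of_le (C := E.quotNCat) _ hk]
  comp_add_of_lt {k} f g f' g' hk _ _ _ := by simp only [comp_of_lt hk]
  comp_smul_of_lt {k} a f g hk _ := by simp only [comp_of_lt hk]
  add_comp {k} f f' g hk hc h := by
    induction f using ind with | _ f =>
    induction f' using ind with | _ f' =>
    induction g using ind with | _ g =>
    have h := sameHom h
    have hc := composable hk hc
    have hc' : C.tgt k f' = C.src k g := by rw [← NCat.SameHom.tgt hk h, hc]
    dsimp only [quotNCat]
    rw [add_mk h, comp_mk hk hc, comp_mk hk hc', comp_mk hk, add_mk, C.add_comp _ _ _ hk hc h]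
    · exact h.comp hk (NCat.SameHom.refl n g) hc
    · rw [C.tgt_add' hk _ _ h, hc]
  comp_add {k} f g g' hk hc h := by
    induction f using ind with | _ f =>
    induction g using ind with | _ g =>
    induction g' using ind with | _ g' =>
    have h := sameHom h
    have hc := composable hk hc
    have hc' : C.tgt k f = C.src k g' := by rw [← NCat.SameHom.src hk h, hc]
    dsimp only [quotNCat]
    rw [add_mk h, comp_mk hk hc, comp_mk hk hc', comp_mk hk, add_mk, C.comp_add _ _ _ hk hc h]
    · exact (NCat.SameHom.refl n f).comp hk h hc
    · rw [C.src_add' hk _ _ h, hc]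
  smul_comp {k} a f g hk hc := by
    induction f using ind with | _ f =>
    induction g using ind with | _ g =>
    have hc := composable hk hc
    dsimp only [quotNCat]
    rw [smul_mk, comp_mk hk hc, smul_mk, comp_mk hk, C.smul_comp _ _ _ hk hc]
    rw [C.tgt_smul' hk, hc]
  comp_smul {k} a f g hk hc := by
    induction f using ind with | _ f =>
    induction g using ind with | _ g =>
    have hc := composable hk hc
    dsimp only [quotNCat]
    rw [smul_mk, comp_mk hk hc, smul_mk, comp_mk hk, C.comp_smul _ _ _ hk hc]
    rw [C.src_smul' hk, hc]

end LinCong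


/-! ### The free linear `(n+2,n+1)`-category on a globular extension -/

/-- Formal expressions for the `(n+2)`-cells of the free linear `(n+2,n+1)`-category on a globular
extension `G` of the linear `(n+1,n+1)`-category `C`. -/
inductive LinTerm {R : Type w} [CommRing R] {n : ℕ} (C : LinCat.{u} R (n + 1) n)
    (G : GlobExt.{u, v} C.toNCat) : Type (max u v w)
  | one (x : C.cell) : LinTerm C G
  | gen (γ : G.gen) : LinTerm C G
  | comp (k : ℕ) (f g : LinTerm C G) : LinTerm C G
  | add (f g : LinTerm C G) : LinTerm C G
  | smul (a : R) (f : LinTerm C G) : LinTerm C G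

namespace LinTerm

variable {R : Type w} [CommRing R] {n : ℕ} {C : LinCat.{u} R (n + 1) n}
  {G : GlobExt.{u, v} C.toNCat}

/-- The source of an expression. -/
def src : LinTerm C G → C.cell
  | one x => x
  | gen γ => G.s γ
  | comp k f g => if k = n + 1 then src f else C.comp k (src f) (src g)
  | add f g => C.add (src f) (src g)
  | smul a f => C.smul a (src f)

/-- The target of an expression. -/
def tgt : LinTerm C G → C.cell
  | one x => x
  | gen γ => G.t γ
  | comp k f g => if k = n + 1 then tgt g else C.comp k (tgt f) (tgt g)
  | add f g => C.add (tgt f) (tgt g)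
  | smul a f => C.smul a (tgt f)

/-- Well-formed expressions: all the composites and sums are defined. -/
def Wf : LinTerm C G → Prop
  | one _ => True
  | gen _ => True
  | comp k f g => Wf f ∧ Wf g ∧ k ≤ n + 1 ∧ C.tgt k (tgt f) = C.src k (src g)
  | add f g => Wf f ∧ Wf g ∧ C.SameHom n (src f) (src g)
  | smul _ f => Wf f

theorem wf_one (x : C.cell) : (one x : LinTerm C G).Wf := trivial

theorem wf_comp {k : ℕ} {f g : LinTerm C G} :
    (comp k f g).Wf ↔ f.Wf ∧ g.Wf ∧ k ≤ n + 1 ∧ C.tgt k f.tgt = C.src k g.src := Iff.rfl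

theorem wf_add {f g : LinTerm C G} :
    (add f g).Wf ↔ f.Wf ∧ g.Wf ∧ C.SameHom n f.src g.src := Iff.rfl

theorem wf_smul {a : R} {f : LinTerm C G} : (smul a f).Wf ↔ f.Wf := Iff.rfl

theorem parallel : ∀ f : LinTerm C G, f.Wf → C.Parallel (n + 1) f.src f.tgt
  | one x, _ => NCat.Parallel.refl _ x
  | gen γ, _ => G.parallel γ
  | comp k f g, ⟨hf, hg, hk, hc⟩ => by
    have pf := parallel f hf
    have pg := parallel g hg
    rcases hk.lt_or_eq with h | rfl
    · simp only [src, tgt, h.ne, if_false]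
      exact pf.comp h pg (by rw [(pf k h).2, hc])
    · simp only [src, tgt, if_true]
      rw [NCat.tgt_of_le _ le_rfl, NCat.src_of_le _ le_rfl] at hc
      intro j hj
      rw [(pf j hj).1, (pf j hj).2, hc]
      exact pg j hj
  | add f g, ⟨hf, hg, hc⟩ => by
    have pf := parallel f hf
    have pg := parallel g hg
    have hc' : C.SameHom n f.tgt g.tgt :=
      ⟨by rw [← (pf n n.lt_succ_self).1, hc.1, (pg n n.lt_succ_self).1],
        by rw [← (pf n n.lt_succ_self).2, hc.2, (pg n n.lt_succ_self).2]⟩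
    intro j hj
    have hj' : j ≤ n := by omega
    simp only [src, tgt, C.src_add' hj' _ _ hc, C.tgt_add' hj' _ _ hc, C.src_add' hj' _ _ hc',
      C.tgt_add' hj' _ _ hc']
    exact pf j hj
  | smul a f, hf => by
    have pf := parallel f hf
    intro j hj
    have hj' : j ≤ n := by omega
    simp only [src, tgt, C.src_smul' hj', C.tgt_smul' hj']
    exact pf j hj

theorem sameHom_tgt {f g : LinTerm C G} (hf : f.Wf) (hg : g.Wf) (h : C.SameHom n f.src g.src) :
    C.SameHom n f.tgt g.tgt :=
  ⟨by rw [← (parallel f hf n n.lt_succ_self).1, h.1, (parallel g hg n n.lt_succ_self).1],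
    by rw [← (parallel f hf n n.lt_succ_self).2, h.2, (parallel g hg n n.lt_succ_self).2]⟩

theorem src_comp {k : ℕ} {f g : LinTerm C G} (h : (comp k f g).Wf) :
    C.src k (comp k f g).src = C.src k f.src := by
  obtain ⟨hf, hg, hk, hc⟩ := h
  rcases hk.lt_or_eq with h | rfl
  · simp only [src, h.ne, if_false]
    exact C.src_comp _ _ (by rw [((parallel f hf) k h).2, hc])
  · simp [src]

theorem tgt_comp {k : ℕ} {f g : LinTerm C G} (h : (comp k f g).Wf) :
    C.tgt k (comp k f g).tgt = C.tgt k g.tgt := by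
  obtain ⟨hf, hg, hk, hc⟩ := h
  rcases hk.lt_or_eq with h | rfl
  · simp only [tgt, h.ne, if_false]
    exact C.tgt_comp _ _ (by rw [← ((parallel g hg) k h).1, hc])
  · simp [tgt]

/-- The congruence on well-formed expressions generated by the axioms of linear
`(n+2,n+1)`-categories and by the relations of `C`. -/
inductive Rel : LinTerm C G → LinTerm C G → Prop
  | refl {f} : f.Wf → Rel f f
  | symm {f g} : Rel f g → Rel g f
  | trans {f g h} : Rel f g → Rel g h → Rel f h
  | congr_comp {k f f' g g'} : Rel f f' → Rel g g' → (comp k f g).Wf → (comp k f' g').Wf →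
      Rel (comp k f g) (comp k f' g')
  | congr_add {f f' g g'} : Rel f f' → Rel g g' → (add f g).Wf → (add f' g').Wf →
      Rel (add f g) (add f' g')
  | congr_smul {a f f'} : Rel f f' → Rel (smul a f) (smul a f')
  | one_comp {k x y} : k ≤ n → C.tgt k x = C.src k y →
      Rel (one (C.comp k x y)) (comp k (one x) (one y))
  | one_add {x y} : C.SameHom n x y → Rel (one (C.add x y)) (add (one x) (one y))
  | one_smul {a x} : Rel (one (C.smul a x)) (smul a (one x))
  | id_comp {k f} : k ≤ n + 1 → f.Wf → Rel (comp k (one (C.src k f.src)) f) f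
  | comp_id {k f} : k ≤ n + 1 → f.Wf → Rel (comp k f (one (C.tgt k f.tgt))) f
  | assoc {k f g h} : (comp k (comp k f g) h).Wf → (comp k f (comp k g h)).Wf →
      Rel (comp k (comp k f g) h) (comp k f (comp k g h))
  | interchange {j k f g f' g'} : j < k → (comp j (comp k f g) (comp k f' g')).Wf →
      (comp k (comp j f f') (comp j g g')).Wf →
      Rel (comp j (comp k f g) (comp k f' g')) (comp k (comp j f f') (comp j g g'))
  | add_comm {f g} : (add f g).Wf → (add g f).Wf → Rel (add f g) (add g f)
  | add_assoc {f g h} : (add (add f g) h).Wf → (add f (add g h)).Wf →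
      Rel (add (add f g) h) (add f (add g h))
  | add_zero {f} : (add f (one (C.zero (C.src n f.src) (C.tgt n f.src)))).Wf →
      Rel (add f (one (C.zero (C.src n f.src) (C.tgt n f.src)))) f
  | smul_add {a f g} : (add f g).Wf → (add (smul a f) (smul a g)).Wf →
      Rel (smul a (add f g)) (add (smul a f) (smul a g))
  | add_smul {a b f} : (add (smul a f) (smul b f)).Wf →
      Rel (smul (a + b) f) (add (smul a f) (smul b f))
  | mul_smul {a b f} : f.Wf → Rel (smul (a * b) f) (smul a (smul b f))
  | unit_smul {f} : f.Wf → Rel (smul 1 f) f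
  | zero_smul {f} : f.Wf → Rel (smul 0 f) (one (C.zero (C.src n f.src) (C.tgt n f.src)))
  | comp_add_top {f g f' g'} : (comp (n + 1) (add f f') (add g g')).Wf →
      (add (comp (n + 1) f g) (comp (n + 1) f' g')).Wf →
      Rel (comp (n + 1) (add f f') (add g g')) (add (comp (n + 1) f g) (comp (n + 1) f' g'))
  | comp_smul_top {a f g} : (comp (n + 1) (smul a f) (smul a g)).Wf → (comp (n + 1) f g).Wf →
      Rel (comp (n + 1) (smul a f) (smul a g)) (smul a (comp (n + 1) f g))
  | add_comp {k f f' g} : k ≤ n → (comp k (add f f') g).Wf →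
      (add (comp k f g) (comp k f' g)).Wf →
      Rel (comp k (add f f') g) (add (comp k f g) (comp k f' g))
  | comp_add {k f g g'} : k ≤ n → (comp k f (add g g')).Wf →
      (add (comp k f g) (comp k f g')).Wf →
      Rel (comp k f (add g g')) (add (comp k f g) (comp k f g'))
  | smul_comp {k a f g} : k ≤ n → (comp k (smul a f) g).Wf → (comp k f g).Wf →
      Rel (comp k (smul a f) g) (smul a (comp k f g))
  | comp_smul {k a f g} : k ≤ n → (comp k f (smul a g)).Wf → (comp k f g).Wf →
      Rel (comp k f (smul a g)) (smul a (comp k f g))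

theorem Rel.spec {f g : LinTerm C G} (h : Rel f g) :
    f.Wf ∧ g.Wf ∧ f.src = g.src ∧ f.tgt = g.tgt := by
  induction h with
  | refl h => exact ⟨h, h, rfl, rfl⟩
  | symm _ ih => exact ⟨ih.2.1, ih.1, ih.2.2.1.symm, ih.2.2.2.symm⟩
  | trans _ _ ih ih' =>
    exact ⟨ih.1, ih'.2.1, ih.2.2.1.trans ih'.2.2.1, ih.2.2.2.trans ih'.2.2.2⟩
  | congr_comp _ _ hw hw' ih ih' =>
    refine ⟨hw, hw', ?_, ?_⟩
    · simp only [src, ih.2.2.1, ih'.2.2.1]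
    · simp only [tgt, ih.2.2.2, ih'.2.2.2]
  | congr_add _ _ hw hw' ih ih' =>
    refine ⟨hw, hw', ?_, ?_⟩
    · simp only [src, ih.2.2.1, ih'.2.2.1]
    · simp only [tgt, ih.2.2.2, ih'.2.2.2]
  | congr_smul _ ih =>
    refine ⟨ih.1, ih.2.1, ?_, ?_⟩
    · simp only [src, ih.2.2.1]
    · simp only [tgt, ih.2.2.2]
  | @one_comp k _ _ hk hc =>
    have : k ≠ n + 1 := by omega
    exact ⟨trivial, ⟨trivial, trivial, by omega, hc⟩, by simp [src, this], by simp [tgt, this]⟩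
  | one_add h => exact ⟨trivial, ⟨trivial, trivial, h⟩, rfl, rfl⟩
  | one_smul => exact ⟨trivial, trivial, rfl, rfl⟩
  | @id_comp k f hk hf =>
    refine ⟨⟨trivial, hf, hk, by simp [tgt, C.tgt_src_of_le]⟩, hf, ?_, ?_⟩
    · rcases hk.lt_or_eq with h | rfl
      · simp [src, h.ne, C.id_comp]
      · simp [src, C.src_top]
    · rcases hk.lt_or_eq with h | rfl
      · simp [tgt, h.ne, (parallel f hf k h).1, C.id_comp]
      · simp [tgt]
  | @comp_id k f hk hf =>
    refine ⟨⟨hf, trivial, hk, by simp [src, C.src_tgt_of_le]⟩, hf, ?_, ?_⟩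
    · rcases hk.lt_or_eq with h | rfl
      · simp [src, h.ne, ← (parallel f hf k h).2, C.comp_id]
      · simp [src]
    · rcases hk.lt_or_eq with h | rfl
      · simp [tgt, h.ne, C.comp_id]
      · simp [tgt, NCat.tgt_of_le]
  | @assoc k f g h hw hw' =>
    refine ⟨hw, hw', ?_⟩
    obtain ⟨⟨hf, hg, hk, hc⟩, hh, -, hc'⟩ := hw
    rcases hk.lt_or_eq with h | rfl
    · have h1 := hc
      have h2 := hw'.2.1.2.2.2
      simp only [src, tgt, h.ne, if_false]
      constructor
      · exact C.assoc _ _ _ (by rw [(parallel f hf k h).2, h1]) (by rw [(parallel g hg k h).2, h2])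
      · exact C.assoc _ _ _ (by rw [h1, (parallel g hg k h).1])
          (by rw [h2, (parallel _ hh k h).1])
    · simp [src, tgt]
  | @interchange j k f g f' g' hjk hw hw' =>
    refine ⟨hw, hw', ?_⟩
    have hj : j ≠ n + 1 := (lt_of_lt_of_le hjk hw'.2.2.1).ne
    have hjn := (lt_of_lt_of_le hjk hw'.2.2.1)
    obtain ⟨⟨hf, hg, hk, hc⟩, ⟨hf', hg', -, hc'⟩, -, -⟩ := hw
    obtain ⟨⟨-, -, -, hd⟩, ⟨-, -, -, hd'⟩, -, -⟩ := hw'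
    rcases hk.lt_or_eq with h | rfl
    · simp only [src, tgt, h.ne, hj, if_false]
      constructor
      · exact C.interchange _ _ _ _ hjk (by rw [(parallel f hf k h).2, hc])
          (by rw [(parallel f' hf' k h).2, hc']) (by rw [(parallel f hf j hjn).2, hd])
          (by rw [(parallel g hg j hjn).2, hd'])
      · exact C.interchange _ _ _ _ hjk (by rw [hc, (parallel g hg k h).1])
          (by rw [hc', (parallel g' hg' k h).1]) (by rw [hd, (parallel f' hf' j hjn).1])
          (by rw [hd', (parallel g' hg' j hjn).1])
    · simp [src, tgt, hj]
  | add_comm hw hw' =>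
    exact ⟨hw, hw', C.add_comm _ _ hw.2.2, C.add_comm _ _ (sameHom_tgt hw.1 hw.2.1 hw.2.2)⟩
  | @add_assoc f g h hw hw' =>
    obtain ⟨⟨hf, hg, h1⟩, -, -⟩ := id hw
    obtain ⟨-, ⟨-, hh, h2⟩, -⟩ := id hw'
    exact ⟨hw, hw', C.add_assoc _ _ _ h1 h2,
      C.add_assoc _ _ _ (sameHom_tgt hf hg h1) (sameHom_tgt hg hh h2)⟩
  | @add_zero f hw =>
    refine ⟨hw, hw.1, C.add_zero _, ?_⟩
    have p := parallel f hw.1 n n.lt_succ_self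
    simp only [tgt]
    rw [p.1, p.2, C.add_zero]
  | smul_add hw hw' =>
    exact ⟨hw, hw', C.smul_add _ _ _ hw.2.2, C.smul_add _ _ _ (sameHom_tgt hw.1 hw.2.1 hw.2.2)⟩
  | add_smul hw => exact ⟨hw.1, hw, C.add_smul _ _ _, C.add_smul _ _ _⟩
  | mul_smul hw => exact ⟨hw, hw, C.mul_smul _ _ _, C.mul_smul _ _ _⟩
  | unit_smul hw => exact ⟨hw, hw, C.one_smul _, C.one_smul _⟩
  | @zero_smul f hw =>
    refine ⟨hw, trivial, C.zero_smul _, ?_⟩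
    have p := parallel f hw n n.lt_succ_self
    simp only [tgt]
    rw [p.1, p.2, C.zero_smul]
  | comp_add_top hw hw' => exact ⟨hw, hw', by simp [src], by simp [tgt]⟩
  | comp_smul_top hw hw' => exact ⟨hw, hw', by simp [src], by simp [tgt]⟩
  | @add_comp k f f' g hk hw hw' =>
    have hk' : k ≠ n + 1 := by omega
    have hk1 : k < n + 1 := by omega
    obtain ⟨⟨hf, hf', h⟩, hg, -, -⟩ := id hw
    have hc := hw'.1.2.2.2
    refine ⟨hw, hw', ?_, ?_⟩
    · simp only [src, hk', if_false]
      exact C.add_comp _ _ _ hk (by rw [(parallel f hf k hk1).2, hc]) h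
    · simp only [tgt, hk', if_false]
      exact C.add_comp _ _ _ hk (by rw [hc, (parallel g hg k hk1).1]) (sameHom_tgt hf hf' h)
  | @comp_add k f g g' hk hw hw' =>
    have hk' : k ≠ n + 1 := by omega
    have hk1 : k < n + 1 := by omega
    obtain ⟨hf, ⟨hg, hg', h⟩, -, -⟩ := id hw
    have hc := hw'.1.2.2.2
    refine ⟨hw, hw', ?_, ?_⟩
    · simp only [src, hk', if_false]
      exact C.comp_add _ _ _ hk (by rw [(parallel f hf k hk1).2, hc]) h
    · simp only [tgt, hk', if_false]
      exact C.comp_add _ _ _ hk (by rw [hc, (parallel g hg k hk1).1]) (sameHom_tgt hg hg' h)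
  | @smul_comp k a f g hk hw hw' =>
    have hk' : k ≠ n + 1 := by omega
    have hk1 : k < n + 1 := by omega
    obtain ⟨hf, hg, -, hc⟩ := id hw'
    refine ⟨hw, hw', ?_, ?_⟩
    · simp only [src, hk', if_false]
      exact C.smul_comp _ _ _ hk (by rw [(parallel f hf k hk1).2, hc])
    · simp only [tgt, hk', if_false]
      exact C.smul_comp _ _ _ hk (by rw [hc, (parallel g hg k hk1).1])
  | @comp_smul k a f g hk hw hw' =>
    have hk' : k ≠ n + 1 := by omega
    have hk1 : k < n + 1 := by omega
    obtain ⟨hf, hg, -, hc⟩ := id hw'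
    refine ⟨hw, hw', ?_, ?_⟩
    · simp only [src, hk', if_false]
      exact C.comp_smul _ _ _ hk (by rw [(parallel f hf k hk1).2, hc])
    · simp only [tgt, hk', if_false]
      exact C.comp_smul _ _ _ hk (by rw [hc, (parallel g hg k hk1).1])

variable (C G) in
def setoid : Setoid {f : LinTerm C G // f.Wf} where
  r f g := Rel f.1 g.1
  iseqv := ⟨fun f => Rel.refl f.2, Rel.symm, Rel.trans⟩

end LinTerm

/-- The `(n+2)`-cells of the free linear `(n+2,n+1)`-category on `G`. -/
def FreeLinCell {R : Type w} [CommRing R] {n : ℕ} (C : LinCat.{u} R (n + 1) n)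
    (G : GlobExt.{u, v} C.toNCat) : Type (max u v w) := Quotient (LinTerm.setoid C G)

namespace FreeLinCell

variable {R : Type w} [CommRing R] {n : ℕ} {C : LinCat.{u} R (n + 1) n}
  {G : GlobExt.{u, v} C.toNCat}

def mk (f : LinTerm C G) (hf : f.Wf) : FreeLinCell C G := Quotient.mk (LinTerm.setoid C G) ⟨f, hf⟩

theorem sound {f g : LinTerm C G} (h : LinTerm.Rel f g) :
    mk f h.spec.1 = mk g h.spec.2.1 := Quotient.sound h

def one (x : C.cell) : FreeLinCell C G := mk (.one x) (LinTerm.wf_one x)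

def s : FreeLinCell C G → C.cell := Quotient.lift (fun f => f.1.src) fun _ _ h => h.spec.2.2.1
def t : FreeLinCell C G → C.cell := Quotient.lift (fun f => f.1.tgt) fun _ _ h => h.spec.2.2.2

@[simp] theorem s_mk (f : LinTerm C G) (hf) : s (mk f hf) = f.src := rfl
@[simp] theorem t_mk (f : LinTerm C G) (hf) : t (mk f hf) = f.tgt := rfl
@[simp] theorem s_one (x : C.cell) : s (one x : FreeLinCell C G) = x := rfl
@[simp] theorem t_one (x : C.cell) : t (one x : FreeLinCell C G) = x := rfl

def comp (k : ℕ) : FreeLinCell C G → FreeLinCell C G → FreeLinCell C G :=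
  Quotient.map₂ (fun f g => if h : k ≤ n + 1 ∧ C.tgt k f.1.tgt = C.src k g.1.src then
    ⟨.comp k f.1 g.1, LinTerm.wf_comp.2 ⟨f.2, g.2, h.1, h.2⟩⟩ else f) (by
      intro f f' hf g g' hg
      have h1 := LinTerm.Rel.spec hf
      have h2 := LinTerm.Rel.spec hg
      by_cases h : k ≤ n + 1 ∧ C.tgt k f.1.tgt = C.src k g.1.src
      · have h' : k ≤ n + 1 ∧ C.tgt k f'.1.tgt = C.src k g'.1.src := by
          rwa [← h1.2.2.2, ← h2.2.2.1]
        simp only [h, h', and_self, dite_true]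
        exact .congr_comp hf hg ⟨f.2, g.2, h.1, h.2⟩ ⟨f'.2, g'.2, h'.1, h'.2⟩
      · have h' : ¬ (k ≤ n + 1 ∧ C.tgt k f'.1.tgt = C.src k g'.1.src) := by
          rwa [← h1.2.2.2, ← h2.2.2.1]
        simp only [h, h', dite_false]
        exact hf)

def add : FreeLinCell C G → FreeLinCell C G → FreeLinCell C G :=
  Quotient.map₂ (fun f g => if h : C.SameHom n f.1.src g.1.src then
    ⟨.add f.1 g.1, LinTerm.wf_add.2 ⟨f.2, g.2, h⟩⟩ else f) (by
      intro f f' hf g g' hg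
      have h1 := LinTerm.Rel.spec hf
      have h2 := LinTerm.Rel.spec hg
      by_cases h : C.SameHom n f.1.src g.1.src
      · have h' : C.SameHom n f'.1.src g'.1.src := by rwa [← h1.2.2.1, ← h2.2.2.1]
        simp only [h, h', dite_true]
        exact .congr_add hf hg ⟨f.2, g.2, h⟩ ⟨f'.2, g'.2, h'⟩
      · have h' : ¬ C.SameHom n f'.1.src g'.1.src := by rwa [← h1.2.2.1, ← h2.2.2.1]
        simp only [h, h', dite_false]
        exact hf)

def smul (a : R) : FreeLinCell C G → FreeLinCell C G :=
  Quotient.map (fun f => ⟨.smul a f.1, LinTerm.wf_smul.2 f.2⟩) fun _ _ h => .congr_smul h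

def zero (f g : FreeLinCell C G) : FreeLinCell C G := one (C.zero f.s g.s)

theorem comp_mk {k : ℕ} {f g : LinTerm C G} (h : (LinTerm.comp k f g).Wf) :
    comp k (mk f (LinTerm.wf_comp.1 h).1) (mk g (LinTerm.wf_comp.1 h).2.1) =
      mk (.comp k f g) h := by
  have h' := (LinTerm.wf_comp.1 h).2.2
  exact congrArg (Quotient.mk (LinTerm.setoid C G)) (dif_pos h')

theorem add_mk {f g : LinTerm C G} (h : (LinTerm.add f g).Wf) :
    add (mk f (LinTerm.wf_add.1 h).1) (mk g (LinTerm.wf_add.1 h).2.1) = mk (.add f g) h := by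
  have h' := (LinTerm.wf_add.1 h).2.2
  exact congrArg (Quotient.mk (LinTerm.setoid C G)) (dif_pos h')

theorem smul_mk (a : R) {f : LinTerm C G} (h : f.Wf) :
    smul a (mk f h) = mk (.smul a f) (LinTerm.wf_smul.2 h) := rfl

theorem comp_of_lt {k : ℕ} (h : n + 1 < k) (f g : FreeLinCell C G) : comp k f g = f := by
  induction f, g using Quotient.inductionOn₂ with
  | _ f g => exact congrArg (Quotient.mk (LinTerm.setoid C G)) (dif_neg fun h' => by
      have := h'.1; omega)

theorem ind {p : FreeLinCell C G → Prop} (h : ∀ f hf, p (mk f hf)) (f) : p f :=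
  Quotient.inductionOn f fun f => h f.1 f.2

theorem parallel (f : FreeLinCell C G) : C.Parallel (n + 1) f.s f.t := by
  induction f using ind with | _ f hf => exact f.parallel hf

theorem comp_one {k : ℕ} (hk : k < n + 1) {x y : C.cell} (h : C.tgt k x = C.src k y) :
    comp k (one x) (one y) = (one (C.comp k x y) : FreeLinCell C G) :=
  (comp_mk (LinTerm.wf_comp.2 ⟨LinTerm.wf_one x, LinTerm.wf_one y, hk.le, h⟩)).trans
    (sound (.one_comp (Nat.lt_succ_iff.1 hk) h)).symm

theorem exists_comp {k : ℕ} (hk : k ≤ n + 1) (f g : FreeLinCell C G)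
    (h : C.tgt k f.t = C.src k g.s) : ∃ a b, ∃ (ha : a.Wf) (hb : b.Wf)
      (hc : (LinTerm.comp k a b).Wf), f = mk a ha ∧ g = mk b hb ∧
      comp k f g = mk (.comp k a b) hc := by
  induction f using ind with | _ f hf =>
  induction g using ind with | _ g hg =>
  exact ⟨f, g, hf, hg, LinTerm.wf_comp.2 ⟨hf, hg, hk, h⟩, rfl, rfl,
    comp_mk (LinTerm.wf_comp.2 ⟨hf, hg, hk, h⟩)⟩

theorem s_comp_n (f g : FreeLinCell C G) (h : f.t = g.s) : (comp (n + 1) f g).s = f.s := by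
  obtain ⟨a, b, ha, hb, hc, rfl, rfl, e⟩ := exists_comp le_rfl f g (by
    rw [h, NCat.tgt_of_le _ le_rfl, NCat.src_of_le _ le_rfl])
  simp [e, LinTerm.src]

theorem t_comp_n (f g : FreeLinCell C G) (h : f.t = g.s) : (comp (n + 1) f g).t = g.t := by
  obtain ⟨a, b, ha, hb, hc, rfl, rfl, e⟩ := exists_comp le_rfl f g (by
    rw [h, NCat.tgt_of_le _ le_rfl, NCat.src_of_le _ le_rfl])
  simp [e, LinTerm.tgt]

theorem s_comp {k : ℕ} (hk : k < n + 1) (f g : FreeLinCell C G) (h : C.tgt k f.t = C.src k g.s) :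
    (comp k f g).s = C.comp k f.s g.s := by
  obtain ⟨a, b, ha, hb, hc, rfl, rfl, e⟩ := exists_comp hk.le f g h
  simp [e, LinTerm.src, hk.ne]

theorem t_comp {k : ℕ} (hk : k < n + 1) (f g : FreeLinCell C G) (h : C.tgt k f.t = C.src k g.s) :
    (comp k f g).t = C.comp k f.t g.t := by
  obtain ⟨a, b, ha, hb, hc, rfl, rfl, e⟩ := exists_comp hk.le f g h
  simp [e, LinTerm.tgt, hk.ne]

theorem src_comp' {k : ℕ} (hk : k ≤ n + 1) (f g : FreeLinCell C G)
    (h : C.tgt k f.t = C.src k g.s) : C.src k (comp k f g).s = C.src k f.s := by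
  obtain ⟨a, b, ha, hb, hc, rfl, rfl, e⟩ := exists_comp hk f g h
  rw [e]; exact LinTerm.src_comp hc

theorem tgt_comp' {k : ℕ} (hk : k ≤ n + 1) (f g : FreeLinCell C G)
    (h : C.tgt k f.t = C.src k g.s) : C.tgt k (comp k f g).t = C.tgt k g.t := by
  obtain ⟨a, b, ha, hb, hc, rfl, rfl, e⟩ := exists_comp hk f g h
  rw [e]; exact LinTerm.tgt_comp hc

theorem exists_add (f g : FreeLinCell C G) (h : C.SameHom n f.s g.s) :
    ∃ a b, ∃ (ha : a.Wf) (hb : b.Wf) (hc : (LinTerm.add a b).Wf), f = mk a ha ∧ g = mk b hb ∧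
      add f g = mk (.add a b) hc := by
  induction f using ind with | _ f hf =>
  induction g using ind with | _ g hg =>
  exact ⟨f, g, hf, hg, LinTerm.wf_add.2 ⟨hf, hg, h⟩, rfl, rfl,
    add_mk (LinTerm.wf_add.2 ⟨hf, hg, h⟩)⟩

theorem s_add {f g : FreeLinCell C G} (h : C.SameHom n f.s g.s) :
    (add f g).s = C.add f.s g.s := by
  obtain ⟨a, b, ha, hb, hc, rfl, rfl, e⟩ := exists_add f g h
  rw [e]; rfl

theorem t_add {f g : FreeLinCell C G} (h : C.SameHom n f.s g.s) :
    (add f g).t = C.add f.t g.t := by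
  obtain ⟨a, b, ha, hb, hc, rfl, rfl, e⟩ := exists_add f g h
  rw [e]; rfl

theorem s_smul (a : R) (f : FreeLinCell C G) : (smul a f).s = C.smul a f.s := by
  induction f using ind with | _ f hf => rfl

theorem t_smul (a : R) (f : FreeLinCell C G) : (smul a f).t = C.smul a f.t := by
  induction f using ind with | _ f hf => rfl

theorem sameHom_t {f g : FreeLinCell C G} (h : C.SameHom n f.s g.s) : C.SameHom n f.t g.t := by
  induction f using ind with | _ f hf =>
  induction g using ind with | _ g hg => exact LinTerm.sameHom_tgt hf hg h

theorem one_add {x y : C.cell} (h : C.SameHom n x y) :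
    add (one x) (one y) = (one (C.add x y) : FreeLinCell C G) :=
  (add_mk (LinTerm.wf_add.2 ⟨LinTerm.wf_one x, LinTerm.wf_one y, h⟩)).trans
    (sound (.one_add h)).symm

theorem one_smul (a : R) (x : C.cell) :
    smul a (one x) = (one (C.smul a x) : FreeLinCell C G) :=
  (sound LinTerm.Rel.one_smul).symm

end FreeLinCell

section

variable {R : Type w} [CommRing R] {n : ℕ} (C : LinCat.{u} R (n + 1) n)
  (G : GlobExt.{u, v} C.toNCat)

open FreeLinCell in
/-- The `(n+2)`-cells of the free linear `(n+2,n+1)`-category, with their compositions. -/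
@[reducible] def freeLinCellExt : CellExt.{u, max u v w} C.toNCat where
  cell := FreeLinCell C G
  one := FreeLinCell.one
  s := FreeLinCell.s
  t := FreeLinCell.t
  comp := FreeLinCell.comp
  s_one _ := rfl
  t_one _ := rfl
  parallel := FreeLinCell.parallel
  comp_of_lt f g h := FreeLinCell.comp_of_lt h f g
  comp_one _ _ hk h := FreeLinCell.comp_one hk h
  s_comp_top := s_comp_n
  t_comp_top := t_comp_n
  s_comp f g hk h := FreeLinCell.s_comp hk f g h
  t_comp f g hk h := FreeLinCell.t_comp hk f g h
  id_comp {k} f hk := by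
    induction f using ind with | _ f hf =>
    have r := LinTerm.Rel.id_comp hk hf
    exact (comp_mk r.spec.1).trans (sound r)
  comp_id {k} f hk := by
    induction f using ind with | _ f hf =>
    have r := LinTerm.Rel.comp_id hk hf
    exact (comp_mk r.spec.1).trans (sound r)
  assoc {k} f g h hk h1 h2 := by
    have h3 := tgt_comp' hk f g h1
    have h4 := src_comp' hk g h h2
    induction f using ind with | _ f hf =>
    induction g using ind with | _ g hg =>
    induction h using ind with | _ h hh =>
    have w1 : (LinTerm.comp k f g).Wf := LinTerm.wf_comp.2 ⟨hf, hg, hk, h1⟩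
    have w2 : (LinTerm.comp k g h).Wf := LinTerm.wf_comp.2 ⟨hg, hh, hk, h2⟩
    rw [comp_mk w1] at h3 ⊢
    rw [comp_mk w2] at h4 ⊢
    have w3 : (LinTerm.comp k (LinTerm.comp k f g) h).Wf :=
      LinTerm.wf_comp.2 ⟨w1, hh, hk, h3.trans h2⟩
    have w4 : (LinTerm.comp k f (LinTerm.comp k g h)).Wf :=
      LinTerm.wf_comp.2 ⟨hf, w2, hk, h1.trans h4.symm⟩
    rw [comp_mk w3, comp_mk w4]
    exact sound (.assoc w3 w4)
  interchange {j k} f g f' g' hjk hk h1 h2 h3 h4 := by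
    have hj : j < n + 1 := by omega
    induction f using ind with | _ f hf =>
    induction g using ind with | _ g hg =>
    induction f' using ind with | _ f' hf' =>
    induction g' using ind with | _ g' hg' =>
    have w1 : (LinTerm.comp k f g).Wf := LinTerm.wf_comp.2 ⟨hf, hg, hk, h1⟩
    have w2 : (LinTerm.comp k f' g').Wf := LinTerm.wf_comp.2 ⟨hf', hg', hk, h2⟩
    have w3 : (LinTerm.comp j f f').Wf := LinTerm.wf_comp.2 ⟨hf, hf', hj.le, h3⟩
    have w4 : (LinTerm.comp j g g').Wf := LinTerm.wf_comp.2 ⟨hg, hg', hj.le, h4⟩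
    simp only [s_mk, t_mk] at h1 h2 h3 h4
    rw [comp_mk w1, comp_mk w2, comp_mk w3, comp_mk w4]
    have w5 : (LinTerm.comp j (LinTerm.comp k f g) (LinTerm.comp k f' g')).Wf := by
      refine LinTerm.wf_comp.2 ⟨w1, w2, hj.le, ?_⟩
      have e1 := LinTerm.parallel _ w1 j hj
      have e2 := LinTerm.parallel _ hf j hj
      rw [← C.src_src_of_lt _ hjk, LinTerm.src_comp w2, C.src_src_of_lt _ hjk,
        ← e1.2, ← C.tgt_src_of_lt _ hjk, LinTerm.src_comp w1, C.tgt_src_of_lt _ hjk, e2.2, h3]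
    have w6 : (LinTerm.comp k (LinTerm.comp j f f') (LinTerm.comp j g g')).Wf := by
      refine LinTerm.wf_comp.2 ⟨w3, w4, hk, ?_⟩
      simp only [LinTerm.src, LinTerm.tgt, hj.ne, if_false]
      rw [C.tgt_comp_of_lt _ _ hjk, C.src_comp_of_lt _ _ hjk, h1, h2]
      · rw [(LinTerm.parallel _ hg j hj).2, h4]
      · rw [h3, (LinTerm.parallel _ hf' j hj).1]
    rw [comp_mk w5, comp_mk w6]
    exact sound (.interchange hjk w5 w6)

theorem FreeLinCell.sameHom_s {f g : FreeLinCell C G}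
    (h : (freeLinCellExt C G).total.SameHom n f g) : C.SameHom n f.s g.s := by
  have hn : n ≤ n + 1 := n.le_succ
  have h1 : (freeLinCellExt C G).src n f = (freeLinCellExt C G).src n g := h.1
  have h2 : (freeLinCellExt C G).tgt n f = (freeLinCellExt C G).tgt n g := h.2
  simp only [CellExt.src, CellExt.tgt, hn, if_true] at h1 h2
  replace h1 := congrArg FreeLinCell.s h1
  replace h2 := congrArg FreeLinCell.s h2
  refine ⟨h1, ?_⟩
  rw [(f.parallel n n.lt_succ_self).2, (g.parallel n n.lt_succ_self).2]
  exact h2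

theorem FreeLinCell.low {u : FreeLinCell C G} (h : (freeLinCellExt C G).src n u = u) :
    u = FreeLinCell.one u.s ∧ C.src n u.s = u.s ∧ u.t = u.s := by
  simp only [CellExt.src, n.le_succ, if_true] at h
  have h1 := congrArg FreeLinCell.s h
  have h2 := congrArg FreeLinCell.t h
  rw [FreeLinCell.s_one] at h1
  rw [FreeLinCell.t_one, h1] at h2
  rw [h1] at h
  exact ⟨h.symm, h1, h2.symm⟩

theorem FreeLinCell.low_parallel {u v : FreeLinCell C G}
    (hu : (freeLinCellExt C G).src n u = u) (hv : (freeLinCellExt C G).src n v = v)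
    (h : (freeLinCellExt C G).total.Parallel n u v) : C.Parallel n u.s v.s := by
  intro k hk
  have hk' : k ≤ n + 1 := by omega
  have h1 : (freeLinCellExt C G).src k u = (freeLinCellExt C G).src k v := (h k hk).1
  have h2 : (freeLinCellExt C G).tgt k u = (freeLinCellExt C G).tgt k v := (h k hk).2
  simp only [CellExt.src, CellExt.tgt, hk', if_true, (low C G hu).2.2, (low C G hv).2.2] at h1 h2
  exact ⟨congrArg FreeLinCell.s h1, congrArg FreeLinCell.s h2⟩

theorem FreeLinCell.composable {k : ℕ} (hk : k ≤ n + 1) {f g : FreeLinCell C G}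
    (h : (freeLinCellExt C G).tgt k f = (freeLinCellExt C G).src k g) :
    C.tgt k f.t = C.src k g.s := by
  simp only [CellExt.src, CellExt.tgt, hk, if_true] at h
  exact congrArg FreeLinCell.s h

open FreeLinCell in
/-- The free linear `(n+2,n+1)`-category over the linear `(n+1,n+1)`-category `C` with the globular
extension `G`. -/
def freeLin : LinCat.{max u v w} R (n + 2) n where
  toNCat := (freeLinCellExt C G).total
  zero := FreeLinCell.zero
  add := FreeLinCell.add
  smul := FreeLinCell.smul
  src_zero (u v : FreeLinCell C G) hu hv h := by
    have hp := low_parallel C G hu hv h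
    obtain ⟨e1, e2, -⟩ := low C G hu
    have e3 := (low C G hv).2.1
    simp only [CellExt.src, n.le_succ, if_true, FreeLinCell.zero, s_one,
      C.src_zero _ _ e2 e3 hp]
    exact e1.symm
  tgt_zero (u v : FreeLinCell C G) hu hv h := by
    have hp := low_parallel C G hu hv h
    obtain ⟨e1, e3, -⟩ := low C G hv
    have e2 := (low C G hu).2.1
    simp only [CellExt.tgt, n.le_succ, if_true, FreeLinCell.zero, t_one,
      C.tgt_zero _ _ e2 e3 hp]
    exact e1.symm
  src_add (f g : FreeLinCell C G) h := by
    have h := sameHom_s C G h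
    simp only [CellExt.src, n.le_succ, if_true, s_add h, C.src_add _ _ h]
  tgt_add (f g : FreeLinCell C G) h := by
    have h := sameHom_s C G h
    simp only [CellExt.tgt, n.le_succ, if_true, t_add h, C.tgt_add _ _ (sameHom_t h)]
  src_smul a (f : FreeLinCell C G) := by
    simp only [CellExt.src, n.le_succ, if_true, s_smul, C.src_smul]
  tgt_smul a (f : FreeLinCell C G) := by
    simp only [CellExt.tgt, n.le_succ, if_true, t_smul, C.tgt_smul]
  add_comm (f g : FreeLinCell C G) h := by
    have h := sameHom_s C G h
    induction f using ind with | _ f hf =>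
    induction g using ind with | _ g hg =>
    have w1 : (LinTerm.add f g).Wf := LinTerm.wf_add.2 ⟨hf, hg, h⟩
    have w2 : (LinTerm.add g f).Wf := LinTerm.wf_add.2 ⟨hg, hf, h.1.symm, h.2.symm⟩
    rw [add_mk w1, add_mk w2]
    exact sound (.add_comm w1 w2)
  add_assoc (f g e : FreeLinCell C G) h h' := by
    have h := sameHom_s C G h
    have h' := sameHom_s C G h'
    induction f using ind with | _ f hf =>
    induction g using ind with | _ g hg =>
    induction e using ind with | _ e he =>
    have w1 : (LinTerm.add f g).Wf := LinTerm.wf_add.2 ⟨hf, hg, h⟩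
    have w2 : (LinTerm.add g e).Wf := LinTerm.wf_add.2 ⟨hg, he, h'⟩
    have w3 : (LinTerm.add (LinTerm.add f g) e).Wf := LinTerm.wf_add.2 ⟨w1, he,
      (C.src_add _ _ h).trans (h.1.trans h'.1), (C.tgt_add _ _ h).trans (h.2.trans h'.2)⟩
    have w4 : (LinTerm.add f (LinTerm.add g e)).Wf := LinTerm.wf_add.2 ⟨hf, w2,
      h.1.trans (C.src_add _ _ h').symm, h.2.trans (C.tgt_add _ _ h').symm⟩
    rw [add_mk w1, add_mk w2, add_mk w3, add_mk w4]
    exact sound (.add_assoc w3 w4)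
  add_zero (f : FreeLinCell C G) := by
    simp only [CellExt.src, CellExt.tgt, n.le_succ, if_true, FreeLinCell.zero, s_one,
      ← (f.parallel n n.lt_succ_self).2]
    induction f using ind with | _ f hf =>
    have e1 := C.src_src_of_le f.src (le_refl n)
    have e2 := C.src_tgt_of_le f.src (le_refl n)
    have hp := C.parallel_src_tgt n f.src
    have w : (LinTerm.add f (.one (C.zero (C.src n f.src) (C.tgt n f.src)))).Wf :=
      LinTerm.wf_add.2 ⟨hf, LinTerm.wf_one _,
        (C.src_zero _ _ e1 e2 hp).symm, (C.tgt_zero _ _ e1 e2 hp).symm⟩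
    exact (add_mk w).trans (sound (.add_zero w))
  smul_add a (f g : FreeLinCell C G) h := by
    have h := sameHom_s C G h
    induction f using ind with | _ f hf =>
    induction g using ind with | _ g hg =>
    have w1 : (LinTerm.add f g).Wf := LinTerm.wf_add.2 ⟨hf, hg, h⟩
    have w2 : (LinTerm.add (LinTerm.smul a f) (LinTerm.smul a g)).Wf :=
      LinTerm.wf_add.2 ⟨LinTerm.wf_smul.2 hf, LinTerm.wf_smul.2 hg,
        (C.src_smul _ _).trans (h.1.trans (C.src_smul _ _).symm),
        (C.tgt_smul _ _).trans (h.2.trans (C.tgt_smul _ _).symm)⟩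
    rw [add_mk w1, smul_mk, smul_mk, smul_mk, add_mk w2]
    exact sound (.smul_add w1 w2)
  add_smul a b (f : FreeLinCell C G) := by
    induction f using ind with | _ f hf =>
    have w2 : (LinTerm.add (LinTerm.smul a f) (LinTerm.smul b f)).Wf :=
      LinTerm.wf_add.2 ⟨LinTerm.wf_smul.2 hf, LinTerm.wf_smul.2 hf,
        (C.src_smul _ _).trans (C.src_smul _ _).symm,
        (C.tgt_smul _ _).trans (C.tgt_smul _ _).symm⟩
    rw [smul_mk, smul_mk, smul_mk, add_mk w2]
    exact sound (.add_smul w2)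
  mul_smul a b (f : FreeLinCell C G) := by
    induction f using ind with | _ f hf => exact sound (.mul_smul hf)
  one_smul (f : FreeLinCell C G) := by
    induction f using ind with | _ f hf => exact sound (.unit_smul hf)
  zero_smul (f : FreeLinCell C G) := by
    simp only [CellExt.src, CellExt.tgt, n.le_succ, if_true, FreeLinCell.zero, s_one,
      ← (f.parallel n n.lt_succ_self).2]
    induction f using ind with | _ f hf => exact sound (.zero_smul hf)
  src_add_of_lt {k} (f g : FreeLinCell C G) hk h := by
    have h := sameHom_s C G h
    rcases (Nat.succ_le_of_lt hk).eq_or_lt with rfl | hk'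
    · simp only [CellExt.src, Nat.succ_eq_add_one, le_rfl, if_true, s_add h, C.src_top, one_add h]
    · have : ¬ k ≤ n + 1 := by omega
      simp only [CellExt.src, this, if_false]
  tgt_add_of_lt {k} (f g : FreeLinCell C G) hk h := by
    have h := sameHom_s C G h
    rcases (Nat.succ_le_of_lt hk).eq_or_lt with rfl | hk'
    · simp only [CellExt.tgt, Nat.succ_eq_add_one, le_rfl, if_true, t_add h,
        NCat.tgt_of_le _ le_rfl, one_add (sameHom_t h)]
    · have : ¬ k ≤ n + 1 := by omega
      simp only [CellExt.tgt, this, if_false]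
  src_smul_of_lt {k} a (f : FreeLinCell C G) hk := by
    rcases (Nat.succ_le_of_lt hk).eq_or_lt with rfl | hk'
    · simp only [CellExt.src, Nat.succ_eq_add_one, le_rfl, if_true, s_smul, C.src_top,
        FreeLinCell.one_smul]
    · have : ¬ k ≤ n + 1 := by omega
      simp only [CellExt.src, this, if_false]
  tgt_smul_of_lt {k} a (f : FreeLinCell C G) hk := by
    rcases (Nat.succ_le_of_lt hk).eq_or_lt with rfl | hk'
    · simp only [CellExt.tgt, Nat.succ_eq_add_one, le_rfl, if_true, t_smul,
        NCat.tgt_of_le _ le_rfl, FreeLinCell.one_smul]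
    · have : ¬ k ≤ n + 1 := by omega
      simp only [CellExt.tgt, this, if_false]
  comp_add_of_lt {k} (f g f' g' : FreeLinCell C G) hk hc hc' h := by
    rcases (Nat.succ_le_of_lt hk).eq_or_lt with rfl | hk'
    · have h := sameHom_s C G h
      have hc := composable C G le_rfl hc
      have hc' := composable C G le_rfl hc'
      induction f using ind with | _ f hf =>
      induction g using ind with | _ g hg =>
      induction f' using ind with | _ f' hf' =>
      induction g' using ind with | _ g' hg' =>
      simp only [s_mk, t_mk] at h hc hc'
      have hg1 : C.SameHom n g.src g'.src := by
        have e := LinTerm.sameHom_tgt hf hf' h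
        rwa [(CellExt.top_iff _ _).1 hc, (CellExt.top_iff _ _).1 hc'] at e
      have w1 : (LinTerm.comp (n + 1) f g).Wf := LinTerm.wf_comp.2 ⟨hf, hg, le_rfl, hc⟩
      have w2 : (LinTerm.comp (n + 1) f' g').Wf := LinTerm.wf_comp.2 ⟨hf', hg', le_rfl, hc'⟩
      have w3 : (LinTerm.add f f').Wf := LinTerm.wf_add.2 ⟨hf, hf', h⟩
      have w4 : (LinTerm.add g g').Wf := LinTerm.wf_add.2 ⟨hg, hg', hg1⟩
      have w5 : (LinTerm.comp (n + 1) (.add f f') (.add g g')).Wf := by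
        refine LinTerm.wf_comp.2 ⟨w3, w4, le_rfl, (CellExt.top_iff _ _).2 ?_⟩
        exact congrArg₂ C.add ((CellExt.top_iff _ _).1 hc) ((CellExt.top_iff _ _).1 hc')
      have w6 : (LinTerm.add (.comp (n + 1) f g) (.comp (n + 1) f' g')).Wf := by
        refine LinTerm.wf_add.2 ⟨w1, w2, ?_⟩
        simpa only [LinTerm.src, if_true] using h
      have := sound (LinTerm.Rel.comp_add_top w5 w6)
      rwa [← comp_mk w5, ← add_mk w6, ← comp_mk w1, ← comp_mk w2, ← add_mk w3, ← add_mk w4] at this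
    · simp only [FreeLinCell.comp_of_lt hk']
  comp_smul_of_lt {k} a (f g : FreeLinCell C G) hk hc := by
    rcases (Nat.succ_le_of_lt hk).eq_or_lt with rfl | hk'
    · have hc := composable C G le_rfl hc
      induction f using ind with | _ f hf =>
      induction g using ind with | _ g hg =>
      have w1 : (LinTerm.comp (n + 1) f g).Wf := LinTerm.wf_comp.2 ⟨hf, hg, le_rfl, hc⟩
      have w2 : (LinTerm.comp (n + 1) (.smul a f) (.smul a g)).Wf := by
        refine LinTerm.wf_comp.2 ⟨LinTerm.wf_smul.2 hf, LinTerm.wf_smul.2 hg, le_rfl,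
          (CellExt.top_iff _ _).2 ?_⟩
        exact congrArg (C.smul a) ((CellExt.top_iff _ _).1 hc)
      have := sound (LinTerm.Rel.comp_smul_top w2 w1)
      rwa [← comp_mk w2, ← smul_mk _ hf, ← smul_mk _ hg, ← smul_mk _ w1, ← comp_mk w1] at this
    · simp only [FreeLinCell.comp_of_lt hk']
  add_comp {k} (f f' g : FreeLinCell C G) hk hc h := by
    have hk1 : k ≤ n + 1 := by omega
    have h := sameHom_s C G h
    have hc := composable C G hk1 hc
    induction f using ind with | _ f hf =>
    induction f' using ind with | _ f' hf' =>
    induction g using ind with | _ g hg =>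
    simp only [s_mk, t_mk] at h hc
    have ht := LinTerm.sameHom_tgt hf hf' h
    have hc' : C.tgt k f'.tgt = C.src k g.src := (ht.tgt hk).symm.trans hc
    have w1 : (LinTerm.comp k f g).Wf := LinTerm.wf_comp.2 ⟨hf, hg, hk1, hc⟩
    have w2 : (LinTerm.comp k f' g).Wf := LinTerm.wf_comp.2 ⟨hf', hg, hk1, hc'⟩
    have w3 : (LinTerm.add f f').Wf := LinTerm.wf_add.2 ⟨hf, hf', h⟩
    have w4 : (LinTerm.comp k (.add f f') g).Wf :=
      LinTerm.wf_comp.2 ⟨w3, hg, hk1, (C.tgt_add' hk _ _ ht).trans hc⟩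
    have w5 : (LinTerm.add (.comp k f g) (.comp k f' g)).Wf := by
      refine LinTerm.wf_add.2 ⟨w1, w2, ?_⟩
      have : k ≠ n + 1 := by omega
      simp only [LinTerm.src, this, if_false]
      refine h.comp hk (NCat.SameHom.refl n _) ?_
      rw [(LinTerm.parallel f hf k (by omega)).2]; exact hc
    have := sound (LinTerm.Rel.add_comp hk w4 w5)
    rwa [← comp_mk w4, ← add_mk w5, ← comp_mk w1, ← comp_mk w2, ← add_mk w3] at this
  comp_add {k} (f g g' : FreeLinCell C G) hk hc h := by
    have hk1 : k ≤ n + 1 := by omega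
    have h := sameHom_s C G h
    have hc := composable C G hk1 hc
    induction f using ind with | _ f hf =>
    induction g using ind with | _ g hg =>
    induction g' using ind with | _ g' hg' =>
    simp only [s_mk, t_mk] at h hc
    have hc' : C.tgt k f.tgt = C.src k g'.src := hc.trans (h.src hk)
    have w1 : (LinTerm.comp k f g).Wf := LinTerm.wf_comp.2 ⟨hf, hg, hk1, hc⟩
    have w2 : (LinTerm.comp k f g').Wf := LinTerm.wf_comp.2 ⟨hf, hg', hk1, hc'⟩
    have w3 : (LinTerm.add g g').Wf := LinTerm.wf_add.2 ⟨hg, hg', h⟩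
    have w4 : (LinTerm.comp k f (.add g g')).Wf :=
      LinTerm.wf_comp.2 ⟨hf, w3, hk1, hc.trans (C.src_add' hk _ _ h).symm⟩
    have w5 : (LinTerm.add (.comp k f g) (.comp k f g')).Wf := by
      refine LinTerm.wf_add.2 ⟨w1, w2, ?_⟩
      have : k ≠ n + 1 := by omega
      simp only [LinTerm.src, this, if_false]
      refine (NCat.SameHom.refl n _).comp hk h ?_
      rw [(LinTerm.parallel f hf k (by omega)).2]; exact hc
    have := sound (LinTerm.Rel.comp_add hk w4 w5)
    rwa [← comp_mk w4, ← add_mk w5, ← comp_mk w1, ← comp_mk w2, ← add_mk w3] at this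
  smul_comp {k} a (f g : FreeLinCell C G) hk hc := by
    have hk1 : k ≤ n + 1 := by omega
    have hc := composable C G hk1 hc
    induction f using ind with | _ f hf =>
    induction g using ind with | _ g hg =>
    have w1 : (LinTerm.comp k f g).Wf := LinTerm.wf_comp.2 ⟨hf, hg, hk1, hc⟩
    have w2 : (LinTerm.comp k (.smul a f) g).Wf := LinTerm.wf_comp.2
      ⟨LinTerm.wf_smul.2 hf, hg, hk1, (C.tgt_smul' hk a _).trans hc⟩
    have := sound (LinTerm.Rel.smul_comp hk w2 w1)
    rwa [← comp_mk w2, ← smul_mk, ← smul_mk _ w1, ← comp_mk w1] at this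
  comp_smul {k} a (f g : FreeLinCell C G) hk hc := by
    have hk1 : k ≤ n + 1 := by omega
    have hc := composable C G hk1 hc
    induction f using ind with | _ f hf =>
    induction g using ind with | _ g hg =>
    have w1 : (LinTerm.comp k f g).Wf := LinTerm.wf_comp.2 ⟨hf, hg, hk1, hc⟩
    have w2 : (LinTerm.comp k f (.smul a g)).Wf := LinTerm.wf_comp.2
      ⟨hf, LinTerm.wf_smul.2 hg, hk1, hc.trans (C.src_smul' hk a _).symm⟩
    have := sound (LinTerm.Rel.comp_smul hk w2 w1)
    rwa [← comp_mk w2, ← smul_mk, ← smul_mk _ w1, ← comp_mk w1] at this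

end


namespace NCat

section trunc

variable {n : ℕ} (C : NCat.{u} (n + 1))

theorem src_low {f : C.cell} (h : C.src n f = f) (k : ℕ) : C.src n (C.src k f) = C.src k f := by
  rcases le_or_gt k n with hk | hk
  · exact C.src_src_of_le f hk
  · rw [C.src_src_of_lt f hk, src_of_le f hk, h]

theorem tgt_low {f : C.cell} (h : C.src n f = f) (k : ℕ) : C.src n (C.tgt k f) = C.tgt k f := by
  rcases le_or_gt k n with hk | hk
  · exact C.src_tgt_of_le f hk
  · rw [C.src_tgt_of_lt f hk, tgt_of_le f hk, h]

theorem comp_low {f g : C.cell} (hf : C.src n f = f) (hg : C.src n g = g) {k : ℕ}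
    (h : C.tgt k f = C.src k g) : C.src n (C.comp k f g) = C.comp k f g := by
  rcases lt_or_ge k n with hk | hk
  · rw [C.src_comp_of_lt f g hk h, hf, hg]
  · have e1 : C.src k f = f := by rw [← hf]; exact C.src_src_of_le f hk
    have e2 : C.src k g = g := by rw [← hg]; exact C.src_src_of_le g hk
    have e3 : C.tgt k f = f := by rw [← e1]; exact C.tgt_src_of_le f le_rfl
    rw [e3, e2] at h
    have := C.comp_id k f
    rw [e3] at this
    rw [← h, this, hf]

/-- The underlying `n`-category of an `(n+1)`-category: its cells of dimension at most `n`. -/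
def trunc : NCat.{u} n where
  cell := {f : C.cell // C.src n f = f}
  src k f := ⟨C.src k f.1, src_low C f.2 k⟩
  tgt k f := ⟨C.tgt k f.1, tgt_low C f.2 k⟩
  comp k f g :=
    if h : C.tgt k f.1 = C.src k g.1 then ⟨C.comp k f.1 g.1, comp_low C f.2 g.2 h⟩ else f
  src_top f := Subtype.ext f.2
  src_src_of_lt f h := Subtype.ext (C.src_src_of_lt f.1 h)
  src_tgt_of_lt f h := Subtype.ext (C.src_tgt_of_lt f.1 h)
  tgt_src_of_lt f h := Subtype.ext (C.tgt_src_of_lt f.1 h)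
  tgt_tgt_of_lt f h := Subtype.ext (C.tgt_tgt_of_lt f.1 h)
  src_src_of_le f h := Subtype.ext (C.src_src_of_le f.1 h)
  src_tgt_of_le f h := Subtype.ext (C.src_tgt_of_le f.1 h)
  tgt_src_of_le f h := Subtype.ext (C.tgt_src_of_le f.1 h)
  tgt_tgt_of_le f h := Subtype.ext (C.tgt_tgt_of_le f.1 h)
  src_comp f g h := by
    have h := congrArg Subtype.val h
    simp only [dif_pos h]
    exact Subtype.ext (C.src_comp f.1 g.1 h)
  tgt_comp f g h := by
    have h := congrArg Subtype.val h
    simp only [dif_pos h]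
    exact Subtype.ext (C.tgt_comp f.1 g.1 h)
  src_comp_of_lt {j k} f g hjk h := by
    have h := congrArg Subtype.val h
    have h' : C.tgt j (C.src k f.1) = C.src j (C.src k g.1) := by
      rw [C.tgt_src_of_lt _ hjk, C.src_src_of_lt _ hjk]; exact h
    simp only [dif_pos h, dif_pos h']
    exact Subtype.ext (C.src_comp_of_lt f.1 g.1 hjk h)
  tgt_comp_of_lt {j k} f g hjk h := by
    have h := congrArg Subtype.val h
    have h' : C.tgt j (C.tgt k f.1) = C.src j (C.tgt k g.1) := by
      rw [C.tgt_tgt_of_lt _ hjk, C.src_tgt_of_lt _ hjk]; exact h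
    simp only [dif_pos h, dif_pos h']
    exact Subtype.ext (C.tgt_comp_of_lt f.1 g.1 hjk h)
  id_comp k f := by
    simp only [dif_pos (C.tgt_src_of_le f.1 (le_refl k))]
    exact Subtype.ext (C.id_comp k f.1)
  comp_id k f := by
    simp only [dif_pos (C.src_tgt_of_le f.1 (le_refl k)).symm]
    exact Subtype.ext (C.comp_id k f.1)
  assoc {k} f g e h h' := by
    have h := congrArg Subtype.val h
    have h' := congrArg Subtype.val h'
    have h1 : C.tgt k (C.comp k f.1 g.1) = C.src k e.1 := (C.tgt_comp _ _ h).trans h'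
    have h2 : C.tgt k f.1 = C.src k (C.comp k g.1 e.1) := h.trans (C.src_comp _ _ h').symm
    simp only [dif_pos h, dif_pos h', dif_pos h1, dif_pos h2]
    exact Subtype.ext (C.assoc f.1 g.1 e.1 h h')
  interchange {j k} f g f' g' hjk h1 h2 h3 h4 := by
    have h1 := congrArg Subtype.val h1
    have h2 := congrArg Subtype.val h2
    have h3 := congrArg Subtype.val h3
    have h4 := congrArg Subtype.val h4
    have h5 : C.tgt j (C.comp k f.1 g.1) = C.src j (C.comp k f'.1 g'.1) := by
      rw [tgt_comp_low _ _ hjk h1, src_comp_low _ _ hjk h2]; exact h3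
    have h6 : C.tgt k (C.comp j f.1 f'.1) = C.src k (C.comp j g.1 g'.1) := by
      rw [C.tgt_comp_of_lt _ _ hjk h3, C.src_comp_of_lt _ _ hjk h4]
      exact congrArg₂ (C.comp j) h1 h2
    simp only [dif_pos h1, dif_pos h2, dif_pos h3, dif_pos h4, dif_pos h5, dif_pos h6]
    exact Subtype.ext (C.interchange _ _ _ _ hjk h1 h2 h3 h4)

variable {C}

theorem trunc_comp {k : ℕ} {f g : C.trunc.cell} (h : C.trunc.tgt k f = C.trunc.src k g) :
    (C.trunc.comp k f g).1 = C.comp k f.1 g.1 :=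
  congrArg Subtype.val (dif_pos (congrArg Subtype.val h) : C.trunc.comp k f g = _)

end trunc

end NCat

/-! ### Linear polygraphs and presentations -/

/-- A linear `(n+2,n+1)`-polygraph over `R`: an `(n+1)`-polygraph with a globular extension of the
free linear `(n+1,n+1)`-category on it. -/
structure LinPol (R : Type w) [CommRing R] (n : ℕ) where
  pol : Pol.{u} (n + 1)
  ext : GlobExt.{max u w, v} (lin R pol.free).toNCat

namespace LinPol

variable {R : Type w} [CommRing R] {n : ℕ} (S : LinPol.{u, v} R n)

/-- The free linear `(n+2,n+1)`-category on a linear `(n+2,n+1)`-polygraph. -/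
def free : LinCat.{max u v w} R (n + 2) n := freeLin (lin R S.pol.free) S.ext

/-- The congruence on the free linear `(n+1,n+1)`-category on the underlying polygraph generated by
identifying the source and the target of each generating `(n+2)`-cell. -/
inductive GenRel : (lin R S.pol.free).cell → (lin R S.pol.free).cell → Prop
  | gen (γ : S.ext.gen) : GenRel (S.ext.s γ) (S.ext.t γ)
  | refl (f) : GenRel f f
  | symm {f g} : GenRel f g → GenRel g f
  | trans {f g h} : GenRel f g → GenRel g h → GenRel f h
  | comp {k f f' g g'} : k ≤ n → GenRel f f' → GenRel g g' →
      (lin R S.pol.free).tgt k f = (lin R S.pol.free).src k g →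
      GenRel ((lin R S.pol.free).comp k f g) ((lin R S.pol.free).comp k f' g')
  | add {f f' g g'} : GenRel f f' → GenRel g g' → (lin R S.pol.free).SameHom n f g →
      GenRel ((lin R S.pol.free).add f g) ((lin R S.pol.free).add f' g')
  | smul {f f'} (a : R) : GenRel f f' →
      GenRel ((lin R S.pol.free).smul a f) ((lin R S.pol.free).smul a f')

theorem GenRel.sameHom {f g : (lin R S.pol.free).cell} (h : S.GenRel f g) :
    (lin R S.pol.free).SameHom n f g := by
  induction h with
  | gen γ => exact S.ext.parallel γ n n.lt_succ_self
  | refl f => exact NCat.SameHom.refl n f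
  | symm _ ih => exact ⟨ih.1.symm, ih.2.symm⟩
  | trans _ _ ih ih' => exact ⟨ih.1.trans ih'.1, ih.2.trans ih'.2⟩
  | comp hk _ _ hc ih ih' => exact ih.comp hk ih' hc
  | @add f f' g g' _ _ hs ih ih' =>
    have hs' : (lin R S.pol.free).SameHom n f' g' :=
      ⟨ih.1.symm.trans (hs.1.trans ih'.1), ih.2.symm.trans (hs.2.trans ih'.2)⟩
    exact ⟨by rw [LinCat.src_add _ _ _ hs, LinCat.src_add _ _ _ hs', ih.1],
      by rw [LinCat.tgt_add _ _ _ hs, LinCat.tgt_add _ _ _ hs', ih.2]⟩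
  | smul a _ ih =>
    exact ⟨by rw [LinCat.src_smul, LinCat.src_smul, ih.1],
      by rw [LinCat.tgt_smul, LinCat.tgt_smul, ih.2]⟩

/-- `GenRel` as a congruence. -/
def genCong : LinCong (lin R S.pol.free) where
  r := S.GenRel
  iseqv := ⟨.refl, .symm, .trans⟩
  src_eq h := (h.sameHom S).1
  tgt_eq h := (h.sameHom S).2
  rel_comp := .comp
  rel_add := .add
  rel_smul := .smul

/-- The linear `(n+1,n+1)`-category presented by a linear `(n+2,n+1)`-polygraph: the quotient of the
free linear `(n+1,n+1)`-category by the generating `(n+2)`-cells. -/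
def presented : LinCat.{max u w} R (n + 1) n := S.genCong.quot

/-- The polygraph `S` presents `C` if the linear category that it presents is isomorphic to `C`. -/
def Presents (C : LinCat R (n + 1) n) : Prop := Nonempty (LinIso S.presented C)

end LinPol

/-! ### Grothendieck decategorification of a linear category -/

namespace LinCat

section

variable {R : Type w} [CommRing R] {n : ℕ} (C : LinCat.{u} R (n + 2) (n + 1))

/-- Two `(n+1)`-cells `u` and `v` of a linear `(n+2,n+2)`-category are isomorphic: there is an
`(n+2)`-cell from `u` to `v` that is invertible for `⋆_(n+1)`. -/
def Isomorphic (u v : C.cell) : Prop :=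
  ∃ f g : C.cell, C.src (n + 1) f = u ∧ C.tgt (n + 1) f = v ∧
    C.src (n + 1) g = v ∧ C.tgt (n + 1) g = u ∧
    C.comp (n + 1) f g = u ∧ C.comp (n + 1) g f = v

/-- The `(n+1)`-cell `a` of a linear `(n+2,n+2)`-category is a direct sum of the `(n+1)`-cells `b`
and `c`. -/
def IsDirectSum (a b c : C.cell) : Prop :=
  ∃ pb pc ib ic : C.cell,
    (C.src (n + 1) pb = a ∧ C.tgt (n + 1) pb = b) ∧ (C.src (n + 1) pc = a ∧ C.tgt (n + 1) pc = c) ∧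
    (C.src (n + 1) ib = b ∧ C.tgt (n + 1) ib = a) ∧ (C.src (n + 1) ic = c ∧ C.tgt (n + 1) ic = a) ∧
    C.add (C.comp (n + 1) pb ib) (C.comp (n + 1) pc ic) = a ∧
    C.comp (n + 1) ib pb = b ∧ C.comp (n + 1) ic pc = c

/-- The relators of the Grothendieck decategorification between the `n`-cells `x` and `y`: `[u] - [v]`
for isomorphic `u` and `v`, and `[a] - ([b] + [c])` when `a` is a direct sum of `b` and `c`. -/
inductive Relator (x y : C.trunc.cell) : (C.trunc.cell →₀ ℤ) → Prop
  | iso (u v : C.trunc.cell) : C.trunc.src n u = x → C.trunc.tgt n u = y →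
      C.trunc.src n v = x → C.trunc.tgt n v = y → C.Isomorphic u.1 v.1 →
      Relator x y (Finsupp.single u 1 - Finsupp.single v 1)
  | sum (a b c : C.trunc.cell) : C.trunc.src n a = x → C.trunc.tgt n a = y →
      C.trunc.src n b = x → C.trunc.tgt n b = y → C.trunc.src n c = x → C.trunc.tgt n c = y →
      C.IsDirectSum a.1 b.1 c.1 →
      Relator x y (Finsupp.single a 1 - (Finsupp.single b 1 + Finsupp.single c 1))

/-- The subgroup generated by the relators. -/
def relators (x y : C.trunc.cell) : AddSubgroup (C.trunc.cell →₀ ℤ) :=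
  AddSubgroup.closure {d | C.Relator x y d}

variable {C}

theorem comp_idem (w : C.cell) (hw : C.src (n + 1) w = w) : C.comp (n + 1) w w = w := by
  have h := C.id_comp (n + 1) w
  rwa [hw] at h

theorem tgt_self {w : C.cell} (hw : C.src (n + 1) w = w) : C.tgt (n + 1) w = w := by
  have h := C.tgt_src_of_le w (le_refl (n + 1))
  rwa [hw] at h

theorem Isomorphic.comp_right {u v w : C.cell} {k : ℕ} (hk : k ≤ n) (hw : C.src (n + 1) w = w)
    (hc : C.tgt k u = C.src k w) (h : C.Isomorphic u v) :
    C.Isomorphic (C.comp k u w) (C.comp k v w) := by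
  obtain ⟨f, g, h1, h2, h3, h4, h5, h6⟩ := h
  have hk' : k < n + 1 := by omega
  have cf : C.tgt k f = C.src k w := by rw [← C.tgt_src_of_lt f hk', h1, hc]
  have cg : C.tgt k g = C.src k w := by rw [← C.tgt_tgt_of_lt g hk', h4, hc]
  refine ⟨C.comp k f w, C.comp k g w, ?_, ?_, ?_, ?_, ?_, ?_⟩
  · rw [C.src_comp_of_lt _ _ hk' cf, h1, hw]
  · rw [C.tgt_comp_of_lt _ _ hk' cf, h2, tgt_self hw]
  · rw [C.src_comp_of_lt _ _ hk' cg, h3, hw]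
  · rw [C.tgt_comp_of_lt _ _ hk' cg, h4, tgt_self hw]
  · rw [← C.interchange f g w w hk' (h2.trans h3.symm) ((tgt_self hw).trans hw.symm) cf cg, h5,
      comp_idem w hw]
  · rw [← C.interchange g f w w hk' (h4.trans h1.symm) ((tgt_self hw).trans hw.symm) cg cf, h6,
      comp_idem w hw]

theorem Isomorphic.comp_left {u v w : C.cell} {k : ℕ} (hk : k ≤ n) (hw : C.src (n + 1) w = w)
    (hc : C.tgt k w = C.src k u) (h : C.Isomorphic u v) :
    C.Isomorphic (C.comp k w u) (C.comp k w v) := by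
  obtain ⟨f, g, h1, h2, h3, h4, h5, h6⟩ := h
  have hk' : k < n + 1 := by omega
  have cf : C.tgt k w = C.src k f := by rw [← C.src_src_of_lt f hk', h1, hc]
  have cg : C.tgt k w = C.src k g := by rw [← C.src_tgt_of_lt g hk', h4, hc]
  refine ⟨C.comp k w f, C.comp k w g, ?_, ?_, ?_, ?_, ?_, ?_⟩
  · rw [C.src_comp_of_lt _ _ hk' cf, h1, hw]
  · rw [C.tgt_comp_of_lt _ _ hk' cf, h2, tgt_self hw]
  · rw [C.src_comp_of_lt _ _ hk' cg, h3, hw]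
  · rw [C.tgt_comp_of_lt _ _ hk' cg, h4, tgt_self hw]
  · rw [← C.interchange w w f g hk' ((tgt_self hw).trans hw.symm) (h2.trans h3.symm) cf cg, h5,
      comp_idem w hw]
  · rw [← C.interchange w w g f hk' ((tgt_self hw).trans hw.symm) (h4.trans h1.symm) cg cf, h6,
      comp_idem w hw]

theorem sameHom_comp {a b c p i q j : C.cell} (h1 : C.src (n + 1) p = a) (h2 : C.tgt (n + 1) p = b)
    (h3 : C.src (n + 1) i = b) (h4 : C.tgt (n + 1) i = a) (h5 : C.src (n + 1) q = a)
    (h6 : C.tgt (n + 1) q = c) (h7 : C.src (n + 1) j = c) (h8 : C.tgt (n + 1) j = a) :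
    C.SameHom (n + 1) (C.comp (n + 1) p i) (C.comp (n + 1) q j) :=
  ⟨by rw [C.src_comp _ _ (h2.trans h3.symm), C.src_comp _ _ (h6.trans h7.symm), h1, h5],
    by rw [C.tgt_comp _ _ (h2.trans h3.symm), C.tgt_comp _ _ (h6.trans h7.symm), h4, h8]⟩

theorem IsDirectSum.comp_right {a b c w : C.cell} {k : ℕ} (hk : k ≤ n)
    (hw : C.src (n + 1) w = w) (hc : C.tgt k a = C.src k w) (h : C.IsDirectSum a b c) :
    C.IsDirectSum (C.comp k a w) (C.comp k b w) (C.comp k c w) := by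
  obtain ⟨p, q, i, j, ⟨p1, p2⟩, ⟨q1, q2⟩, ⟨i1, i2⟩, ⟨j1, j2⟩, h1, h2, h3⟩ := h
  have hk' : k < n + 1 := by omega
  have hw' := (tgt_self hw).trans hw.symm
  have cp : C.tgt k p = C.src k w := by rw [← C.tgt_src_of_lt p hk', p1, hc]
  have cq : C.tgt k q = C.src k w := by rw [← C.tgt_src_of_lt q hk', q1, hc]
  have ci : C.tgt k i = C.src k w := by rw [← C.tgt_tgt_of_lt i hk', i2, hc]
  have cj : C.tgt k j = C.src k w := by rw [← C.tgt_tgt_of_lt j hk', j2, hc]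
  refine ⟨C.comp k p w, C.comp k q w, C.comp k i w, C.comp k j w,
    ⟨?_, ?_⟩, ⟨?_, ?_⟩, ⟨?_, ?_⟩, ⟨?_, ?_⟩, ?_, ?_, ?_⟩
  · rw [C.src_comp_of_lt _ _ hk' cp, p1, hw]
  · rw [C.tgt_comp_of_lt _ _ hk' cp, p2, tgt_self hw]
  · rw [C.src_comp_of_lt _ _ hk' cq, q1, hw]
  · rw [C.tgt_comp_of_lt _ _ hk' cq, q2, tgt_self hw]
  · rw [C.src_comp_of_lt _ _ hk' ci, i1, hw]
  · rw [C.tgt_comp_of_lt _ _ hk' ci, i2, tgt_self hw]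
  · rw [C.src_comp_of_lt _ _ hk' cj, j1, hw]
  · rw [C.tgt_comp_of_lt _ _ hk' cj, j2, tgt_self hw]
  · rw [← C.interchange p i w w hk' (p2.trans i1.symm) hw' cp ci,
      ← C.interchange q j w w hk' (q2.trans j1.symm) hw' cq cj, comp_idem w hw,
      ← C.add_comp _ _ _ hk'.le _ (sameHom_comp p1 p2 i1 i2 q1 q2 j1 j2), h1]
    rw [NCat.tgt_comp_low _ _ hk' (p2.trans i1.symm), cp]
  · rw [← C.interchange i p w w hk' (i2.trans p1.symm) hw' ci cp, h2, comp_idem w hw]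
  · rw [← C.interchange j q w w hk' (j2.trans q1.symm) hw' cj cq, h3, comp_idem w hw]

theorem IsDirectSum.comp_left {a b c w : C.cell} {k : ℕ} (hk : k ≤ n)
    (hw : C.src (n + 1) w = w) (hc : C.tgt k w = C.src k a) (h : C.IsDirectSum a b c) :
    C.IsDirectSum (C.comp k w a) (C.comp k w b) (C.comp k w c) := by
  obtain ⟨p, q, i, j, ⟨p1, p2⟩, ⟨q1, q2⟩, ⟨i1, i2⟩, ⟨j1, j2⟩, h1, h2, h3⟩ := h
  have hk' : k < n + 1 := by omega
  have hw' := (tgt_self hw).trans hw.symm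
  have cp : C.tgt k w = C.src k p := by rw [← C.src_src_of_lt p hk', p1, hc]
  have cq : C.tgt k w = C.src k q := by rw [← C.src_src_of_lt q hk', q1, hc]
  have ci : C.tgt k w = C.src k i := by rw [← C.src_tgt_of_lt i hk', i2, hc]
  have cj : C.tgt k w = C.src k j := by rw [← C.src_tgt_of_lt j hk', j2, hc]
  refine ⟨C.comp k w p, C.comp k w q, C.comp k w i, C.comp k w j,
    ⟨?_, ?_⟩, ⟨?_, ?_⟩, ⟨?_, ?_⟩, ⟨?_, ?_⟩, ?_, ?_, ?_⟩
  · rw [C.src_comp_of_lt _ _ hk' cp, p1, hw]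
  · rw [C.tgt_comp_of_lt _ _ hk' cp, p2, tgt_self hw]
  · rw [C.src_comp_of_lt _ _ hk' cq, q1, hw]
  · rw [C.tgt_comp_of_lt _ _ hk' cq, q2, tgt_self hw]
  · rw [C.src_comp_of_lt _ _ hk' ci, i1, hw]
  · rw [C.tgt_comp_of_lt _ _ hk' ci, i2, tgt_self hw]
  · rw [C.src_comp_of_lt _ _ hk' cj, j1, hw]
  · rw [C.tgt_comp_of_lt _ _ hk' cj, j2, tgt_self hw]
  · rw [← C.interchange w w p i hk' hw' (p2.trans i1.symm) cp ci,
      ← C.interchange w w q j hk' hw' (q2.trans j1.symm) cq cj, comp_idem w hw,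
      ← C.comp_add _ _ _ hk'.le _ (sameHom_comp p1 p2 i1 i2 q1 q2 j1 j2), h1]
    rw [NCat.src_comp_low _ _ hk' (p2.trans i1.symm), cp]
  · rw [← C.interchange w w i p hk' hw' (i2.trans p1.symm) ci cp, h2, comp_idem w hw]
  · rw [← C.interchange w w j q hk' hw' (j2.trans q1.symm) cj cq, h3, comp_idem w hw]

end

end LinCat


namespace LinCat

section

variable {R : Type w} [CommRing R] {n : ℕ} {C : LinCat.{u} R (n + 2) (n + 1)}

theorem low_src (w : C.trunc.cell) : C.src (n + 1) w.1 = w.1 := w.2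

/-- The source (for `y = x`) or the target (for `y` the last target) of a composite. -/
def hcomp (k : ℕ) (x x' : C.trunc.cell) (y : C.trunc.cell) : C.trunc.cell :=
  if k = n then y else C.trunc.comp k x x'

theorem src_tcomp {k : ℕ} (hk : k ≤ n) {u w x x' : C.trunc.cell}
    (hc : C.trunc.tgt k u = C.trunc.src k w) (hu : C.trunc.src n u = x)
    (hw : C.trunc.src n w = x') : C.trunc.src n (C.trunc.comp k u w) = hcomp k x x' x := by
  unfold hcomp
  rcases hk.lt_or_eq with h | rfl
  · rw [if_neg h.ne, C.trunc.src_comp_of_lt _ _ h hc, hu, hw]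
  · rw [if_pos rfl, C.trunc.src_comp _ _ hc, hu]

theorem tgt_tcomp {k : ℕ} (hk : k ≤ n) {u w y y' : C.trunc.cell}
    (hc : C.trunc.tgt k u = C.trunc.src k w) (hu : C.trunc.tgt n u = y)
    (hw : C.trunc.tgt n w = y') : C.trunc.tgt n (C.trunc.comp k u w) = hcomp k y y' y' := by
  unfold hcomp
  rcases hk.lt_or_eq with h | rfl
  · rw [if_neg h.ne, C.trunc.tgt_comp_of_lt _ _ h hc, hu, hw]
  · rw [if_pos rfl, C.trunc.tgt_comp _ _ hc, hw]

theorem bil_relator_single {k : ℕ} (hk : k ≤ n) {x y x' y' w : C.trunc.cell}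
    {d : C.trunc.cell →₀ ℤ} (hd : C.Relator x y d) (hx' : C.trunc.src n w = x')
    (hy' : C.trunc.tgt n w = y') (hc : C.trunc.tgt k y = C.trunc.src k x') :
    LinCell.bil k d (Finsupp.single w 1) ∈ C.relators (hcomp k x x' x) (hcomp k y y' y') := by
  have key : ∀ u : C.trunc.cell, C.trunc.tgt n u = y → C.trunc.tgt k u = C.trunc.src k w :=
    fun u hu => by rw [← NCat.tgt_tgt_le hk, hu, hc, ← hx', NCat.src_src_le hk]
  cases hd with
  | iso u v h1 h2 h3 h4 h5 =>
    rw [sub_eq_add_neg, LinCell.add_bil, ← neg_one_smul ℤ (Finsupp.single v (1 : ℤ)),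
      LinCell.smul_bil, LinCell.bil_single, LinCell.bil_single, neg_one_smul, ← sub_eq_add_neg,
      one_mul]
    have cu := key u h2
    have cv := key v h4
    refine AddSubgroup.subset_closure (.iso _ _ (src_tcomp hk cu h1 hx') (tgt_tcomp hk cu h2 hy')
      (src_tcomp hk cv h3 hx') (tgt_tcomp hk cv h4 hy') ?_)
    rw [NCat.trunc_comp cu, NCat.trunc_comp cv]
    exact h5.comp_right hk w.2 (congrArg Subtype.val cu)
  | sum a b c h1 h2 h3 h4 h5 h6 h7 =>
    rw [sub_eq_add_neg, LinCell.add_bil, ← neg_one_smul ℤ (_ + _),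
      LinCell.smul_bil, LinCell.add_bil, LinCell.bil_single, LinCell.bil_single,
      LinCell.bil_single, neg_one_smul, ← sub_eq_add_neg, one_mul]
    have ca := key a h2
    have cb := key b h4
    have cc := key c h6
    refine AddSubgroup.subset_closure (.sum _ _ _ (src_tcomp hk ca h1 hx') (tgt_tcomp hk ca h2 hy')
      (src_tcomp hk cb h3 hx') (tgt_tcomp hk cb h4 hy')
      (src_tcomp hk cc h5 hx') (tgt_tcomp hk cc h6 hy') ?_)
    rw [NCat.trunc_comp ca, NCat.trunc_comp cb, NCat.trunc_comp cc]
    exact h7.comp_right hk w.2 (congrArg Subtype.val ca)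

theorem bil_single_relator {k : ℕ} (hk : k ≤ n) {x y x' y' w : C.trunc.cell}
    {d : C.trunc.cell →₀ ℤ} (hd : C.Relator x' y' d) (hx : C.trunc.src n w = x)
    (hy : C.trunc.tgt n w = y) (hc : C.trunc.tgt k y = C.trunc.src k x') :
    LinCell.bil k (Finsupp.single w 1) d ∈ C.relators (hcomp k x x' x) (hcomp k y y' y') := by
  have key : ∀ u : C.trunc.cell, C.trunc.src n u = x' → C.trunc.tgt k w = C.trunc.src k u :=
    fun u hu => by rw [← NCat.src_src_le hk, hu, ← hc, ← hy, NCat.tgt_tgt_le hk]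
  cases hd with
  | iso u v h1 h2 h3 h4 h5 =>
    rw [sub_eq_add_neg, LinCell.bil_add, ← neg_one_smul ℤ (Finsupp.single v (1 : ℤ)),
      LinCell.bil_smul, LinCell.bil_single, LinCell.bil_single, neg_one_smul, ← sub_eq_add_neg,
      one_mul]
    have cu := key u h1
    have cv := key v h3
    refine AddSubgroup.subset_closure (.iso _ _ (src_tcomp hk cu hx h1) (tgt_tcomp hk cu hy h2)
      (src_tcomp hk cv hx h3) (tgt_tcomp hk cv hy h4) ?_)
    rw [NCat.trunc_comp cu, NCat.trunc_comp cv]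
    exact h5.comp_left hk w.2 (congrArg Subtype.val cu)
  | sum a b c h1 h2 h3 h4 h5 h6 h7 =>
    rw [sub_eq_add_neg, LinCell.bil_add, ← neg_one_smul ℤ (_ + _),
      LinCell.bil_smul, LinCell.bil_add, LinCell.bil_single, LinCell.bil_single,
      LinCell.bil_single, neg_one_smul, ← sub_eq_add_neg, one_mul]
    have ca := key a h1
    have cb := key b h3
    have cc := key c h5
    refine AddSubgroup.subset_closure (.sum _ _ _ (src_tcomp hk ca hx h1) (tgt_tcomp hk ca hy h2)
      (src_tcomp hk cb hx h3) (tgt_tcomp hk cb hy h4)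
      (src_tcomp hk cc hx h5) (tgt_tcomp hk cc hy h6) ?_)
    rw [NCat.trunc_comp ca, NCat.trunc_comp cb, NCat.trunc_comp cc]
    exact h7.comp_left hk w.2 (congrArg Subtype.val ca)

theorem bil_zero_left (k : ℕ) (m : C.trunc.cell →₀ ℤ) : LinCell.bil k 0 m = 0 := by
  simp [LinCell.bil]

theorem bil_zero_right (k : ℕ) (m : C.trunc.cell →₀ ℤ) : LinCell.bil k m 0 = 0 := by
  simp [LinCell.bil]

theorem bil_relators_right {k : ℕ} (hk : k ≤ n) {x y x' y' : C.trunc.cell}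
    {d m : C.trunc.cell →₀ ℤ} (hd : d ∈ C.relators x y)
    (hm : ∀ w ∈ m.support, C.trunc.src n w = x' ∧ C.trunc.tgt n w = y')
    (hc : C.trunc.tgt k y = C.trunc.src k x') :
    LinCell.bil k d m ∈ C.relators (hcomp k x x' x) (hcomp k y y' y') := by
  induction hd using AddSubgroup.closure_induction with
  | mem d hd =>
    rw [← Finsupp.sum_single m, Finsupp.sum, ← (show LinCell.bil k d = _ from rfl)]
    have h : ∀ s : Finset C.trunc.cell, s ⊆ m.support →
        LinCell.bil k d (∑ w ∈ s, Finsupp.single w (m w)) ∈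
          C.relators (hcomp k x x' x) (hcomp k y y' y') := by
      intro s
      induction s using Finset.induction_on with
      | empty => intro _; rw [Finset.sum_empty, bil_zero_right]; exact AddSubgroup.zero_mem _
      | insert w s hw ih =>
        intro hs
        rw [Finset.insert_subset_iff] at hs
        rw [Finset.sum_insert hw, LinCell.bil_add]
        refine AddSubgroup.add_mem _ ?_ (ih hs.2)
        obtain ⟨h1, h2⟩ := hm w hs.1
        have e : Finsupp.single w (m w) = m w • Finsupp.single w (1 : ℤ) := by simp
        rw [e, LinCell.bil_smul]
        exact AddSubgroup.zsmul_mem _ (bil_relator_single hk hd h1 h2 hc) _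
    exact h _ (Finset.Subset.refl _)
  | zero => rw [bil_zero_left]; exact AddSubgroup.zero_mem _
  | add d d' _ _ h h' => rw [LinCell.add_bil]; exact AddSubgroup.add_mem _ h h'
  | neg d _ h =>
    rw [← neg_one_smul ℤ d, LinCell.smul_bil, neg_one_smul]; exact AddSubgroup.neg_mem _ h

theorem bil_relators_left {k : ℕ} (hk : k ≤ n) {x y x' y' : C.trunc.cell}
    {d m : C.trunc.cell →₀ ℤ} (hd : d ∈ C.relators x' y')
    (hm : ∀ w ∈ m.support, C.trunc.src n w = x ∧ C.trunc.tgt n w = y)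
    (hc : C.trunc.tgt k y = C.trunc.src k x') :
    LinCell.bil k m d ∈ C.relators (hcomp k x x' x) (hcomp k y y' y') := by
  induction hd using AddSubgroup.closure_induction with
  | mem d hd =>
    rw [← Finsupp.sum_single m, Finsupp.sum]
    have h : ∀ s : Finset C.trunc.cell, s ⊆ m.support →
        LinCell.bil k (∑ w ∈ s, Finsupp.single w (m w)) d ∈
          C.relators (hcomp k x x' x) (hcomp k y y' y') := by
      intro s
      induction s using Finset.induction_on with
      | empty => intro _; rw [Finset.sum_empty, bil_zero_left]; exact AddSubgroup.zero_mem _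
      | insert w s hw ih =>
        intro hs
        rw [Finset.insert_subset_iff] at hs
        rw [Finset.sum_insert hw, LinCell.add_bil]
        refine AddSubgroup.add_mem _ ?_ (ih hs.2)
        obtain ⟨h1, h2⟩ := hm w hs.1
        have e : Finsupp.single w (m w) = m w • Finsupp.single w (1 : ℤ) := by simp
        rw [e, LinCell.smul_bil]
        exact AddSubgroup.zsmul_mem _ (bil_single_relator hk hd h1 h2 hc) _
    exact h _ (Finset.Subset.refl _)
  | zero => rw [bil_zero_right]; exact AddSubgroup.zero_mem _
  | add d d' _ _ h h' => rw [LinCell.bil_add]; exact AddSubgroup.add_mem _ h h'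
  | neg d _ h =>
    rw [← neg_one_smul ℤ d, LinCell.bil_smul, neg_one_smul]; exact AddSubgroup.neg_mem _ h

variable (C)

/-- The relators as a congruence on the free `ℤ`-linear `(n+1,n+1)`-category on the cells of `C` of
dimension at most `n+1`. -/
def grothendieckCong : LinCong (lin ℤ C.trunc) where
  r (c d : LinCell ℤ C.trunc) := c.s = d.s ∧ c.t = d.t ∧ c.m - d.m ∈ C.relators c.s c.t
  iseqv := by
    refine ⟨fun c => ⟨rfl, rfl, ?_⟩, fun {c d} h => ⟨h.1.symm, h.2.1.symm, ?_⟩,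
      fun {c d e} h h' => ⟨h.1.trans h'.1, h.2.1.trans h'.2.1, ?_⟩⟩
    · rw [sub_self]; exact AddSubgroup.zero_mem _
    · rw [← h.1, ← h.2.1, ← neg_sub]; exact AddSubgroup.neg_mem _ h.2.2
    · have h2 := h'.2.2
      rw [← h.1, ← h.2.1] at h2
      have := AddSubgroup.add_mem _ h.2.2 h2
      rwa [sub_add_sub_cancel] at this
  src_eq {c d} h := by
    change LinCell.src n c = LinCell.src n d
    have e : ∀ c : LinCell ℤ C.trunc, LinCell.src n c = LinCell.ofCell (C.trunc.src n c.s) :=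
      fun c => if_pos le_rfl
    exact (e c).trans ((congrArg (fun x => LinCell.ofCell (C.trunc.src n x)) h.1).trans (e d).symm)
  tgt_eq {c d} h := by
    change LinCell.tgt n c = LinCell.tgt n d
    have e : ∀ c : LinCell ℤ C.trunc, LinCell.tgt n c = LinCell.ofCell (C.trunc.tgt n c.t) :=
      fun c => if_pos le_rfl
    exact (e c).trans
      ((congrArg (fun x => LinCell.ofCell (C.trunc.tgt n x)) h.2.1).trans (e d).symm)
  rel_comp {k c c' d d'} hk h h' hc := by
    have hc : C.trunc.tgt k c.t = C.trunc.src k d.s := (LinCell.composable_iff hk c d).1 hc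
    have hc' : C.trunc.tgt k c'.t = C.trunc.src k d'.s := by rw [← h.2.1, ← h'.1, hc]
    change (LinCell.comp k c d).s = (LinCell.comp k c' d').s ∧
      (LinCell.comp k c d).t = (LinCell.comp k c' d').t ∧
      (LinCell.comp k c d).m - (LinCell.comp k c' d').m ∈
        C.relators (LinCell.comp k c d).s (LinCell.comp k c d).t
    rw [LinCell.comp_eq hk hc, LinCell.comp_eq hk hc']
    refine ⟨by simp only [LinCell.compAux, h.1, h'.1], by simp only [LinCell.compAux, h.2.1, h'.2.1],
      ?_⟩
    have e : LinCell.bil k c.m d.m - LinCell.bil k c'.m d'.m =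
        LinCell.bil k (c.m - c'.m) d.m + LinCell.bil k c'.m (d.m - d'.m) := by
      rw [sub_eq_add_neg c.m, sub_eq_add_neg d.m, LinCell.add_bil, LinCell.bil_add,
        ← neg_one_smul ℤ c'.m, ← neg_one_smul ℤ d'.m, LinCell.smul_bil, LinCell.bil_smul,
        neg_one_smul, neg_one_smul]
      abel
    change LinCell.bil k c.m d.m - LinCell.bil k c'.m d'.m ∈ _
    rw [e]
    refine AddSubgroup.add_mem _ (bil_relators_right hk h.2.2 d.supp hc)
      (bil_relators_left hk h'.2.2 ?_ hc)
    rw [h.1, h.2.1]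
    exact c'.supp
  rel_add {c c' d d'} h h' hs := by
    have hs : c.s = d.s ∧ c.t = d.t := LinCell.sameHom_iff.1 hs
    refine ⟨h.1, h.2.1, ?_⟩
    change (LinCell.add c d).m - (LinCell.add c' d').m ∈ C.relators c.s c.t
    rw [LinCell.add_eq hs.1 hs.2, LinCell.add_eq (h.1.symm.trans (hs.1.trans h'.1))
      (h.2.1.symm.trans (hs.2.trans h'.2.1)), add_sub_add_comm]
    refine AddSubgroup.add_mem _ h.2.2 ?_
    rw [hs.1, hs.2]; exact h'.2.2
  rel_smul {c c'} a h := by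
    refine ⟨h.1, h.2.1, ?_⟩
    change a • c.m - a • c'.m ∈ C.relators c.s c.t
    rw [← _root_.smul_sub]
    exact AddSubgroup.zsmul_mem _ h.2.2 _

/-- The Grothendieck decategorification of a linear `(n+2,n+2)`-category `C`. It is `ℤ`-linear, has
the same `k`-cells as `C` for `k ≤ n`, and the group of `(n+1)`-cells from `x` to `y` is the free
abelian group on the `(n+1)`-cells of `C` from `x` to `y` modulo the relations `[u] = [v]` for `u`
and `v` isomorphic and `[a] = [b] + [c]` for `a` a direct sum of `b` and `c`; composition is the
biadditive one with `[u] ⋆_k [v] = [u ⋆_k v]`. -/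
def grothendieck : LinCat.{u} ℤ (n + 1) n := C.grothendieckCong.quot

end

section

variable {R : Type w} [CommRing R] {n : ℕ} (E : LinCat.{u} R (n + 3) (n + 1))

/-- `(α, β)` is an isomorphism proof between the distinct `(n+1)`-cells `u` and `v`: for some
`(n+2)`-cells `f` from `u` to `v` and `g` from `v` to `u`, `α` is an `(n+3)`-cell from `f ⋆ g` to the
identity of `u` and `β` is an `(n+3)`-cell from `g ⋆ f` to the identity of `v`. -/
def IsoProof (u v α β : E.cell) : Prop :=
  E.src (n + 1) u = u ∧ E.src (n + 1) v = v ∧ u ≠ v ∧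
  ∃ f g : E.cell, (E.src (n + 2) f = f ∧ E.src (n + 1) f = u ∧ E.tgt (n + 1) f = v) ∧
    (E.src (n + 2) g = g ∧ E.src (n + 1) g = v ∧ E.tgt (n + 1) g = u) ∧
    (E.src (n + 2) α = E.comp (n + 1) f g ∧ E.tgt (n + 2) α = u) ∧
    (E.src (n + 2) β = E.comp (n + 1) g f ∧ E.tgt (n + 2) β = v)

/-- The isomorphism proof is minimal: it is not `(w ⋆_k α', w ⋆_k β')` or `(α' ⋆_k w, β' ⋆_k w)` for
an `(n+1)`-cell `w`, some `k < n + 1` and another isomorphism proof `(α', β')`. -/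
def MinimalIsoProof (u v α β : E.cell) : Prop :=
  E.IsoProof u v α β ∧
  ¬ ∃ (w : E.cell) (k : ℕ) (u' v' α' β' : E.cell), E.src (n + 1) w = w ∧ k < n + 1 ∧
    E.IsoProof u' v' α' β' ∧ (α', β') ≠ (α, β) ∧
    ((E.tgt k w = E.src k α' ∧ E.tgt k w = E.src k β' ∧
        α = E.comp k w α' ∧ β = E.comp k w β') ∨
      (E.tgt k α' = E.src k w ∧ E.tgt k β' = E.src k w ∧
        α = E.comp k α' w ∧ β = E.comp k β' w))

/-- `(α, β, γ)` is a direct sum proof of `a ≃ b ⊕ c`: for some `(n+2)`-cells `pb : a → b`,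
`pc : a → c`, `ib : b → a`, `ic : c → a`, the `(n+3)`-cells `α`, `β`, `γ` go from
`pb ⋆ ib + pc ⋆ ic`, `ib ⋆ pb`, `ic ⋆ pc` to the identities of `a`, `b`, `c` respectively. -/
def SumProof (a b c α β γ : E.cell) : Prop :=
  E.src (n + 1) a = a ∧ E.src (n + 1) b = b ∧ E.src (n + 1) c = c ∧
  ∃ pb pc ib ic : E.cell,
    (E.src (n + 2) pb = pb ∧ E.src (n + 1) pb = a ∧ E.tgt (n + 1) pb = b) ∧
    (E.src (n + 2) pc = pc ∧ E.src (n + 1) pc = a ∧ E.tgt (n + 1) pc = c) ∧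
    (E.src (n + 2) ib = ib ∧ E.src (n + 1) ib = b ∧ E.tgt (n + 1) ib = a) ∧
    (E.src (n + 2) ic = ic ∧ E.src (n + 1) ic = c ∧ E.tgt (n + 1) ic = a) ∧
    (E.src (n + 2) α = E.add (E.comp (n + 1) pb ib) (E.comp (n + 1) pc ic) ∧
      E.tgt (n + 2) α = a) ∧
    (E.src (n + 2) β = E.comp (n + 1) ib pb ∧ E.tgt (n + 2) β = b) ∧
    (E.src (n + 2) γ = E.comp (n + 1) ic pc ∧ E.tgt (n + 2) γ = c)

/-- The direct sum proof is minimal: it is not obtained from another direct sum proof by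
`k`-composing, on one side, with an `(n+1)`-cell `w`, for some `k < n + 1`. -/
def MinimalSumProof (a b c α β γ : E.cell) : Prop :=
  E.SumProof a b c α β γ ∧
  ¬ ∃ (w : E.cell) (k : ℕ) (a' b' c' α' β' γ' : E.cell), E.src (n + 1) w = w ∧ k < n + 1 ∧
    E.SumProof a' b' c' α' β' γ' ∧ (α', β', γ') ≠ (α, β, γ) ∧
    ((E.tgt k w = E.src k α' ∧ E.tgt k w = E.src k β' ∧ E.tgt k w = E.src k γ' ∧
        α = E.comp k w α' ∧ β = E.comp k w β' ∧ γ = E.comp k w γ') ∨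
      (E.tgt k α' = E.src k w ∧ E.tgt k β' = E.src k w ∧ E.tgt k γ' = E.src k w ∧
        α = E.comp k α' w ∧ β = E.comp k β' w ∧ γ = E.comp k γ' w))

end

end LinCat

namespace LinPol

variable {R : Type w} [CommRing R] {n : ℕ} (S : LinPol.{u, v} R (n + 1))

/-- The `(n+1)`-cells of the free `(n+1)`-category on the underlying `(n+1)`-polygraph, seen as
`(n+1)`-cells of the free linear `(n+3,n+2)`-category on `S`. -/
def inclLow (u : S.pol.lower.free.cell) : S.free.cell :=
  (FreeLinCell.one (LinCell.ofCell (S.pol.incl u)) : FreeLinCell (lin R S.pol.free) S.ext)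

theorem parallel_of {D : NCat.{u} (n + 1)} {c d : LinCell ℤ D} {x y : D.cell}
    (hc : c.s = D.src n x ∧ c.t = D.tgt n x) (hd : d.s = D.src n y ∧ d.t = D.tgt n y)
    (h : D.Parallel (n + 1) x y) : (lin ℤ D).Parallel (n + 1) c d := by
  intro k hk
  have hk : k ≤ n := Nat.lt_succ_iff.1 hk
  have h := h n n.lt_succ_self
  change LinCell.src k c = LinCell.src k d ∧ LinCell.tgt k c = LinCell.tgt k d
  unfold LinCell.src LinCell.tgt
  rw [if_pos hk, if_pos hk, if_pos hk, if_pos hk, hc.1, hc.2, hd.1, hd.2, h.1, h.2]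
  exact ⟨rfl, rfl⟩

/-- The pairs of distinct `(n+1)`-cells between which there is a minimal isomorphism proof. (Cells
related by an isomorphism proof are automatically parallel.) -/
def IsoGen : Type u :=
  {p : S.pol.lower.free.cell × S.pol.lower.free.cell //
    S.pol.lower.free.Parallel (n + 1) p.1 p.2 ∧ p.1 ≠ p.2 ∧
      ∃ α β, S.free.MinimalIsoProof (S.inclLow p.1) (S.inclLow p.2) α β}

/-- The triples `(a, b, c)` of `(n+1)`-cells such that there is a minimal direct sum proof of
`a ≃ b ⊕ c`. (Such cells are automatically parallel.) -/
def SumGen : Type u :=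
  {p : S.pol.lower.free.cell × S.pol.lower.free.cell × S.pol.lower.free.cell //
    (S.pol.lower.free.Parallel (n + 1) p.1 p.2.1 ∧ S.pol.lower.free.Parallel (n + 1) p.1 p.2.2) ∧
      ∃ α β γ, S.free.MinimalSumProof (S.inclLow p.1) (S.inclLow p.2.1) (S.inclLow p.2.2) α β γ}

/-- The Grothendieck decategorification of a linear `(n+3,n+2)`-polygraph `S`: the `ℤ`-linear
`(n+2,n+1)`-polygraph with the same generating `k`-cells as `S` for `k ≤ n + 1`, one generating
`(n+2)`-cell `u → v` for each pair of distinct `(n+1)`-cells with a minimal isomorphism proof between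
`u` and `v`, and one generating `(n+2)`-cell `a → b + c` for each triple with a minimal direct sum
proof of `a ≃ b ⊕ c`. -/
def grothendieck : LinPol.{u, u} ℤ n where
  pol := S.pol.lower
  ext :=
    { gen := S.IsoGen ⊕ S.SumGen
      s := Sum.elim (fun p => (LinCell.ofCell p.1.1 : LinCell ℤ _))
        (fun p => (LinCell.ofCell p.1.1 : LinCell ℤ _))
      t := Sum.elim (fun p => (LinCell.ofCell p.1.2 : LinCell ℤ _))
        (fun p => LinCell.add (LinCell.ofCell p.1.2.1 : LinCell ℤ _) (LinCell.ofCell p.1.2.2))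
      parallel := by
        rintro (p | p)
        · exact parallel_of ⟨rfl, rfl⟩ ⟨rfl, rfl⟩ p.2.1
        · exact parallel_of ⟨rfl, rfl⟩ ⟨rfl, rfl⟩ p.2.1.1 }

end LinPol

end

/-! The dimension called n in the statement is `n + 2` in the code: the cells being decategorified
have dimension `n + 1`, the morphisms between them have dimension `n + 2`, and the relations between
morphisms are cells of dimension `n + 3`.

Taking linear combinations of `(n+2)`-cells and then dividing by relations between them changes
nothing in lower dimensions. A category `C` presented by `S` therefore has the same cells up to
dimension `n + 1` as the free `(n+1)`-category on the underlying polygraph (`truncIso`). The two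
ℤ-linear categories to be compared become quotients of one free ℤ-linear category, and it remains to
identify two congruences: the one generated by minimal proofs, and the one given by `[u] = [v]` for
isomorphic cells and `[a] = [b] + [c]` for direct sums.

Isomorphisms and direct sums correspond to proofs. An `(n+3)`-cell `α : f → g` of a free linear
category has a reverse, namely `1_f + 1_g - α : g → f`. The relation "there is an `(n+3)`-cell from
`f` to `g`" is thus symmetric, and it is exactly the congruence generated by the generating
`(n+3)`-cells (`genRel_iff`). Each equation `f ⋆ g = 1` that holds in the presented category is then
witnessed by an `(n+3)`-cell, and conversely (`isomorphic_iff_exists_proof`,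
`isDirectSum_iff_exists_proof`). One inclusion of congruences follows, since every generating cell
of the decategorified polygraph comes from a proof (`rel_of_genRel`).

For the other inclusion, every proof has to be reduced to minimal ones. If a proof is obtained from
a different one by composing with a cell `w` along `k`-cells, then `w` is not itself a `k`-cell, for
otherwise the composition would change nothing. The first cell of the proof is then `w ⋆_k u'` or
`u' ⋆_k w`, and `u'` is strictly smaller in a well-founded order: count the generators of top
dimension, then those of the source, and so on downwards (`Smaller`, `smaller_comp_left`,
`smaller_comp_right`). By induction the smaller proof gives a congruence, and congruences are stable
under composition with `w` (`genRel_of_isoProof`, `genRel_of_sumProof`).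

What remains is linear algebra. With the boundary fixed, each element of the subgroup generated by
the relators is a difference `c - c'` of congruent cells. If `f - g = c - c'`, then `f = g + c - c'`
is congruent to `g + c' - c' = g` (`exists_genRel_of_mem_relators`, `genRel_of_rel`). -/

/-! ### Functoriality of the free linear category with respect to isomorphisms. -/

/-- An isomorphism of `n`-categories. -/
structure NCatIso {n : ℕ} (C : NCat.{u} n) (D : NCat.{v} n) extends C.cell ≃ D.cell where
  map_src : ∀ k f, toFun (C.src k f) = D.src k (toFun f)
  map_tgt : ∀ k f, toFun (C.tgt k f) = D.tgt k (toFun f)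
  map_comp : ∀ k f g, C.tgt k f = C.src k g → toFun (C.comp k f g) = D.comp k (toFun f) (toFun g)

namespace NCatIso

variable {n : ℕ} {C : NCat.{u} n} {D : NCat.{v} n} (e : NCatIso C D)

/-- The inverse of an isomorphism of `n`-categories. -/
def symm : NCatIso D C where
  toEquiv := e.toEquiv.symm
  map_src k f := e.toEquiv.injective (by
    simpa using (e.map_src k (e.toEquiv.symm f)).symm)
  map_tgt k f := e.toEquiv.injective (by
    simpa using (e.map_tgt k (e.toEquiv.symm f)).symm)
  map_comp k f g h := e.toEquiv.injective (by
    have h' : C.tgt k (e.toEquiv.symm f) = C.src k (e.toEquiv.symm g) := by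
      apply e.toEquiv.injective
      refine (e.map_tgt k _).trans (Eq.trans ?_ (e.map_src k _).symm)
      simpa using h
    simpa using (e.map_comp k _ _ h').symm)

theorem tgt_eq_src {k : ℕ} {f g : C.cell} (h : C.tgt k f = C.src k g) :
    D.tgt k (e.toFun f) = D.src k (e.toFun g) := by
  rw [← e.map_tgt, h, e.map_src]

theorem parallel {m : ℕ} {f g : C.cell} (h : C.Parallel m f g) :
    D.Parallel m (e.toFun f) (e.toFun g) := fun k hk => by
  rw [← e.map_src, ← e.map_src, ← e.map_tgt, ← e.map_tgt, (h k hk).1, (h k hk).2]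
  exact ⟨rfl, rfl⟩

end NCatIso

namespace LinCell

variable {n : ℕ} {R : Type w} [CommRing R] {C : NCat.{u} (n + 1)} {D : NCat.{v} (n + 1)}
  (e : NCatIso C D)

/-- The action of an isomorphism of `(n+1)`-categories on formal linear combinations. -/
noncomputable def map (c : LinCell R C) : LinCell R D where
  s := e.toFun c.s
  t := e.toFun c.t
  m := c.m.mapDomain e.toFun
  src_s := by rw [← e.map_src, c.src_s]
  src_t := by rw [← e.map_src, c.src_t]
  par := e.parallel c.par
  supp f hf := by
    classical
    obtain ⟨g, hg, rfl⟩ := Finset.mem_image.1 (Finsupp.mapDomain_support hf)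
    rw [← e.map_src, ← e.map_tgt, (c.supp g hg).1, (c.supp g hg).2]
    exact ⟨rfl, rfl⟩

theorem map_ofCell (f : C.cell) : map e (ofCell f : LinCell R C) = ofCell (e.toFun f) := by
  ext1
  · exact e.map_src _ _
  · exact e.map_tgt _ _
  · exact Finsupp.mapDomain_single

theorem map_src (k : ℕ) (c : LinCell R C) : map e (src k c) = src k (map e c) := by
  unfold src
  split_ifs with h
  · rw [map_ofCell, e.map_src]; rfl
  · rfl

theorem map_tgt (k : ℕ) (c : LinCell R C) : map e (tgt k c) = tgt k (map e c) := by
  unfold tgt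
  split_ifs with h
  · rw [map_ofCell, e.map_tgt]; rfl
  · rfl

/-- Both sides are double sums over the two supports, and they agree term by term. Composability has
to be assumed on the supports because an isomorphism controls only the composites that are
meaningful; the other values of `comp` are arbitrary. -/
theorem mapDomain_bil {k : ℕ} (m m' : C.cell →₀ R)
    (h : ∀ f ∈ m.support, ∀ g ∈ m'.support, C.tgt k f = C.src k g) :
    (bil k m m').mapDomain e.toFun = bil k (m.mapDomain e.toFun) (m'.mapDomain e.toFun) := by
  unfold bil
  rw [Finsupp.mapDomain_sum, Finsupp.sum_mapDomain_index (by simp) (by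
    intro f a b
    simp only [add_mul, Finsupp.single_add, Finsupp.sum_add])]
  refine Finsupp.sum_congr fun f hf => ?_
  rw [Finsupp.mapDomain_sum, Finsupp.sum_mapDomain_index (by simp) (by
    intro g a b
    simp only [mul_add, Finsupp.single_add])]
  refine Finsupp.sum_congr fun g hg => ?_
  rw [Finsupp.mapDomain_single, e.map_comp _ _ _ (h f hf g hg)]

theorem map_comp {k : ℕ} {c d : LinCell R C} (h : tgt k c = src k d) :
    map e (comp k c d) = comp k (map e c) (map e d) := by
  by_cases hk : k ≤ n
  · have h1 := (composable_iff hk _ _).1 h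
    have h2 : D.tgt k (map e c).t = D.src k (map e d).s := e.tgt_eq_src h1
    rw [comp_eq hk h1, comp_eq hk h2]
    -- The coefficients behave in the same way for every `k ≤ n`. Only the boundary of the composite
    -- depends on whether `k = n` or `k < n`.
    have hm := mapDomain_bil e c.m d.m fun f hf g hg => composable hk h1 hf hg
    rcases hk.lt_or_eq with hk' | rfl
    · have h3 : C.tgt k c.s = C.src k d.s := by rw [c.tgt_s hk', h1]
      have h4 : C.tgt k c.t = C.src k d.t := by rw [h1, d.src_s' hk']
      refine ext_of ⟨?_, ?_⟩ hm
      · simp only [compAux, map, hk'.ne, if_false]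
        exact e.map_comp _ _ _ h3
      · simp only [compAux, map, hk'.ne, if_false]
        exact e.map_comp _ _ _ h4
    · exact ext_of ⟨by simp only [compAux, map, if_true], by simp only [compAux, map, if_true]⟩ hm
  · rw [comp_of_lt (not_le.1 hk), comp_of_lt (not_le.1 hk)]

theorem map_add {c d : LinCell R C} (h1 : c.s = d.s) (h2 : c.t = d.t) :
    map e (add c d) = add (map e c) (map e d) := by
  refine ext_of ⟨rfl, rfl⟩ ?_
  rw [add_eq (congrArg e.toFun h1) (congrArg e.toFun h2)]
  change (add c d).m.mapDomain e.toFun = _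
  rw [add_eq h1 h2]
  exact Finsupp.mapDomain_add

theorem map_smul (r : R) (c : LinCell R C) : map e (smul r c) = smul r (map e c) :=
  ext_of ⟨rfl, rfl⟩ (Finsupp.mapDomain_smul _ _)

theorem map_symm_map (c : LinCell R C) : map e.symm (map e c) = c := by
  refine ext_of ⟨e.left_inv _, e.left_inv _⟩ ?_
  -- By definition of `symm`, the underlying map of the inverse isomorphism is `e.invFun`.
  change (c.m.mapDomain e.toFun).mapDomain e.invFun = c.m
  rw [← Finsupp.mapDomain_comp, show e.invFun ∘ e.toFun = id from funext e.left_inv,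
    Finsupp.mapDomain_id]

end LinCell

/-- The isomorphism of free linear categories induced by an isomorphism of categories. -/
noncomputable def NCatIso.lin {n : ℕ} (R : Type w) [CommRing R] {C : NCat.{u} (n + 1)}
    {D : NCat.{v} (n + 1)} (e : NCatIso C D) : LinIso (lin R C) (lin R D) where
  toFun := LinCell.map e
  invFun := LinCell.map e.symm
  left_inv := LinCell.map_symm_map e
  right_inv := LinCell.map_symm_map e.symm
  map_src := LinCell.map_src e
  map_tgt := LinCell.map_tgt e
  map_comp _ _ _ h := LinCell.map_comp e h
  map_add _ _ h := LinCell.map_add e (LinCell.sameHom_iff.1 h).1 (LinCell.sameHom_iff.1 h).2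
  map_smul := LinCell.map_smul e

/-! ### Isomorphisms of linear categories: inverses, quotients, invariance of isomorphisms and
direct sums. -/

namespace LinIso

variable {R : Type w} [CommRing R] {n q : ℕ}

theorem tgt_eq_src {C : LinCat.{u} R n q} {D : LinCat.{v} R n q} (e : LinIso C D) {k : ℕ}
    {f g : C.cell} (h : C.tgt k f = C.src k g) : D.tgt k (e.toFun f) = D.src k (e.toFun g) := by
  rw [← e.map_tgt, h, e.map_src]

theorem sameHom {C : LinCat.{u} R n q} {D : LinCat.{v} R n q} (e : LinIso C D)
    {f g : C.cell} (h : C.SameHom q f g) : D.SameHom q (e.toFun f) (e.toFun g) :=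
  ⟨by rw [← e.map_src, h.1, e.map_src], by rw [← e.map_tgt, h.2, e.map_tgt]⟩

/-- The inverse of an isomorphism of linear categories. -/
def symm {C : LinCat.{u} R n q} {D : LinCat.{v} R n q} (e : LinIso C D) : LinIso D C where
  toEquiv := e.toEquiv.symm
  map_src k f := e.toEquiv.injective (by
    simpa using (e.map_src k (e.toEquiv.symm f)).symm)
  map_tgt k f := e.toEquiv.injective (by
    simpa using (e.map_tgt k (e.toEquiv.symm f)).symm)
  map_comp k f g h := e.toEquiv.injective (by
    have h' : C.tgt k (e.toEquiv.symm f) = C.src k (e.toEquiv.symm g) := by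
      apply e.toEquiv.injective
      refine (e.map_tgt k _).trans (Eq.trans ?_ (e.map_src k _).symm)
      simpa using h
    simpa using (e.map_comp k _ _ h').symm)
  map_add f g h := e.toEquiv.injective (by
    have h' : C.SameHom q (e.toEquiv.symm f) (e.toEquiv.symm g) := by
      constructor
      · apply e.toEquiv.injective
        refine (e.map_src q _).trans (Eq.trans ?_ (e.map_src q _).symm)
        simpa using h.1
      · apply e.toEquiv.injective
        refine (e.map_tgt q _).trans (Eq.trans ?_ (e.map_tgt q _).symm)
        simpa using h.2
    simpa using (e.map_add _ _ h').symm)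
  map_smul r f := e.toEquiv.injective (by
    simpa using (e.map_smul r (e.toEquiv.symm f)).symm)

/-- The isomorphism of quotients induced by an isomorphism compatible with the congruences. -/
def quot {C : LinCat.{u} R (n + 1) n} {D : LinCat.{v} R (n + 1) n} (e : LinIso C D)
    (E : LinCong C) (F : LinCong D) (h : ∀ f g, E.r f g ↔ F.r (e.toFun f) (e.toFun g)) :
    LinIso E.quot F.quot where
  toEquiv := Quotient.congr e.toEquiv h
  map_src k f := by
    induction f using LinCong.ind with | _ f => exact congrArg F.cls (e.map_src k f)
  map_tgt k f := by
    induction f using LinCong.ind with | _ f => exact congrArg F.cls (e.map_tgt k f)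
  map_comp k f g hc := by
    induction f using LinCong.ind with | _ f =>
    induction g using LinCong.ind with | _ g =>
    change Quotient.congr e.toEquiv h (E.comp k (E.cls f) (E.cls g)) =
      F.comp k (F.cls (e.toFun f)) (F.cls (e.toFun g))
    by_cases hk : k ≤ n
    · have hc := LinCong.composable hk hc
      rw [LinCong.comp_mk hk hc, LinCong.comp_mk hk (e.tgt_eq_src hc)]
      exact congrArg F.cls (e.map_comp k f g hc)
    -- Above dimension `n`, composition in a quotient returns its first argument by convention.
    · rw [LinCong.comp_of_lt (not_le.1 hk), LinCong.comp_of_lt (not_le.1 hk)]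
      rfl
  map_add f g hc := by
    induction f using LinCong.ind with | _ f =>
    induction g using LinCong.ind with | _ g =>
    change Quotient.congr e.toEquiv h (E.add (E.cls f) (E.cls g)) =
      F.add (F.cls (e.toFun f)) (F.cls (e.toFun g))
    have hc := LinCong.sameHom hc
    rw [LinCong.add_mk hc, LinCong.add_mk (e.sameHom hc)]
    exact congrArg F.cls (e.map_add f g hc)
  map_smul r f := by
    induction f using LinCong.ind with | _ f => exact congrArg F.cls (e.map_smul r f)

variable {C : LinCat.{u} R (n + 2) (n + 1)} {D : LinCat.{v} R (n + 2) (n + 1)} (e : LinIso C D)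

/-- The property is a system of equations between sources, targets and composites, all preserved by
`e`; the witnesses are the images of the witnesses. -/
theorem isomorphic {u v : C.cell} (h : C.Isomorphic u v) :
    D.Isomorphic (e.toFun u) (e.toFun v) := by
  obtain ⟨f, g, rfl, rfl, h3, h4, h5, h6⟩ := h
  refine ⟨e.toFun f, e.toFun g, (e.map_src _ _).symm, (e.map_tgt _ _).symm, ?_, ?_, ?_, ?_⟩
  · rw [← e.map_src, h3]
  · rw [← e.map_tgt, h4]
  · rw [← e.map_comp _ _ _ h3.symm, h5]
  · rw [← e.map_comp _ _ _ h4, h6]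

theorem isDirectSum {a b c : C.cell} (h : C.IsDirectSum a b c) :
    D.IsDirectSum (e.toFun a) (e.toFun b) (e.toFun c) := by
  obtain ⟨p, q, i, j, ⟨p1, p2⟩, ⟨q1, q2⟩, ⟨i1, i2⟩, ⟨j1, j2⟩, h1, h2, h3⟩ := h
  refine ⟨e.toFun p, e.toFun q, e.toFun i, e.toFun j, ?_, ?_, ?_, ?_, ?_, ?_, ?_⟩
  · rw [← e.map_src, ← e.map_tgt, p1, p2]; exact ⟨rfl, rfl⟩
  · rw [← e.map_src, ← e.map_tgt, q1, q2]; exact ⟨rfl, rfl⟩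
  · rw [← e.map_src, ← e.map_tgt, i1, i2]; exact ⟨rfl, rfl⟩
  · rw [← e.map_src, ← e.map_tgt, j1, j2]; exact ⟨rfl, rfl⟩
  -- Additivity of `e` is only available for cells with the same boundary; here both summands go
  -- from `a` to `a`.
  · rw [← e.map_comp _ _ _ (p2.trans i1.symm), ← e.map_comp _ _ _ (q2.trans j1.symm),
      ← e.map_add _ _ (LinCat.sameHom_comp p1 p2 i1 i2 q1 q2 j1 j2), h1]
  · rw [← e.map_comp _ _ _ (i2.trans p1.symm), h2]
  · rw [← e.map_comp _ _ _ (j2.trans q1.symm), h3]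

/-- The converse is the direct implication applied to the inverse isomorphism. -/
theorem isomorphic_iff {u v : C.cell} :
    C.Isomorphic u v ↔ D.Isomorphic (e.toFun u) (e.toFun v) := by
  refine ⟨e.isomorphic, fun h => ?_⟩
  have h := e.symm.isomorphic h
  change C.Isomorphic (e.invFun (e.toFun u)) (e.invFun (e.toFun v)) at h
  rwa [e.left_inv, e.left_inv] at h

theorem isDirectSum_iff {a b c : C.cell} :
    C.IsDirectSum a b c ↔ D.IsDirectSum (e.toFun a) (e.toFun b) (e.toFun c) := by
  refine ⟨e.isDirectSum, fun h => ?_⟩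
  have h := e.symm.isDirectSum h
  change C.IsDirectSum (e.invFun (e.toFun a)) (e.invFun (e.toFun b)) (e.invFun (e.toFun c)) at h
  rwa [e.left_inv, e.left_inv, e.left_inv] at h

end LinIso

/-! ### The congruence generated by a linear polygraph, described by cells of the next dimension. -/

namespace LinCat

variable {R : Type w} [CommRing R] {n q : ℕ} (C : LinCat.{u} R n q)

/-- The identity `f + g - f = g` in the module of cells with the boundary of `f`. It computes the
source and the target of the reverse `1_f + 1_g - α` of a cell `α : f → g`. -/
theorem add_add_neg {f g : C.cell} (h : C.SameHom q f g) :
    C.add (C.add f g) (C.smul (-1) f) = g := by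
  have h' : C.SameHom q g f := ⟨h.1.symm, h.2.symm⟩
  have hs : C.SameHom q f (C.smul (-1) f) := ⟨(C.src_smul _ _).symm, (C.tgt_smul _ _).symm⟩
  -- Opposites are not part of the structure. They come from `(1 + (-1)) • f = 0 • f`.
  have e : C.add f (C.smul (-1) f) = C.zero (C.src q f) (C.tgt q f) := by
    have := C.add_smul 1 (-1) f
    rwa [add_neg_cancel, C.zero_smul, C.one_smul, eq_comm] at this
  rw [C.add_comm _ _ h, C.add_assoc _ _ _ h' hs, e, h.1, h.2, C.add_zero]

end LinCat

namespace LinPol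

variable {R : Type w} [CommRing R] {n : ℕ} (S : LinPol.{u, v} R n)

/-- Each way of building an expression matches a closure property of the congruence: identities give
reflexivity, composition in the top dimension gives transitivity, and the remaining operations give
compatibility with compositions and with the linear structure. -/
theorem genRel_of_term : ∀ f : LinTerm (lin R S.pol.free) S.ext, f.Wf → S.GenRel f.src f.tgt
  | .one x, _ => .refl x
  | .gen γ, _ => .gen γ
  | .comp k f g, ⟨hf, hg, hk, hc⟩ => by
    have rf := genRel_of_term f hf
    have rg := genRel_of_term g hg
    rcases hk.lt_or_eq with h | rfl
    · simp only [LinTerm.src, LinTerm.tgt, h.ne, if_false]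
      -- Well-formedness compares the target of `f` with the source of `g`. For `k ≤ n` the source
      -- and target of `f` have the same `k`-target, so the sources are composable as well.
      exact .comp (Nat.lt_succ_iff.1 h) rf rg (by rw [(f.parallel hf k h).2, hc])
    · simp only [LinTerm.src, LinTerm.tgt, if_true]
      rw [CellExt.top_iff] at hc
      exact rf.trans (hc ▸ rg)
  | .add f g, ⟨hf, hg, h⟩ => .add (genRel_of_term f hf) (genRel_of_term g hg) h
  | .smul a f, hf => .smul a (genRel_of_term f hf)

/-- Two cells are identified by the generating `(n+2)`-cells if and only if they are the source and
the target of an element of `FreeLinCell`. -/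
theorem genRel_iff {f g : (lin R S.pol.free).cell} :
    S.GenRel f g ↔ ∃ α : FreeLinCell (lin R S.pol.free) S.ext, α.s = f ∧ α.t = g := by
  constructor
  · intro h
    induction h with
    | gen γ => exact ⟨.mk (.gen γ) trivial, rfl, rfl⟩
    | refl f => exact ⟨.one f, rfl, rfl⟩
    | @symm f g hr ih =>
      obtain ⟨α, h1, h2⟩ := ih
      have h := hr.sameHom
      have hα : (lin R S.pol.free).SameHom n
          (FreeLinCell.add (.one f) (.one g : FreeLinCell (lin R S.pol.free) S.ext)).s
          (FreeLinCell.smul (-1) α).s := by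
        rw [FreeLinCell.s_add h, FreeLinCell.s_smul, h1]
        exact ⟨(LinCat.src_add _ _ _ h).trans (LinCat.src_smul _ _ _).symm,
          (LinCat.tgt_add _ _ _ h).trans (LinCat.tgt_smul _ _ _).symm⟩
      -- The reverse of `α : f → g` is `1_f + 1_g - α`: its source is `f + g - f = g` and its target
      -- is `f + g - g = f`. Linearity alone makes the existence of a cell symmetric.
      refine ⟨.add (.add (.one f) (.one g)) (.smul (-1) α), ?_, ?_⟩
      · rw [FreeLinCell.s_add hα, FreeLinCell.s_add h, FreeLinCell.s_smul, h1]
        exact LinCat.add_add_neg _ h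
      · rw [FreeLinCell.t_add hα, FreeLinCell.t_add h, FreeLinCell.t_smul, h2]
        have h' : (lin R S.pol.free).SameHom n g f := ⟨h.1.symm, h.2.symm⟩
        rw [FreeLinCell.t_one, FreeLinCell.t_one, LinCat.add_comm _ _ _ h]
        exact LinCat.add_add_neg _ h'
    | trans _ _ ih ih' =>
      obtain ⟨α, h1, h2⟩ := ih
      obtain ⟨β, h3, h4⟩ := ih'
      have h := h2.trans h3.symm
      exact ⟨.comp (n + 1) α β, (FreeLinCell.s_comp_n _ _ h).trans h1,
        (FreeLinCell.t_comp_n _ _ h).trans h4⟩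
    | @comp k f f' g g' hk r r' hc ih ih' =>
      obtain ⟨α, h1, h2⟩ := ih
      obtain ⟨β, h3, h4⟩ := ih'
      have hk' : k < n + 1 := Nat.lt_succ_iff.2 hk
      -- Composability is assumed for `f` and `g`, while composing `α` with `β` requires it for `f'`
      -- and `g`. Congruent cells have the same boundary, so the two conditions agree.
      have h : (lin R S.pol.free).tgt k α.t = (lin R S.pol.free).src k β.s := by
        rw [h2, h3, ← hc, (r.sameHom S).tgt hk]
      exact ⟨.comp k α β, by rw [FreeLinCell.s_comp hk' _ _ h, h1, h3],
        by rw [FreeLinCell.t_comp hk' _ _ h, h2, h4]⟩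
    | add _ _ h ih ih' =>
      obtain ⟨α, h1, h2⟩ := ih
      obtain ⟨β, h3, h4⟩ := ih'
      have h' : (lin R S.pol.free).SameHom n α.s β.s := by rwa [h1, h3]
      exact ⟨.add α β, by rw [FreeLinCell.s_add h', h1, h3],
        by rw [FreeLinCell.t_add h', h2, h4]⟩
    | smul a _ ih =>
      obtain ⟨α, h1, h2⟩ := ih
      exact ⟨.smul a α, by rw [FreeLinCell.s_smul, h1], by rw [FreeLinCell.t_smul, h2]⟩
  · rintro ⟨α, rfl, rfl⟩
    induction α using FreeLinCell.ind with | _ α hα => exact S.genRel_of_term α hα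

end LinPol

/-! ### Counting generators in free categories, and a well-founded comparison of cells. -/

namespace FreeTerm

variable {n : ℕ} {C : NCat.{u} n} {G : GlobExt.{u, v} C}

/-- The number of occurrences of generators in an expression. -/
def count : FreeTerm C G → ℕ
  | one _ => 0
  | gen _ => 1
  | comp _ f g => count f + count g

/-- The axioms of a category only insert identities, move parentheses or permute factors; none of
them creates, deletes or duplicates a generator. The number of generators is therefore an invariant
of a cell, not merely of an expression for it. -/
theorem Rel.count_eq {f g : FreeTerm C G} (h : Rel f g) : f.count = g.count := by
  induction h with
  | refl _ => rfl
  | symm _ ih => exact ih.symm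
  | trans _ _ ih ih' => exact ih.trans ih'
  | congr _ _ _ _ ih ih' => simp only [count, ih, ih']
  | one_comp _ _ => rfl
  | id_comp _ _ => simp only [count, Nat.zero_add]
  | comp_id _ _ => rfl
  | assoc _ _ => simp only [count, Nat.add_assoc]
  | interchange _ _ _ => simp only [count, Nat.add_add_add_comm]

end FreeTerm

namespace FreeCell

variable {n : ℕ} {C : NCat.{u} n} {G : GlobExt.{u, v} C}

/-- The number of generating `(n+1)`-cells that occur in an `(n+1)`-cell. -/
def count : FreeCell C G → ℕ := Quotient.lift (fun f => f.1.count) fun _ _ h => h.count_eq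

theorem count_comp {k : ℕ} (hk : k ≤ n) {f g : FreeCell C G} (h : C.tgt k f.t = C.src k g.s) :
    (comp k f g).count = f.count + g.count := by
  obtain ⟨a, b, ha, hb, hc, rfl, rfl, e⟩ := exists_comp hk f g h
  rw [e]; rfl

/-- An expression without generators is a composite of identities, and such a composite is again an
identity. This is what lets the comparison of cells descend by one dimension when the composed cell
contributes no generator. -/
theorem eq_one_of_count : ∀ (f : FreeTerm C G) (hf : f.Wf), f.count = 0 →
    ∃ x, mk f hf = one x
  | .one x, _, _ => ⟨x, rfl⟩
  | .comp k f g, hw, h => by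
    obtain ⟨hf, hg, hk, hc⟩ := id hw
    have h : f.count + g.count = 0 := h
    obtain ⟨x, hx⟩ := eq_one_of_count f hf (by omega)
    obtain ⟨y, hy⟩ := eq_one_of_count g hg (by omega)
    have hc : C.tgt k (mk f hf).t = C.src k (mk g hg).s := hc
    have e : mk (.comp k f g) hw = comp k (one x) (one y) := by
      rw [← hx, ← hy]
      exact (comp_mk hw).symm
    rw [hx, hy] at hc
    rcases hk.lt_or_eq with hk | rfl
    · exact ⟨C.comp k x y, e.trans (comp_one hk hc)⟩
    -- In the top dimension two identities are composable only if they are equal, and the composite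
    -- is settled by the unit law.
    · obtain rfl : x = y := (CellExt.top_iff x y).1 hc
      have h := (freeCellExt C G).id_comp (one x) (le_refl k)
      refine ⟨x, e.trans ?_⟩
      change comp k (one (C.src k x)) (one x) = one x at h
      rwa [C.src_top] at h

theorem exists_one {f : FreeCell C G} (h : f.count = 0) : ∃ x, f = one x := by
  induction f using ind with | _ f hf => exact eq_one_of_count f hf h

end FreeCell

namespace Pol

/-- The lexicographic comparison of the numbers of generating cells of dimension `n`, `n - 1`, ...,
`1` in an `n`-cell, in its `(n-1)`-source, ... -/
def Smaller : {n : ℕ} → (P : Pol.{u} n) → P.free.cell → P.free.cell → Prop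
  | 0, _ => fun _ _ => False
  | _ + 1, P => InvImage (Prod.Lex (· < ·) (Smaller P.lower))
      fun x : FreeCell P.lower.free P.top => (x.count, x.s)

/-- In dimension 0 the relation is empty; each further dimension is a lexicographic product of the
order of the natural numbers with the relation one dimension below. -/
theorem wellFounded_smaller : {n : ℕ} → (P : Pol.{u} n) → WellFounded P.Smaller
  | 0, _ => ⟨fun _ => ⟨_, fun _ h => h.elim⟩⟩
  | _ + 1, P => InvImage.wf _ (WellFounded.prod_lex wellFounded_lt (wellFounded_smaller P.lower))

/-- Counts add up under composition. If `w` contains a generator of top dimension, the count of the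
composite is strictly larger. Otherwise `w` is the identity of a lower cell, the counts are equal,
and the comparison passes to the sources, where the same argument applies. The descent stops because
a cell `w` that is not a `k`-cell has to contain a generator in some dimension above `k`. -/
theorem smaller_comp_left : {n : ℕ} → (P : Pol.{u} n) → {k : ℕ} → {w x : P.free.cell} →
    P.free.src k w ≠ w → P.free.tgt k w = P.free.src k x → P.Smaller x (P.free.comp k w x)
  | 0, _, _, _, _, hw, _ => (hw (NCat.src_of_le _ (Nat.zero_le _))).elim
  | n + 1, P, k, (w : FreeCell P.lower.free P.top), (x : FreeCell P.lower.free P.top), hw, hc => by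
    have hk : k ≤ n := by
      by_contra hk
      exact hw (NCat.src_of_le (C := P.free) w (by omega))
    have hc : P.lower.free.tgt k w.t = P.lower.free.src k x.s :=
      (CellExt.composable_iff (X := freeCellExt P.lower.free P.top) hk w x).1 hc
    change Prod.Lex _ _ (x.count, x.s) ((FreeCell.comp k w x).count, (FreeCell.comp k w x).s)
    rw [FreeCell.count_comp hk hc, Prod.lex_def]
    rcases Nat.eq_zero_or_pos w.count with h0 | h0
    · obtain ⟨w, rfl⟩ := FreeCell.exists_one h0
      -- The lower cell of which `w` is the identity is still not a `k`-cell. As every cell of an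
      -- `n`-category is a `k`-cell for `k ≥ n`, this forces `k < n`, and the source of the
      -- composite is the composite of the sources.
      have hw : P.lower.free.src k w ≠ w := fun h => hw (by
        change CellExt.src (freeCellExt P.lower.free P.top) k (FreeCell.one w) = FreeCell.one w
        exact (if_pos hk).trans (congrArg FreeCell.one h))
      have hk' : k < n := by
        by_contra hk
        exact hw (NCat.src_of_le _ (by omega))
      refine .inr ⟨by rw [h0, Nat.zero_add], ?_⟩
      dsimp only
      rw [FreeCell.s_comp hk' _ _ hc]
      exact smaller_comp_left P.lower hw hc
    · exact .inl (Nat.lt_add_of_pos_left h0)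

/-- The mirror image of `smaller_comp_left`. -/
theorem smaller_comp_right : {n : ℕ} → (P : Pol.{u} n) → {k : ℕ} → {x w : P.free.cell} →
    P.free.src k w ≠ w → P.free.tgt k x = P.free.src k w → P.Smaller x (P.free.comp k x w)
  | 0, _, _, _, _, hw, _ => (hw (NCat.src_of_le _ (Nat.zero_le _))).elim
  | n + 1, P, k, (x : FreeCell P.lower.free P.top), (w : FreeCell P.lower.free P.top), hw, hc => by
    have hk : k ≤ n := by
      by_contra hk
      exact hw (NCat.src_of_le (C := P.free) w (by omega))
    have hc : P.lower.free.tgt k x.t = P.lower.free.src k w.s :=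
      (CellExt.composable_iff (X := freeCellExt P.lower.free P.top) hk x w).1 hc
    change Prod.Lex _ _ (x.count, x.s) ((FreeCell.comp k x w).count, (FreeCell.comp k x w).s)
    rw [FreeCell.count_comp hk hc, Prod.lex_def]
    rcases Nat.eq_zero_or_pos w.count with h0 | h0
    · obtain ⟨w, rfl⟩ := FreeCell.exists_one h0
      have hw : P.lower.free.src k w ≠ w := fun h => hw (by
        change CellExt.src (freeCellExt P.lower.free P.top) k (FreeCell.one w) = FreeCell.one w
        exact (if_pos hk).trans (congrArg FreeCell.one h))
      have hk' : k < n := by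
        by_contra hk
        exact hw (NCat.src_of_le _ (by omega))
      refine .inr ⟨by rw [h0, Nat.add_zero], ?_⟩
      dsimp only
      rw [FreeCell.s_comp hk' _ _ hc]
      -- The order always looks at sources, whereas composability concerns the target of `x`. Since
      -- source and target of `x` are parallel and `k < n`, they have the same `k`-target.
      exact smaller_comp_right P.lower hw (((x.parallel k hk').2).trans hc)
    · exact .inl (Nat.lt_add_of_pos_right h0)

end Pol

/-! ### Low-dimensional cells inside the free categories and the free linear categories. -/

namespace LinCell

variable {n : ℕ} {R : Type w} [CommRing R] {D : NCat.{u} (n + 1)}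

theorem src_ofCell (k : ℕ) (f : D.cell) : src k (ofCell f : LinCell R D) = ofCell (D.src k f) := by
  unfold src
  split_ifs with h
  · exact congrArg ofCell (NCat.src_src_le h f)
  · rw [NCat.src_of_le f (by omega)]

theorem tgt_ofCell (k : ℕ) (f : D.cell) : tgt k (ofCell f : LinCell R D) = ofCell (D.tgt k f) := by
  unfold tgt
  split_ifs with h
  · exact congrArg ofCell (NCat.tgt_tgt_le h f)
  · rw [NCat.tgt_of_le f (by omega)]

/-- The embedding of an `(n+1)`-category into the free linear category on it preserves
compositions. -/
theorem comp_ofCell_ofCell (k : ℕ) {f g : D.cell} (h : D.tgt k f = D.src k g) :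
    comp k (ofCell f) (ofCell g) = (ofCell (D.comp k f g) : LinCell R D) := by
  by_cases hk : k ≤ n
  · have h' : D.tgt k (ofCell f : LinCell R D).t = D.src k (ofCell g : LinCell R D).s :=
      (NCat.tgt_tgt_le hk f).trans (h.trans (NCat.src_src_le hk g).symm)
    rw [comp_eq hk h']
    rcases hk.lt_or_eq with hk' | rfl
    · ext1
      · simp only [compAux, hk'.ne, if_false, ofCell]
        rw [D.src_comp_of_lt _ _ hk' h]
      · simp only [compAux, hk'.ne, if_false, ofCell]
        rw [D.tgt_comp_of_lt _ _ hk' h]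
      · simp only [compAux, ofCell, bil_single, mul_one]
    · ext1
      · simp only [compAux, if_true, ofCell]
        rw [D.src_comp _ _ h]
      · simp only [compAux, if_true, ofCell]
        rw [D.tgt_comp _ _ h]
      · simp only [compAux, ofCell, bil_single, mul_one]
  -- For `k > n` both compositions are trivial and return the first factor.
  · rw [comp_of_lt (not_le.1 hk), NCat.comp_top (by omega) _ _ h]

end LinCell

namespace Pol

variable {n : ℕ} (P : Pol.{u} (n + 1))

theorem incl_injective : Function.Injective P.incl := fun _ _ h =>
  congrArg (FreeCell.s : FreeCell P.lower.free P.top → _) h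

theorem src_incl (k : ℕ) (x : P.lower.free.cell) :
    P.free.src k (P.incl x) = P.incl (P.lower.free.src k x) := by
  by_cases hk : k ≤ n
  · exact if_pos hk
  · rw [NCat.src_of_le x (by omega)]
    exact NCat.src_of_le (C := P.free) _ (by omega)

theorem tgt_incl (k : ℕ) (x : P.lower.free.cell) :
    P.free.tgt k (P.incl x) = P.incl (P.lower.free.tgt k x) := by
  by_cases hk : k ≤ n
  · exact if_pos hk
  · rw [NCat.tgt_of_le x (by omega)]
    exact NCat.tgt_of_le (C := P.free) _ (by omega)

theorem tgt_incl_eq {k : ℕ} {x y : P.lower.free.cell}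
    (h : P.lower.free.tgt k x = P.lower.free.src k y) :
    P.free.tgt k (P.incl x) = P.free.src k (P.incl y) := by
  rw [P.tgt_incl, P.src_incl, h]

theorem comp_incl (k : ℕ) {x y : P.lower.free.cell}
    (h : P.lower.free.tgt k x = P.lower.free.src k y) :
    P.free.comp k (P.incl x) (P.incl y) = P.incl (P.lower.free.comp k x y) := by
  rcases lt_or_ge k n with hk | hk
  · exact FreeCell.comp_one hk h
  -- For `k ≥ n` composable `n`-cells coincide, and the claim reduces to the unit law for an
  -- identity cell.
  · obtain rfl : x = y := by rwa [NCat.tgt_of_le x hk, NCat.src_of_le y hk] at h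
    rw [NCat.comp_top hk _ _ h]
    have e := P.free.id_comp k (P.incl x)
    rwa [P.src_incl, NCat.src_of_le x hk] at e

/-- In the one-sorted encoding, being an `n`-cell means being fixed by `src n`, and `src n` only
takes identities as values. -/
theorem exists_incl {x : P.free.cell} (h : P.free.src n x = x) : ∃ y, x = P.incl y :=
  ⟨FreeCell.s (C := P.lower.free) (G := P.top) (P.free.src n x), by
    have e : P.free.src n x = P.incl (P.lower.free.src n
      (FreeCell.s (C := P.lower.free) (G := P.top) x)) := if_pos le_rfl
    conv_lhs => rw [← h, e]
    rw [e]; rfl⟩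

end Pol

namespace LinPol

variable {R : Type w} [CommRing R] {n : ℕ} (S : LinPol.{u, v} R (n + 1))

/-- The `(n+1)`-cells of the free `(n+1)`-category on the underlying `(n+1)`-polygraph, seen as
`(n+1)`-cells of the free linear `(n+2,n+2)`-category. -/
noncomputable def lowCell (x : S.pol.lower.free.cell) : (lin R S.pol.free).cell :=
  (LinCell.ofCell (S.pol.incl x) : LinCell R S.pol.free)

theorem src_lowCell (k : ℕ) (x : S.pol.lower.free.cell) :
    (lin R S.pol.free).src k (S.lowCell x) = S.lowCell (S.pol.lower.free.src k x) :=
  (LinCell.src_ofCell k _).trans (congrArg LinCell.ofCell (S.pol.src_incl k x))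

theorem tgt_lowCell (k : ℕ) (x : S.pol.lower.free.cell) :
    (lin R S.pol.free).tgt k (S.lowCell x) = S.lowCell (S.pol.lower.free.tgt k x) :=
  (LinCell.tgt_ofCell k _).trans (congrArg LinCell.ofCell (S.pol.tgt_incl k x))

theorem src_lowCell_self (x : S.pol.lower.free.cell) :
    (lin R S.pol.free).src (n + 1) (S.lowCell x) = S.lowCell x := by
  rw [S.src_lowCell, NCat.src_of_le x le_rfl]

theorem comp_lowCell (k : ℕ) {x y : S.pol.lower.free.cell}
    (h : S.pol.lower.free.tgt k x = S.pol.lower.free.src k y) :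
    (lin R S.pol.free).comp k (S.lowCell x) (S.lowCell y) =
      S.lowCell (S.pol.lower.free.comp k x y) :=
  (LinCell.comp_ofCell_ofCell k (S.pol.tgt_incl_eq h)).trans
    (congrArg LinCell.ofCell (S.pol.comp_incl k h))

/-- An identity cell can be recovered from its linear counterpart, because it is the source recorded
there. This holds over every ring, even the zero ring, where the coefficients carry no information.
-/
theorem lowCell_injective : Function.Injective S.lowCell := fun x y h => by
  refine S.pol.incl_injective ((LinCell.ofCell_inj ?_ ?_).1 h)
  · rw [S.pol.src_incl, NCat.src_of_le x le_rfl]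
  · rw [S.pol.src_incl, NCat.src_of_le y le_rfl]

/-- Only the cells of top dimension are linear combinations: an `(n+1)`-source is by construction
the image of a genuine cell. -/
theorem exists_lowCell {c : (lin R S.pol.free).cell} (h : (lin R S.pol.free).src (n + 1) c = c) :
    ∃ x, c = S.lowCell x := by
  change LinCell R S.pol.free at c
  have e : LinCell.src (n + 1) c = LinCell.ofCell (S.pol.free.src (n + 1) c.s) := if_pos le_rfl
  obtain ⟨x, hx⟩ := S.pol.exists_incl (S.pol.free.src_src_of_le c.s (le_refl (n + 1)))
  exact ⟨x, h.symm.trans (e.trans (congrArg LinCell.ofCell hx))⟩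

theorem inclLow_injective : Function.Injective S.inclLow := fun _ _ h =>
  S.lowCell_injective (congrArg (FreeLinCell.s : FreeLinCell (lin R S.pol.free) S.ext → _) h)

theorem src_inclLow (k : ℕ) (x : S.pol.lower.free.cell) :
    S.free.src k (S.inclLow x) = S.inclLow (S.pol.lower.free.src k x) := by
  by_cases hk : k ≤ n + 2
  · exact (if_pos hk).trans (congrArg FreeLinCell.one (S.src_lowCell k x))
  · rw [NCat.src_of_le x (by omega)]
    exact NCat.src_of_le (C := S.free.toNCat) _ (by omega)

theorem tgt_inclLow (k : ℕ) (x : S.pol.lower.free.cell) :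
    S.free.tgt k (S.inclLow x) = S.inclLow (S.pol.lower.free.tgt k x) := by
  by_cases hk : k ≤ n + 2
  · exact (if_pos hk).trans (congrArg FreeLinCell.one (S.tgt_lowCell k x))
  · rw [NCat.tgt_of_le x (by omega)]
    exact NCat.tgt_of_le (C := S.free.toNCat) _ (by omega)

theorem comp_inclLow {k : ℕ} (hk : k < n + 1) {x y : S.pol.lower.free.cell}
    (h : S.pol.lower.free.tgt k x = S.pol.lower.free.src k y) :
    S.free.comp k (S.inclLow x) (S.inclLow y) = S.inclLow (S.pol.lower.free.comp k x y) := by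
  refine (FreeLinCell.comp_one (by omega) ?_).trans
    (congrArg FreeLinCell.one (S.comp_lowCell k h))
  exact (S.tgt_lowCell k x).trans ((congrArg S.lowCell h).trans (S.src_lowCell k y).symm)

/-- The cells `u`, `v`, `w`, `a`, `b`, `c` in the definition of proofs and of minimality are
`(n+1)`-cells of the free linear `(n+3,n+2)`-category. By this lemma they can be treated as cells of
the free `(n+1)`-category, where generators can be counted. -/
theorem exists_inclLow {c : S.free.cell} (h : S.free.src (n + 1) c = c) :
    ∃ x, c = S.inclLow x := by
  obtain ⟨h1, h2, -⟩ := FreeLinCell.low _ _ h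
  obtain ⟨x, hx⟩ := S.exists_lowCell h2
  exact ⟨x, h1.trans (congrArg FreeLinCell.one hx)⟩

theorem composable_of_inclLow {k : ℕ} {x y : S.pol.lower.free.cell}
    (h : S.free.tgt k (S.inclLow x) = S.free.src k (S.inclLow y)) :
    S.pol.lower.free.tgt k x = S.pol.lower.free.src k y := by
  rw [S.tgt_inclLow, S.src_inclLow] at h
  exact S.inclLow_injective h

/-- Cells between which there is an `(n+2)`-cell are parallel. -/
theorem parallel_of_cell {f : S.free.cell} {x y : S.pol.lower.free.cell}
    (h1 : S.free.src (n + 1) f = S.inclLow x) (h2 : S.free.tgt (n + 1) f = S.inclLow y) :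
    S.pol.lower.free.Parallel (n + 1) x y := fun k hk => by
  constructor
  · apply S.inclLow_injective
    rw [← S.src_inclLow, ← S.src_inclLow, ← h1, ← h2, S.free.src_src_of_lt _ hk,
      S.free.src_tgt_of_lt _ hk]
  · apply S.inclLow_injective
    rw [← S.tgt_inclLow, ← S.tgt_inclLow, ← h1, ← h2, S.free.tgt_src_of_lt _ hk,
      S.free.tgt_tgt_of_lt _ hk]

theorem tgt_inclLow_self {k : ℕ} (hk : n + 1 ≤ k) (x : S.pol.lower.free.cell) :
    S.free.tgt k (S.inclLow x) = S.inclLow x := by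
  rw [S.tgt_inclLow, NCat.tgt_of_le x hk]

theorem src_inclLow_self {k : ℕ} (hk : n + 1 ≤ k) (x : S.pol.lower.free.cell) :
    S.free.src k (S.inclLow x) = S.inclLow x := by
  rw [S.src_inclLow, NCat.src_of_le x hk]

/-! ### Reduction of arbitrary proofs to minimal ones. -/

/-- If the `(n+3)`-cell `α` with target `u` is obtained by composing `w` with a cell `α'` with target
`u'`, then `u` is obtained by composing `w` with `u'`. -/
theorem eq_comp_left {k : ℕ} (hk : k < n + 1) {α α' : S.free.cell} {u u' w : S.pol.lower.free.cell}
    (h : S.free.tgt (n + 2) α = S.inclLow u) (h' : S.free.tgt (n + 2) α' = S.inclLow u')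
    (hc : S.free.tgt k (S.inclLow w) = S.free.src k α')
    (e : α = S.free.comp k (S.inclLow w) α') :
    S.pol.lower.free.tgt k w = S.pol.lower.free.src k u' ∧ u = S.pol.lower.free.comp k w u' := by
  have hk' : k < n + 2 := by omega
  have hc' : S.pol.lower.free.tgt k w = S.pol.lower.free.src k u' := by
    apply S.composable_of_inclLow
    rw [hc, ← h', S.free.src_tgt_of_lt _ hk']
  refine ⟨hc', S.inclLow_injective ?_⟩
  -- The `(n+2)`-targets are used, not the sources, because the cells of a proof end at identities:
  -- their targets return the `(n+1)`-cells themselves.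
  rw [← h, e, S.free.tgt_comp_of_lt _ _ hk' hc, h', S.tgt_inclLow_self (by omega),
    S.comp_inclLow hk hc']

theorem eq_comp_right {k : ℕ} (hk : k < n + 1) {α α' : S.free.cell} {u u' w : S.pol.lower.free.cell}
    (h : S.free.tgt (n + 2) α = S.inclLow u) (h' : S.free.tgt (n + 2) α' = S.inclLow u')
    (hc : S.free.tgt k α' = S.free.src k (S.inclLow w))
    (e : α = S.free.comp k α' (S.inclLow w)) :
    S.pol.lower.free.tgt k u' = S.pol.lower.free.src k w ∧ u = S.pol.lower.free.comp k u' w := by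
  have hk' : k < n + 2 := by omega
  have hc' : S.pol.lower.free.tgt k u' = S.pol.lower.free.src k w := by
    apply S.composable_of_inclLow
    rw [← hc, ← h', S.free.tgt_tgt_of_lt _ hk']
  refine ⟨hc', S.inclLow_injective ?_⟩
  rw [← h, e, S.free.tgt_comp_of_lt _ _ hk' hc, h', S.tgt_inclLow_self (by omega),
    S.comp_inclLow hk hc']

/-- Composing along `k`-cells with a cell that is itself a `k`-cell is composing with a unit.
Minimality only excludes composites of a different proof, so this degenerate case cannot occur and
`w` is a genuinely higher cell. -/
theorem comp_left_of_src_eq {k : ℕ} {α : S.free.cell} {w : S.pol.lower.free.cell}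
    (hw : S.pol.lower.free.src k w = w) (hc : S.free.tgt k (S.inclLow w) = S.free.src k α) :
    S.free.comp k (S.inclLow w) α = α := by
  have e : S.pol.lower.free.tgt k w = w := by rw [← hw, S.pol.lower.free.tgt_src_of_le _ le_rfl]
  rw [S.tgt_inclLow, e] at hc
  rw [hc, S.free.id_comp]

theorem comp_right_of_src_eq {k : ℕ} {α : S.free.cell} {w : S.pol.lower.free.cell}
    (hw : S.pol.lower.free.src k w = w) (hc : S.free.tgt k α = S.free.src k (S.inclLow w)) :
    S.free.comp k α (S.inclLow w) = α := by
  rw [S.src_inclLow, hw] at hc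
  rw [← hc, S.free.comp_id]

theorem genRel_comp_left {k : ℕ} (hk : k < n + 1) {w : S.pol.lower.free.cell}
    {c d : LinCell ℤ S.pol.lower.free} (h : S.grothendieck.GenRel c d)
    (hc : (lin ℤ S.pol.lower.free).tgt k (LinCell.ofCell w : LinCell ℤ S.pol.lower.free) =
      (lin ℤ S.pol.lower.free).src k c) :
    S.grothendieck.GenRel (LinCell.comp k (LinCell.ofCell w : LinCell ℤ S.pol.lower.free) c)
      (LinCell.comp k (LinCell.ofCell w : LinCell ℤ S.pol.lower.free) d) :=
  .comp (Nat.lt_succ_iff.1 hk) (.refl _) h hc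

theorem genRel_comp_right {k : ℕ} (hk : k < n + 1) {w : S.pol.lower.free.cell}
    {c d : LinCell ℤ S.pol.lower.free} (h : S.grothendieck.GenRel c d)
    (hc : (lin ℤ S.pol.lower.free).tgt k c =
      (lin ℤ S.pol.lower.free).src k (LinCell.ofCell w : LinCell ℤ S.pol.lower.free)) :
    S.grothendieck.GenRel (LinCell.comp k c (LinCell.ofCell w : LinCell ℤ S.pol.lower.free))
      (LinCell.comp k d (LinCell.ofCell w : LinCell ℤ S.pol.lower.free)) :=
  .comp (Nat.lt_succ_iff.1 hk) h (.refl _) hc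

/-- The cells related by an isomorphism proof are identified by the Grothendieck decategorification
of the polygraph. -/
theorem genRel_of_isoProof (u v : S.pol.lower.free.cell) (α β : S.free.cell)
    (h : S.free.IsoProof (S.inclLow u) (S.inclLow v) α β) :
    S.grothendieck.GenRel (LinCell.ofCell u : LinCell ℤ S.pol.lower.free)
      (LinCell.ofCell v : LinCell ℤ S.pol.lower.free) := by
  -- The size of the first cell alone controls the induction; the other cell and the proof itself
  -- vary freely.
  induction u using S.pol.lower.wellFounded_smaller.induction generalizing v α β with
  | _ u ih =>
  by_cases hm : S.free.MinimalIsoProof (S.inclLow u) (S.inclLow v) α β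
  · obtain ⟨-, -, hne, f, -, ⟨-, f1, f2⟩, -⟩ := h
    -- A minimal proof is exactly what produces a generating cell. The required parallelism comes
    -- from the morphism `f : u → v`.
    exact GenRel.gen (S := S.grothendieck) (.inl ⟨(u, v), S.parallel_of_cell f1 f2,
      fun e => hne (congrArg S.inclLow e), α, β, hm⟩)
  · have hm := not_not.1 (not_and.1 hm h)
    obtain ⟨w, k, u', v', α', β', hw, hk, h', hne, hcase⟩ := hm
    obtain ⟨u', rfl⟩ := S.exists_inclLow h'.1
    obtain ⟨v', rfl⟩ := S.exists_inclLow h'.2.1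
    obtain ⟨w, rfl⟩ := S.exists_inclLow hw
    obtain ⟨-, -, -, -, -, -, -, ⟨-, hα⟩, ⟨-, hβ⟩⟩ := h
    obtain ⟨-, -, -, -, -, -, -, ⟨-, hα'⟩, ⟨-, hβ'⟩⟩ := id h'
    rcases hcase with ⟨c1, c2, e1, e2⟩ | ⟨c1, c2, e1, e2⟩
    -- Both related cells decompose with the same `w`: `u = w ⋆_k u'` and `v = w ⋆_k v'`.
    · obtain ⟨d1, rfl⟩ := S.eq_comp_left hk hα hα' c1 e1
      obtain ⟨d2, rfl⟩ := S.eq_comp_left hk hβ hβ' c2 e2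
      -- If `w` were a `k`-cell, the two proofs would be equal, contrary to the choice of `(α',
      -- β')`.
      have hw' : S.pol.lower.free.src k w ≠ w := fun hw' => hne (by
        rw [e1, e2, S.comp_left_of_src_eq hw' c1, S.comp_left_of_src_eq hw' c2])
      have r := ih u' (S.pol.lower.smaller_comp_left hw' d1) v' α' β' h'
      rw [← LinCell.comp_ofCell_ofCell k d1, ← LinCell.comp_ofCell_ofCell k d2]
      -- The smaller proof makes `u'` and `v'` congruent, and composing with `w` carries this over
      -- to `u` and `v`.
      refine S.genRel_comp_left hk r ?_
      exact (LinCell.tgt_ofCell k w).trans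
        ((congrArg LinCell.ofCell d1).trans (LinCell.src_ofCell k u').symm)
    · obtain ⟨d1, rfl⟩ := S.eq_comp_right hk hα hα' c1 e1
      obtain ⟨d2, rfl⟩ := S.eq_comp_right hk hβ hβ' c2 e2
      have hw' : S.pol.lower.free.src k w ≠ w := fun hw' => hne (by
        rw [e1, e2, S.comp_right_of_src_eq hw' c1, S.comp_right_of_src_eq hw' c2])
      have r := ih u' (S.pol.lower.smaller_comp_right hw' d1) v' α' β' h'
      rw [← LinCell.comp_ofCell_ofCell k d1, ← LinCell.comp_ofCell_ofCell k d2]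
      refine S.genRel_comp_right hk r ?_
      exact (LinCell.tgt_ofCell k u').trans
        ((congrArg LinCell.ofCell d1).trans (LinCell.src_ofCell k w).symm)

theorem sameHom_ofCell {a b : S.pol.lower.free.cell}
    (h : S.pol.lower.free.Parallel (n + 1) a b) :
    (lin ℤ S.pol.lower.free).SameHom n (LinCell.ofCell a : LinCell ℤ S.pol.lower.free)
      (LinCell.ofCell b : LinCell ℤ S.pol.lower.free) :=
  LinCell.sameHom_iff.2 (h n n.lt_succ_self)

/-- The cells related by a direct sum proof are related in the Grothendieck decategorification of the
polygraph. -/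
theorem genRel_of_sumProof (a b c : S.pol.lower.free.cell) (α β γ : S.free.cell)
    (h : S.free.SumProof (S.inclLow a) (S.inclLow b) (S.inclLow c) α β γ) :
    S.grothendieck.GenRel (LinCell.ofCell a : LinCell ℤ S.pol.lower.free)
      (LinCell.add (LinCell.ofCell b : LinCell ℤ S.pol.lower.free) (LinCell.ofCell c)) := by
  induction a using S.pol.lower.wellFounded_smaller.induction generalizing b c α β γ with
  | _ a ih =>
  by_cases hm : S.free.MinimalSumProof (S.inclLow a) (S.inclLow b) (S.inclLow c) α β γ
  · obtain ⟨-, -, -, p, q, -, -, ⟨-, p1, p2⟩, ⟨-, q1, q2⟩, -⟩ := h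
    exact GenRel.gen (S := S.grothendieck) (.inr ⟨(a, b, c), ⟨S.parallel_of_cell p1 p2,
      S.parallel_of_cell q1 q2⟩, α, β, γ, hm⟩)
  · have hm := not_not.1 (not_and.1 hm h)
    obtain ⟨w, k, a', b', c', α', β', γ', hw, hk, h', hne, hcase⟩ := hm
    obtain ⟨a', rfl⟩ := S.exists_inclLow h'.1
    obtain ⟨b', rfl⟩ := S.exists_inclLow h'.2.1
    obtain ⟨c', rfl⟩ := S.exists_inclLow h'.2.2.1
    obtain ⟨w, rfl⟩ := S.exists_inclLow hw
    obtain ⟨-, -, -, p, q, -, -, ⟨-, p1, p2⟩, ⟨-, q1, q2⟩, -, -, ⟨-, hα⟩, ⟨-, hβ⟩, ⟨-, hγ⟩⟩ := h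
    obtain ⟨-, -, -, p', q', -, -, ⟨-, p1', p2'⟩, ⟨-, q1', q2'⟩, -, -, ⟨-, hα'⟩, ⟨-, hβ'⟩, ⟨-, hγ'⟩⟩ :=
      id h'
    -- The sum of `b'` and `c'` is meaningful because both are parallel to `a'`, by the two
    -- projections of the smaller proof.
    have hbc : (lin ℤ S.pol.lower.free).SameHom n
        (LinCell.ofCell b' : LinCell ℤ S.pol.lower.free)
        (LinCell.ofCell c' : LinCell ℤ S.pol.lower.free) := by
      have h1 := S.sameHom_ofCell (S.parallel_of_cell p1' p2')
      have h2 := S.sameHom_ofCell (S.parallel_of_cell q1' q2')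
      exact ⟨h1.1.symm.trans h2.1, h1.2.symm.trans h2.2⟩
    have hk' : k ≤ n := Nat.lt_succ_iff.1 hk
    have key : ∀ x y : S.pol.lower.free.cell, S.pol.lower.free.tgt k x = S.pol.lower.free.src k y →
        (lin ℤ S.pol.lower.free).tgt k (LinCell.ofCell x : LinCell ℤ S.pol.lower.free) =
          (lin ℤ S.pol.lower.free).src k (LinCell.ofCell y : LinCell ℤ S.pol.lower.free) :=
      fun x y d => (LinCell.tgt_ofCell k x).trans
        ((congrArg LinCell.ofCell d).trans (LinCell.src_ofCell k y).symm)
    rcases hcase with ⟨c1, c2, c3, e1, e2, e3⟩ | ⟨c1, c2, c3, e1, e2, e3⟩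
    · obtain ⟨d1, rfl⟩ := S.eq_comp_left hk hα hα' c1 e1
      obtain ⟨d2, rfl⟩ := S.eq_comp_left hk hβ hβ' c2 e2
      obtain ⟨d3, rfl⟩ := S.eq_comp_left hk hγ hγ' c3 e3
      have hw' : S.pol.lower.free.src k w ≠ w := fun hw' => hne (by
        rw [e1, e2, e3, S.comp_left_of_src_eq hw' c1, S.comp_left_of_src_eq hw' c2,
          S.comp_left_of_src_eq hw' c3])
      have r := ih a' (S.pol.lower.smaller_comp_left hw' d1) b' c' α' β' γ' h'
      rw [← LinCell.comp_ofCell_ofCell k d1]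
      -- Compared with the case of isomorphisms, distributivity is needed too: `w ⋆_k (b' + c')` has
      -- to be rewritten as `w ⋆_k b' + w ⋆_k c'`.
      have e := LinCat.comp_add (lin ℤ S.pol.lower.free) (k := k)
        (LinCell.ofCell w : LinCell ℤ S.pol.lower.free) _ _ hk' (key w b' d2) hbc
      have r' := S.genRel_comp_left hk r (key w a' d1)
      exact (e.trans (congrArg₂ LinCell.add (LinCell.comp_ofCell_ofCell k d2)
        (LinCell.comp_ofCell_ofCell k d3))) ▸ r'
    · obtain ⟨d1, rfl⟩ := S.eq_comp_right hk hα hα' c1 e1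
      obtain ⟨d2, rfl⟩ := S.eq_comp_right hk hβ hβ' c2 e2
      obtain ⟨d3, rfl⟩ := S.eq_comp_right hk hγ hγ' c3 e3
      have hw' : S.pol.lower.free.src k w ≠ w := fun hw' => hne (by
        rw [e1, e2, e3, S.comp_right_of_src_eq hw' c1, S.comp_right_of_src_eq hw' c2,
          S.comp_right_of_src_eq hw' c3])
      have r := ih a' (S.pol.lower.smaller_comp_right hw' d1) b' c' α' β' γ' h'
      rw [← LinCell.comp_ofCell_ofCell k d1]
      have e := LinCat.add_comp (lin ℤ S.pol.lower.free) (k := k) _ _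
        (LinCell.ofCell w : LinCell ℤ S.pol.lower.free) hk' (key b' w d2) hbc
      have r' := S.genRel_comp_right hk r (key a' w d1)
      exact (e.trans (congrArg₂ LinCell.add (LinCell.comp_ofCell_ofCell k d2)
        (LinCell.comp_ofCell_ofCell k d3))) ▸ r'

end LinPol

/-! ### Proofs as witnesses of isomorphisms and direct sums in the presented category. -/

namespace LinPol

section

variable {R : Type w} [CommRing R] {n : ℕ} (S : LinPol.{u, v} R n)

/-- The `(n+1)`-cells of the free linear `(n+1,n+1)`-category as cells of the free linear
`(n+2,n+1)`-category. -/
noncomputable def incl (f : (lin R S.pol.free).cell) : S.free.cell :=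
  (FreeLinCell.one f : FreeLinCell (lin R S.pol.free) S.ext)

theorem incl_injective : Function.Injective S.incl := fun _ _ h =>
  congrArg (FreeLinCell.s : FreeLinCell (lin R S.pol.free) S.ext → _) h

theorem src_incl {k : ℕ} (hk : k ≤ n + 1) (f : (lin R S.pol.free).cell) :
    S.free.src k (S.incl f) = S.incl ((lin R S.pol.free).src k f) := if_pos hk

theorem tgt_incl {k : ℕ} (hk : k ≤ n + 1) (f : (lin R S.pol.free).cell) :
    S.free.tgt k (S.incl f) = S.incl ((lin R S.pol.free).tgt k f) := if_pos hk

theorem comp_incl {k : ℕ} (hk : k < n + 1) {f g : (lin R S.pol.free).cell}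
    (h : (lin R S.pol.free).tgt k f = (lin R S.pol.free).src k g) :
    S.free.comp k (S.incl f) (S.incl g) = S.incl ((lin R S.pol.free).comp k f g) :=
  FreeLinCell.comp_one hk h

theorem add_incl {f g : (lin R S.pol.free).cell} (h : (lin R S.pol.free).SameHom n f g) :
    S.free.add (S.incl f) (S.incl g) = S.incl ((lin R S.pol.free).add f g) :=
  FreeLinCell.one_add h

/-- Used to turn the morphisms that occur in a proof into actual cells of the free linear category,
whose classes can then be taken. -/
theorem exists_incl {x : S.free.cell} (h : S.free.src (n + 1) x = x) : ∃ f, x = S.incl f :=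
  ⟨_, h.symm.trans (if_pos le_rfl)⟩

/-- Two cells are identified by the generating `(n+2)`-cells if and only if there is an `(n+2)`-cell
of the free linear `(n+2,n+1)`-category between them. -/
theorem genRel_iff_exists_cell {f g : (lin R S.pol.free).cell} :
    S.GenRel f g ↔ ∃ α, S.free.src (n + 1) α = S.incl f ∧ S.free.tgt (n + 1) α = S.incl g := by
  -- The one-sorted `src` and `tgt` are the identities on the source and target of the underlying
  -- `(n+2)`-cell, so this is `genRel_iff` in another notation.
  have h1 : ∀ α : FreeLinCell (lin R S.pol.free) S.ext,
      S.free.src (n + 1) α = S.incl α.s := fun α =>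
    (if_pos le_rfl).trans (congrArg FreeLinCell.one ((lin R S.pol.free).src_top _))
  have h2 : ∀ α : FreeLinCell (lin R S.pol.free) S.ext,
      S.free.tgt (n + 1) α = S.incl α.t := fun α =>
    (if_pos le_rfl).trans (congrArg FreeLinCell.one (NCat.tgt_of_le _ le_rfl))
  rw [S.genRel_iff]
  refine exists_congr fun α => ?_
  rw [h1 α, h2 α, S.incl_injective.eq_iff, S.incl_injective.eq_iff]

/-- The class of a cell in the presented linear category. -/
noncomputable def cls (f : (lin R S.pol.free).cell) : S.presented.cell := S.genCong.cls f

theorem cls_eq_iff {f g : (lin R S.pol.free).cell} : S.cls f = S.cls g ↔ S.GenRel f g :=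
  ⟨fun h => LinCong.rel_of_eq h, fun h => Quotient.sound h⟩

theorem exists_cls (c : S.presented.cell) : ∃ f, c = S.cls f := by
  induction c using LinCong.ind with | _ f => exact ⟨f, rfl⟩

theorem src_cls (k : ℕ) (f : (lin R S.pol.free).cell) :
    S.presented.src k (S.cls f) = S.cls ((lin R S.pol.free).src k f) := rfl

theorem tgt_cls (k : ℕ) (f : (lin R S.pol.free).cell) :
    S.presented.tgt k (S.cls f) = S.cls ((lin R S.pol.free).tgt k f) := rfl

theorem comp_cls {k : ℕ} (hk : k ≤ n) {f g : (lin R S.pol.free).cell}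
    (h : (lin R S.pol.free).tgt k f = (lin R S.pol.free).src k g) :
    S.presented.comp k (S.cls f) (S.cls g) = S.cls ((lin R S.pol.free).comp k f g) :=
  LinCong.comp_mk hk h

theorem add_cls {f g : (lin R S.pol.free).cell} (h : (lin R S.pol.free).SameHom n f g) :
    S.presented.add (S.cls f) (S.cls g) = S.cls ((lin R S.pol.free).add f g) :=
  LinCong.add_mk h

end

variable {R : Type w} [CommRing R] {n : ℕ} (S : LinPol.{u, v} R (n + 1))

theorem incl_lowCell (x : S.pol.lower.free.cell) : S.incl (S.lowCell x) = S.inclLow x := rfl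

/-- Congruent cells have equal `(n+1)`-sources, and a low-dimensional cell is its own source.
Dividing by the relations therefore identifies nothing in dimension `n + 1`. -/
theorem cls_lowCell_injective : Function.Injective fun x => S.cls (S.lowCell x) := fun x y h =>
  S.lowCell_injective
    (LinCong.low le_rfl (S.src_lowCell_self x) (S.src_lowCell_self y) h)

/-- Boundaries can be read off before passing to classes. Consequently arbitrary representatives of
composable morphisms are already composable in the free linear category. -/
theorem src_eq_lowCell {f : (lin R S.pol.free).cell} {x : S.pol.lower.free.cell}
    (h : S.presented.src (n + 1) (S.cls f) = S.cls (S.lowCell x)) :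
    (lin R S.pol.free).src (n + 1) f = S.lowCell x :=
  LinCong.low le_rfl ((lin R S.pol.free).src_src_of_le f le_rfl) (S.src_lowCell_self x) h

theorem tgt_eq_lowCell {f : (lin R S.pol.free).cell} {x : S.pol.lower.free.cell}
    (h : S.presented.tgt (n + 1) (S.cls f) = S.cls (S.lowCell x)) :
    (lin R S.pol.free).tgt (n + 1) f = S.lowCell x :=
  LinCong.low le_rfl ((lin R S.pol.free).src_tgt_of_le f le_rfl) (S.src_lowCell_self x) h

theorem src_incl_iff {f : (lin R S.pol.free).cell} {x : S.pol.lower.free.cell} :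
    S.free.src (n + 1) (S.incl f) = S.inclLow x ↔
      (lin R S.pol.free).src (n + 1) f = S.lowCell x := by
  rw [S.src_incl (by omega), ← S.incl_lowCell, S.incl_injective.eq_iff]

theorem tgt_incl_iff {f : (lin R S.pol.free).cell} {x : S.pol.lower.free.cell} :
    S.free.tgt (n + 1) (S.incl f) = S.inclLow x ↔
      (lin R S.pol.free).tgt (n + 1) f = S.lowCell x := by
  rw [S.tgt_incl (by omega), ← S.incl_lowCell, S.incl_injective.eq_iff]

theorem src_incl_self (f : (lin R S.pol.free).cell) :
    S.free.src (n + 2) (S.incl f) = S.incl f := by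
  rw [S.src_incl le_rfl, (lin R S.pol.free).src_top]

/-- Distinct `(n+1)`-cells are isomorphic in the presented category if and only if there is an
isomorphism proof between them. -/
theorem isomorphic_iff_exists_proof {x y : S.pol.lower.free.cell} (hxy : x ≠ y) :
    S.presented.Isomorphic (S.cls (S.lowCell x)) (S.cls (S.lowCell y)) ↔
      ∃ α β, S.free.IsoProof (S.inclLow x) (S.inclLow y) α β := by
  constructor
  · rintro ⟨f, g, h1, h2, h3, h4, h5, h6⟩
    obtain ⟨f, rfl⟩ := S.exists_cls f
    obtain ⟨g, rfl⟩ := S.exists_cls g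
    replace h1 := S.src_eq_lowCell h1
    replace h2 := S.tgt_eq_lowCell h2
    replace h3 := S.src_eq_lowCell h3
    replace h4 := S.tgt_eq_lowCell h4
    -- The equation `f ⋆ g = 1` between classes becomes the existence of an `(n+3)`-cell from the
    -- composite of the representatives to the identity: one component of an isomorphism proof.
    rw [S.comp_cls le_rfl (h2.trans h3.symm), S.cls_eq_iff, S.genRel_iff_exists_cell,
      ← S.comp_incl (by omega) (h2.trans h3.symm)] at h5
    rw [S.comp_cls le_rfl (h4.trans h1.symm), S.cls_eq_iff, S.genRel_iff_exists_cell,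
      ← S.comp_incl (by omega) (h4.trans h1.symm)] at h6
    obtain ⟨α, hα⟩ := h5
    obtain ⟨β, hβ⟩ := h6
    exact ⟨α, β, S.src_inclLow_self le_rfl x, S.src_inclLow_self le_rfl y,
      fun h => hxy (S.inclLow_injective h), S.incl f, S.incl g,
      ⟨S.src_incl_self f, S.src_incl_iff.2 h1, S.tgt_incl_iff.2 h2⟩,
      ⟨S.src_incl_self g, S.src_incl_iff.2 h3, S.tgt_incl_iff.2 h4⟩, hα, hβ⟩
  · rintro ⟨α, β, -, -, -, f, g, ⟨hf, h1, h2⟩, ⟨hg, h3, h4⟩, hα, hβ⟩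
    -- Conversely, the morphisms of a proof have inverse classes, since the two `(n+3)`-cells force
    -- the required equations in the quotient.
    obtain ⟨f, rfl⟩ := S.exists_incl hf
    obtain ⟨g, rfl⟩ := S.exists_incl hg
    rw [S.src_incl_iff] at h1 h3
    rw [S.tgt_incl_iff] at h2 h4
    rw [S.comp_incl (by omega) (h2.trans h3.symm)] at hα
    rw [S.comp_incl (by omega) (h4.trans h1.symm)] at hβ
    refine ⟨S.cls f, S.cls g, congrArg S.cls h1, congrArg S.cls h2, congrArg S.cls h3,
      congrArg S.cls h4, ?_, ?_⟩
    · rw [S.comp_cls le_rfl (h2.trans h3.symm), S.cls_eq_iff]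
      exact S.genRel_iff_exists_cell.2 ⟨α, hα⟩
    · rw [S.comp_cls le_rfl (h4.trans h1.symm), S.cls_eq_iff]
      exact S.genRel_iff_exists_cell.2 ⟨β, hβ⟩

/-- Direct sums in the presented category correspond to direct sum proofs. -/
theorem isDirectSum_iff_exists_proof {a b c : S.pol.lower.free.cell} :
    S.presented.IsDirectSum (S.cls (S.lowCell a)) (S.cls (S.lowCell b)) (S.cls (S.lowCell c)) ↔
      ∃ α β γ, S.free.SumProof (S.inclLow a) (S.inclLow b) (S.inclLow c) α β γ := by
  constructor
  · rintro ⟨p, q, i, j, ⟨p1, p2⟩, ⟨q1, q2⟩, ⟨i1, i2⟩, ⟨j1, j2⟩, h1, h2, h3⟩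
    obtain ⟨p, rfl⟩ := S.exists_cls p
    obtain ⟨q, rfl⟩ := S.exists_cls q
    obtain ⟨i, rfl⟩ := S.exists_cls i
    obtain ⟨j, rfl⟩ := S.exists_cls j
    replace p1 := S.src_eq_lowCell p1
    replace p2 := S.tgt_eq_lowCell p2
    replace q1 := S.src_eq_lowCell q1
    replace q2 := S.tgt_eq_lowCell q2
    replace i1 := S.src_eq_lowCell i1
    replace i2 := S.tgt_eq_lowCell i2
    replace j1 := S.src_eq_lowCell j1
    replace j2 := S.tgt_eq_lowCell j2
    -- The composites `p ⋆ i` and `q ⋆ j` are both endomorphisms of `a`, so their sum can be formed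
    -- before passing to classes and agrees with the sum of the classes.
    have hs := LinCat.sameHom_comp p1 p2 i1 i2 q1 q2 j1 j2
    rw [S.comp_cls le_rfl (p2.trans i1.symm), S.comp_cls le_rfl (q2.trans j1.symm), S.add_cls hs,
      S.cls_eq_iff, S.genRel_iff_exists_cell, ← S.add_incl hs,
      ← S.comp_incl (by omega) (p2.trans i1.symm), ← S.comp_incl (by omega) (q2.trans j1.symm)] at h1
    rw [S.comp_cls le_rfl (i2.trans p1.symm), S.cls_eq_iff, S.genRel_iff_exists_cell,
      ← S.comp_incl (by omega) (i2.trans p1.symm)] at h2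
    rw [S.comp_cls le_rfl (j2.trans q1.symm), S.cls_eq_iff, S.genRel_iff_exists_cell,
      ← S.comp_incl (by omega) (j2.trans q1.symm)] at h3
    obtain ⟨α, hα⟩ := h1
    obtain ⟨β, hβ⟩ := h2
    obtain ⟨γ, hγ⟩ := h3
    exact ⟨α, β, γ, S.src_inclLow_self le_rfl a, S.src_inclLow_self le_rfl b,
      S.src_inclLow_self le_rfl c, S.incl p, S.incl q, S.incl i, S.incl j,
      ⟨S.src_incl_self p, S.src_incl_iff.2 p1, S.tgt_incl_iff.2 p2⟩,
      ⟨S.src_incl_self q, S.src_incl_iff.2 q1, S.tgt_incl_iff.2 q2⟩,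
      ⟨S.src_incl_self i, S.src_incl_iff.2 i1, S.tgt_incl_iff.2 i2⟩,
      ⟨S.src_incl_self j, S.src_incl_iff.2 j1, S.tgt_incl_iff.2 j2⟩, hα, hβ, hγ⟩
  · rintro ⟨α, β, γ, -, -, -, p, q, i, j, ⟨hp, p1, p2⟩, ⟨hq, q1, q2⟩, ⟨hi, i1, i2⟩, ⟨hj, j1, j2⟩,
      hα, hβ, hγ⟩
    obtain ⟨p, rfl⟩ := S.exists_incl hp
    obtain ⟨q, rfl⟩ := S.exists_incl hq
    obtain ⟨i, rfl⟩ := S.exists_incl hi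
    obtain ⟨j, rfl⟩ := S.exists_incl hj
    rw [S.src_incl_iff] at p1 q1 i1 j1
    rw [S.tgt_incl_iff] at p2 q2 i2 j2
    have hs := LinCat.sameHom_comp p1 p2 i1 i2 q1 q2 j1 j2
    rw [S.comp_incl (by omega) (p2.trans i1.symm), S.comp_incl (by omega) (q2.trans j1.symm),
      S.add_incl hs] at hα
    rw [S.comp_incl (by omega) (i2.trans p1.symm)] at hβ
    rw [S.comp_incl (by omega) (j2.trans q1.symm)] at hγ
    refine ⟨S.cls p, S.cls q, S.cls i, S.cls j, ⟨congrArg S.cls p1, congrArg S.cls p2⟩,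
      ⟨congrArg S.cls q1, congrArg S.cls q2⟩, ⟨congrArg S.cls i1, congrArg S.cls i2⟩,
      ⟨congrArg S.cls j1, congrArg S.cls j2⟩, ?_, ?_, ?_⟩
    · rw [S.comp_cls le_rfl (p2.trans i1.symm), S.comp_cls le_rfl (q2.trans j1.symm), S.add_cls hs,
        S.cls_eq_iff]
      exact S.genRel_iff_exists_cell.2 ⟨α, hα⟩
    · rw [S.comp_cls le_rfl (i2.trans p1.symm), S.cls_eq_iff]
      exact S.genRel_iff_exists_cell.2 ⟨β, hβ⟩
    · rw [S.comp_cls le_rfl (j2.trans q1.symm), S.cls_eq_iff]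
      exact S.genRel_iff_exists_cell.2 ⟨γ, hγ⟩

/-! ### Comparison of the two congruences and conclusion. -/

variable {S} {C : LinCat.{v'} R (n + 2) (n + 1)} (e : LinIso S.presented C)

/-- The `(n+1)`-cells of a linear `(n+2,n+2)`-category presented by `S` are those of the free
`(n+1)`-category on the underlying `(n+1)`-polygraph. -/
noncomputable def truncIso : NCatIso S.pol.lower.free C.trunc where
  toEquiv := Equiv.ofBijective
    (fun x => ⟨e.toFun (S.cls (S.lowCell x)), by
      rw [← e.map_src, S.src_cls, S.src_lowCell_self]⟩)
    ⟨fun x y h => S.cls_lowCell_injective (e.toEquiv.injective (congrArg Subtype.val h)), by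
      rintro ⟨c, hc⟩
      obtain ⟨c, rfl⟩ := e.toEquiv.surjective c
      obtain ⟨f, rfl⟩ := S.exists_cls c
      -- The representative `f` need not be low-dimensional, but its class equals its own source.
      -- Hence it is also the class of the `(n+1)`-source of `f`, which comes from the free
      -- `(n+1)`-category.
      have h : S.presented.src (n + 1) (S.cls f) = S.cls f :=
        e.toEquiv.injective ((e.map_src _ _).trans hc)
      obtain ⟨x, hx⟩ := S.exists_lowCell ((lin R S.pol.free).src_src_of_le f (le_refl (n + 1)))
      refine ⟨x, Subtype.ext (congrArg e.toFun ?_)⟩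
      rw [← hx, ← S.src_cls, h]⟩
  map_src k x := Subtype.ext (by
    change e.toFun (S.cls (S.lowCell _)) = C.src k (e.toFun (S.cls (S.lowCell x)))
    rw [← e.map_src, S.src_cls, S.src_lowCell])
  map_tgt k x := Subtype.ext (by
    change e.toFun (S.cls (S.lowCell _)) = C.tgt k (e.toFun (S.cls (S.lowCell x)))
    rw [← e.map_tgt, S.tgt_cls, S.tgt_lowCell])
  map_comp k x y h := by
    have h1 : (lin R S.pol.free).tgt k (S.lowCell x) = (lin R S.pol.free).src k (S.lowCell y) := by
      rw [S.tgt_lowCell, S.src_lowCell, h]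
    have h2 : S.presented.tgt k (S.cls (S.lowCell x)) = S.presented.src k (S.cls (S.lowCell y)) :=
      congrArg S.cls h1
    refine Subtype.ext (Eq.trans ?_ (NCat.trunc_comp (C := C.toNCat) (Subtype.ext ?_)).symm)
    · change e.toFun (S.cls (S.lowCell _)) =
        C.comp k (e.toFun (S.cls (S.lowCell x))) (e.toFun (S.cls (S.lowCell y)))
      rw [← e.map_comp _ _ _ h2, ← S.comp_lowCell k h]
      rcases le_or_gt k (n + 1) with hk | hk
      · rw [S.comp_cls hk h1]
      -- Compositions along dimensions `k > n + 1` are trivial on both sides.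
      · rw [NCat.comp_top hk _ _ h1, NCat.comp_top hk _ _ h2]
    · exact e.tgt_eq_src h2

theorem isomorphic_truncIso_iff {x y : S.pol.lower.free.cell} :
    C.Isomorphic ((truncIso e).toFun x).1 ((truncIso e).toFun y).1 ↔
      S.presented.Isomorphic (S.cls (S.lowCell x)) (S.cls (S.lowCell y)) := e.isomorphic_iff.symm

theorem isDirectSum_truncIso_iff {a b c : S.pol.lower.free.cell} :
    C.IsDirectSum ((truncIso e).toFun a).1 ((truncIso e).toFun b).1 ((truncIso e).toFun c).1 ↔
      S.presented.IsDirectSum (S.cls (S.lowCell a)) (S.cls (S.lowCell b))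
        (S.cls (S.lowCell c)) := e.isDirectSum_iff.symm

/-- An isomorphism in `C` gives one in the presented category, hence an isomorphism proof, which
reduces to minimal ones. Proofs only relate distinct cells, so equal cells are treated apart, by
reflexivity. -/
theorem genRel_of_isomorphic {x y : S.pol.lower.free.cell}
    (h : C.Isomorphic ((truncIso e).toFun x).1 ((truncIso e).toFun y).1) :
    S.grothendieck.GenRel (LinCell.ofCell x : LinCell ℤ S.pol.lower.free)
      (LinCell.ofCell y : LinCell ℤ S.pol.lower.free) := by
  rcases eq_or_ne x y with rfl | hxy
  · exact .refl _
  · obtain ⟨α, β, h⟩ := (S.isomorphic_iff_exists_proof hxy).1 ((isomorphic_truncIso_iff e).1 h)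
    exact S.genRel_of_isoProof x y α β h

/-- The same route as for isomorphisms, except that direct sum proofs carry no distinctness
condition and no case has to be separated. -/
theorem genRel_of_isDirectSum {a b c : S.pol.lower.free.cell}
    (h : C.IsDirectSum ((truncIso e).toFun a).1 ((truncIso e).toFun b).1
      ((truncIso e).toFun c).1) :
    S.grothendieck.GenRel (LinCell.ofCell a : LinCell ℤ S.pol.lower.free)
      (LinCell.add (LinCell.ofCell b : LinCell ℤ S.pol.lower.free) (LinCell.ofCell c)) := by
  obtain ⟨α, β, γ, h⟩ := S.isDirectSum_iff_exists_proof.1 ((isDirectSum_truncIso_iff e).1 h)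
  exact S.genRel_of_sumProof a b c α β γ h

theorem src_truncIso_iff {k : ℕ} {x y : S.pol.lower.free.cell} :
    C.trunc.src k ((truncIso e).toFun x) = (truncIso e).toFun y ↔ S.pol.lower.free.src k x = y := by
  rw [← (truncIso e).map_src]; exact (truncIso e).toEquiv.injective.eq_iff

theorem tgt_truncIso_iff {k : ℕ} {x y : S.pol.lower.free.cell} :
    C.trunc.tgt k ((truncIso e).toFun x) = (truncIso e).toFun y ↔ S.pol.lower.free.tgt k x = y := by
  rw [← (truncIso e).map_tgt]; exact (truncIso e).toEquiv.injective.eq_iff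

/-- The relations of the polygraph `S.grothendieck` hold in the Grothendieck decategorification. -/
theorem rel_of_genRel {f g : (lin ℤ S.grothendieck.pol.free).cell}
    (h : S.grothendieck.GenRel f g) :
    C.grothendieckCong.r (LinCell.map (truncIso e) f) (LinCell.map (truncIso e) g) := by
  -- Viewing the map as an isomorphism of linear categories makes the congruence on the target pull
  -- back to a congruence on the source; only the generating cells need an argument.
  let Φ : LinIso (lin ℤ S.pol.lower.free) (lin ℤ C.trunc) := (truncIso e).lin ℤ
  change C.grothendieckCong.r (Φ.toFun f) (Φ.toFun g)
  induction h with
  | gen γ =>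
    rcases γ with ⟨⟨x, y⟩, hp, hxy, α, β, hm⟩ | ⟨⟨a, b, c⟩, ⟨hb, hc⟩, α, β, γ, hm⟩
    · have hi := (isomorphic_truncIso_iff e).2
        ((S.isomorphic_iff_exists_proof hxy).2 ⟨α, β, hm.1⟩)
      have hs := hp n n.lt_succ_self
      change C.grothendieckCong.r (LinCell.map (truncIso e) (LinCell.ofCell x))
        (LinCell.map (truncIso e) (LinCell.ofCell y))
      rw [LinCell.map_ofCell, LinCell.map_ofCell]
      have e1 : C.trunc.src n ((truncIso e).toFun x) = C.trunc.src n ((truncIso e).toFun y) := by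
        rw [← (truncIso e).map_src, ← (truncIso e).map_src]; exact congrArg _ hs.1
      have e2 : C.trunc.tgt n ((truncIso e).toFun x) = C.trunc.tgt n ((truncIso e).toFun y) := by
        rw [← (truncIso e).map_tgt, ← (truncIso e).map_tgt]; exact congrArg _ hs.2
      exact ⟨e1, e2, AddSubgroup.subset_closure (.iso _ _ rfl rfl e1.symm e2.symm hi)⟩
    · have hi := (isDirectSum_truncIso_iff e).2
        (S.isDirectSum_iff_exists_proof.2 ⟨α, β, γ, hm.1⟩)
      have hb := hb n n.lt_succ_self
      have hc := hc n n.lt_succ_self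
      have hbc : S.pol.lower.free.src n b = S.pol.lower.free.src n c ∧
        S.pol.lower.free.tgt n b = S.pol.lower.free.tgt n c :=
        ⟨hb.1.symm.trans hc.1, hb.2.symm.trans hc.2⟩
      change C.grothendieckCong.r (LinCell.map (truncIso e) (LinCell.ofCell a))
        (LinCell.map (truncIso e) (LinCell.add (LinCell.ofCell b) (LinCell.ofCell c)))
      rw [LinCell.map_ofCell, LinCell.map_add _ hbc.1 hbc.2, LinCell.map_ofCell,
        LinCell.map_ofCell]
      have key1 : ∀ {x y : S.pol.lower.free.cell},
          S.pol.lower.free.src n x = S.pol.lower.free.src n y →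
          C.trunc.src n ((truncIso e).toFun x) = C.trunc.src n ((truncIso e).toFun y) := by
        intro x y h
        rw [← (truncIso e).map_src, ← (truncIso e).map_src, h]
      have key2 : ∀ {x y : S.pol.lower.free.cell},
          S.pol.lower.free.tgt n x = S.pol.lower.free.tgt n y →
          C.trunc.tgt n ((truncIso e).toFun x) = C.trunc.tgt n ((truncIso e).toFun y) := by
        intro x y h
        rw [← (truncIso e).map_tgt, ← (truncIso e).map_tgt, h]
      refine ⟨key1 hb.1, key2 hb.2, ?_⟩
      rw [LinCell.add_eq (key1 hbc.1) (key2 hbc.2)]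
      exact AddSubgroup.subset_closure (.sum _ _ _ rfl rfl (key1 hb.1).symm (key2 hb.2).symm
        (key1 hc.1).symm (key2 hc.2).symm hi)
  | refl f => exact C.grothendieckCong.iseqv.refl _
  | symm _ ih => exact C.grothendieckCong.iseqv.symm ih
  | trans _ _ ih ih' => exact C.grothendieckCong.iseqv.trans ih ih'
  | @comp k f f' g g' hk r r' hc ih ih' =>
    -- The second pair is composable too, since congruent cells have the same boundary; this is
    -- needed to push its composite through `Φ`.
    have hc' : (lin ℤ S.pol.lower.free).tgt k f' = (lin ℤ S.pol.lower.free).src k g' :=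
      ((r.sameHom S.grothendieck).tgt hk).symm.trans
        (hc.trans ((r'.sameHom S.grothendieck).src hk))
    have e1 := Φ.map_comp k f g hc
    have e2 := Φ.map_comp k f' g' hc'
    have := C.grothendieckCong.rel_comp hk ih ih' (Φ.tgt_eq_src hc)
    rw [← e1, ← e2] at this
    exact this
  | @add f f' g g' r r' hs ih ih' =>
    have h1 := r.sameHom S.grothendieck
    have h2 := r'.sameHom S.grothendieck
    have hs' : (lin ℤ S.pol.lower.free).SameHom n f' g' :=
      ⟨h1.1.symm.trans (hs.1.trans h2.1), h1.2.symm.trans (hs.2.trans h2.2)⟩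
    have e1 := Φ.map_add f g hs
    have e2 := Φ.map_add f' g' hs'
    have := C.grothendieckCong.rel_add ih ih' (Φ.sameHom hs)
    rw [← e1, ← e2] at this
    exact this
  | @smul f f' a _ ih =>
    have e1 := Φ.map_smul a f
    have e2 := Φ.map_smul a f'
    have := C.grothendieckCong.rel_smul a ih
    rw [← e1, ← e2] at this
    exact this

/-- Each combination of relators of the Grothendieck decategorification is a difference of cells
identified by the generating cells of the polygraph `S.grothendieck`. -/
theorem exists_genRel_of_mem_relators (f : LinCell ℤ S.pol.lower.free) {d : C.trunc.cell →₀ ℤ}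
    (hd : d ∈ C.relators ((truncIso e).toFun f.s) ((truncIso e).toFun f.t)) :
    ∃ c c' : LinCell ℤ S.pol.lower.free, S.grothendieck.GenRel c c' ∧ (c.s = f.s ∧ c.t = f.t) ∧
      (c'.s = f.s ∧ c'.t = f.t) ∧
      (LinCell.map (truncIso e) c).m - (LinCell.map (truncIso e) c').m = d := by
  -- The boundary stays that of `f` throughout, so the pairs obtained for different elements of the
  -- subgroup can always be added.
  induction hd using AddSubgroup.closure_induction with
  | mem d hd =>
    rcases hd with ⟨x, y, h1, h2, h3, h4, h5⟩ | ⟨a, b, c, h1, h2, h3, h4, h5, h6, h7⟩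
    · obtain ⟨x, rfl⟩ := (truncIso e).toEquiv.surjective x
      obtain ⟨y, rfl⟩ := (truncIso e).toEquiv.surjective y
      refine ⟨LinCell.ofCell x, LinCell.ofCell y, genRel_of_isomorphic e h5,
        ⟨(src_truncIso_iff e).1 h1, (tgt_truncIso_iff e).1 h2⟩,
        ⟨(src_truncIso_iff e).1 h3, (tgt_truncIso_iff e).1 h4⟩, ?_⟩
      rw [LinCell.map_ofCell, LinCell.map_ofCell]
      rfl
    · obtain ⟨a, rfl⟩ := (truncIso e).toEquiv.surjective a
      obtain ⟨b, rfl⟩ := (truncIso e).toEquiv.surjective b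
      obtain ⟨c, rfl⟩ := (truncIso e).toEquiv.surjective c
      have hb : (LinCell.ofCell b : LinCell ℤ S.pol.lower.free).s = f.s ∧
          (LinCell.ofCell b : LinCell ℤ S.pol.lower.free).t = f.t :=
        ⟨(src_truncIso_iff e).1 h3, (tgt_truncIso_iff e).1 h4⟩
      have hc : (LinCell.ofCell c : LinCell ℤ S.pol.lower.free).s = f.s ∧
          (LinCell.ofCell c : LinCell ℤ S.pol.lower.free).t = f.t :=
        ⟨(src_truncIso_iff e).1 h5, (tgt_truncIso_iff e).1 h6⟩
      refine ⟨LinCell.ofCell a, LinCell.add (LinCell.ofCell b) (LinCell.ofCell c),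
        genRel_of_isDirectSum e h7, ⟨(src_truncIso_iff e).1 h1, (tgt_truncIso_iff e).1 h2⟩,
        hb, ?_⟩
      rw [LinCell.map_add _ (hb.1.trans hc.1.symm) (hb.2.trans hc.2.symm), LinCell.map_ofCell,
        LinCell.map_ofCell, LinCell.map_ofCell, LinCell.add_eq (h3.trans h5.symm)
          (h4.trans h6.symm)]
      rfl
  -- Any cell with the prescribed boundary would do for both members of the pair; `f` is at hand.
  | zero => exact ⟨f, f, .refl _, ⟨rfl, rfl⟩, ⟨rfl, rfl⟩, sub_self _⟩
  | add d d' _ _ ih ih' =>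
    obtain ⟨a, a', ra, ⟨h1, h2⟩, ⟨h3, h4⟩, rfl⟩ := ih
    obtain ⟨b, b', rb, ⟨h5, h6⟩, ⟨h7, h8⟩, rfl⟩ := ih'
    have e1 := h1.trans h5.symm
    have e2 := h2.trans h6.symm
    have e3 := h3.trans h7.symm
    have e4 := h4.trans h8.symm
    refine ⟨LinCell.add a b, LinCell.add a' b', .add ra rb (LinCell.sameHom_iff.2 ⟨e1, e2⟩),
      ⟨h1, h2⟩, ⟨h3, h4⟩, ?_⟩
    rw [LinCell.map_add _ e1 e2, LinCell.map_add _ e3 e4,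
      LinCell.add_eq (congrArg (truncIso e).toFun e1) (congrArg (truncIso e).toFun e2),
      LinCell.add_eq (congrArg (truncIso e).toFun e3) (congrArg (truncIso e).toFun e4),
      add_sub_add_comm]
  | neg d _ ih =>
    obtain ⟨c, c', r, h, h', rfl⟩ := ih
    -- A difference is negated by exchanging its two members, which symmetry of the congruence
    -- allows.
    exact ⟨c', c, r.symm, h', h, (neg_sub _ _).symm⟩

/-- The relations of the Grothendieck decategorification follow from those of the polygraph
`S.grothendieck`. -/
theorem genRel_of_rel {f g : LinCell ℤ S.pol.lower.free}
    (h : C.grothendieckCong.r (LinCell.map (truncIso e) f) (LinCell.map (truncIso e) g)) :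
    S.grothendieck.GenRel f g := by
  obtain ⟨h1, h2, h3⟩ := h
  replace h1 : f.s = g.s := (truncIso e).toEquiv.injective h1
  replace h2 : f.t = g.t := (truncIso e).toEquiv.injective h2
  obtain ⟨c, c', r, ⟨c1, c2⟩, ⟨c3, c4⟩, hd⟩ := exists_genRel_of_mem_relators e f h3
  -- The equation is known only after transport to cells of `C`. Transport is injective and additive
  -- on formal combinations, so it already holds in the free category.
  have hm : c.m - c'.m = f.m - g.m := by
    refine Finsupp.mapDomain_injective (truncIso e).toEquiv.injective ?_
    refine (map_sub (Finsupp.mapDomain.addMonoidHom (truncIso e).toEquiv) c.m c'.m).trans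
      (Eq.trans ?_ (map_sub (Finsupp.mapDomain.addMonoidHom (truncIso e).toEquiv) f.m g.m).symm)
    exact hd
  have gc : (lin ℤ S.pol.lower.free).SameHom n g c :=
    LinCell.sameHom_iff.2 ⟨h1.symm.trans c1.symm, h2.symm.trans c2.symm⟩
  have k1 : g.s = c.s := h1.symm.trans c1.symm
  have k2 : g.t = c.t := h2.symm.trans c2.symm
  have k3 : g.s = c'.s := h1.symm.trans c3.symm
  have k4 : g.t = c'.t := h2.symm.trans c4.symm
  have key : ∀ x : LinCell ℤ S.pol.lower.free, g.s = x.s → g.t = x.t →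
      (LinCell.add (LinCell.add g x) (LinCell.smul (-1) c')).m = g.m + x.m - c'.m := by
    intro x x1 x2
    rw [LinCell.add_eq (c := LinCell.add g x) (d := LinCell.smul (-1) c') k3 k4, LinCell.add_eq x1 x2, sub_eq_add_neg]
    exact congrArg _ (neg_one_smul ℤ c'.m)
  -- Adding `g - c'` to both sides of the congruence between `c` and `c'` gives one between `g + c -
  -- c'` and `g + c' - c'`. The first is `f` because `c - c' = f - g`, and the second is `g`.
  have r' : S.grothendieck.GenRel (LinCell.add (LinCell.add g c) (LinCell.smul (-1) c'))
      (LinCell.add (LinCell.add g c') (LinCell.smul (-1) c')) :=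
    .add (.add (.refl (S := S.grothendieck) _) r gc) (.refl _) (LinCell.sameHom_iff.2 ⟨k3, k4⟩)
  have ef : LinCell.add (LinCell.add g c) (LinCell.smul (-1) c') = f :=
    LinCell.ext_of ⟨h1.symm, h2.symm⟩ (by
      rw [key c k1 k2, add_sub_assoc, hm, add_sub_cancel])
  have eg : LinCell.add (LinCell.add g c') (LinCell.smul (-1) c') = g :=
    LinCell.ext_of ⟨rfl, rfl⟩ (by rw [key c' k3 k4, add_sub_cancel_right])
  exact Eq.mp (congrArg₂ S.grothendieck.GenRel ef eg) r'

end LinPol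

/-- The isomorphism of free ℤ-linear categories induced by `truncIso` matches the two congruences in
both directions, so it descends to the quotients. -/
theorem mainTheorem4 {R : Type w} [CommRing R] (n : ℕ) (S : LinPol.{u, v} R (n + 1))
    (C : LinCat.{v'} R (n + 2) (n + 1)) (h : S.Presents C) :
    S.grothendieck.Presents C.grothendieck := by
  obtain ⟨e⟩ := h
  exact ⟨((LinPol.truncIso e).lin ℤ).quot S.grothendieck.genCong C.grothendieckCong
    fun _ _ => ⟨LinPol.rel_of_genRel e, LinPol.genRel_of_rel e⟩⟩
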